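/- **Lemma 4.4 (Higher integrability of the pressure).** *Setting.* Let $N\in\{2,3\}$, let $\Omega\subset\mathbb R^N$ be a simply connected, bounded, open, polygonal (polyhedral) domain with Lipschitz boundary, and let $T>0$. Let $a>0$, $\gamma>1$, $p(\varrho)=a\varrho^\gamma$, and let $\mu>0$, $N\lambda+2\mu\ge 0$. Let $f\in L^2((0,T)\times\Omega;\mathbb R^N)$ and $\varrho_0\in L^\gamma(\Omega)$. *Meshes and spaces.* Let $\{E_h\}_h$ be a family of conforming simplicial meshes of $\Omega$ ($h$ is the maximal element diameter) that is shape regular: for some $\kappa>0$, every element $E$ contains a ball of radius at least $\operatorname{diam}(E)/\kappa$. Let the time steps satisfy $\Delta t=c\,h$ with a constant $c>0$ and $M\Delta t=T$ with $M\in\mathbb N$, and put $t^m=m\Delta t$. On each mesh, fix one unit normal $\nu$ for each face ($(N-1)$-dimensional). An interior face is a face not contained in $\partial\Omega$. For an interior face $\Gamma$, let $E_-,E_+$ be the two elements sharing it, with $\nu$ pointing from $E_-$ to $E_+$. Denote by $g_\pm$ the trace of $g$ on $\Gamma$ from within $E_\pm$, $[g]_\Gamma=g_+-g_-$, $s^+=\max\{s,0\}$,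 $s^-=\min\{s,0\}$. Let * $Q_h$ be the functions that are constant on each element; * $V_h$ be the vector fields of the form $a_E+b_Ex$ ($a_E\in\mathbb R^N$, $b_E\in\mathbb R$) on each element $E$, whose degrees of freedom $\int_\Gamma v\cdot\nu\,dS$ from the elements sharing a face $\Gamma$ coincide, and vanish if $\Gamma\subset\partial\Omega$; * $W_h$ be, if $N=2$, the scalar functions that are affine on each element, coincide at shared vertices and vanish at vertices on $\partial\Omega$; and, if $N=3$, the vector fields of the form $a_E+b_E\times x$ ($a_E,b_E\in\mathbb R^3$) on each element $E$, whose degrees of freedom $\int_e w\cdot\tau$ from the elements sharing an edge $e$ with unit tangent $\tau$ coincide, and vanish if $e\subset\partial\Omega$. The operators $\operatorname{div}$ and $\operatorname{curl}$ are taken element by element; for $N=2$ and scalar $w$, $\operatorname{curl}w=(\partial_2w,-\partial_1w)$. *Numerical method.* For each $h$ let $\varrho_h^0\in Q_h$ with $\varrho_h^0>0$. Assume that $\varrho_h^0\to\varrho_0$ a.e. in $\Omega$ and in $L^1(\Omega)$ as $h\to0$, and that $\varrho_h^0$ is bounded in $L^\gamma(\Omega)$ uniformly in $h$. Let $f_h^m=\frac1{\Delta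 t}\int_{t^{m-1}}^{t^m}\Pi_h^Qf(s,\cdot)\,ds$, where $\Pi_h^Q$ replaces a function by its mean value on each element. Let $(\varrho_h^m,w_h^m,u_h^m)\in Q_h\times W_h\times V_h$, $m=1,\dots,M$, satisfy $$\int_\Omega\varrho_h^m\phi_h\,dx-\Delta t\sum_{\Gamma\text{ interior}}\int_\Gamma\big(\varrho_-^m(u_h^m\cdot\nu)^++\varrho_+^m(u_h^m\cdot\nu)^-\big)[\phi_h]_\Gamma\,dS=\int_\Omega\varrho_h^{m-1}\phi_h\,dx,$$ $$\int_\Omega\mu\operatorname{curl}w_h^m\cdot v_h+\big[(\mu+\lambda)\operatorname{div}u_h^m-p(\varrho_h^m)\big]\operatorname{div}v_h\,dx=\int_\Omega f_h^m\cdot v_h\,dx,$$ $$\int_\Omega w_h^m\cdot\eta_h-u_h^m\cdot\operatorname{curl}\eta_h\,dx=0$$ for all $\phi_h\in Q_h$, $v_h\in V_h$, $\eta_h\in W_h$, and set $\varrho_h(t,\cdot)=\varrho_h^m$ for $t\in(t^{m-1},t^m]$. *Claim.* There is a constant $C$, independent of $h$, such that $p(\varrho_h)\in L^2((0,T)\times\Omega)$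 and $$\|p(\varrho_h)\|_{L^2((0,T)\times\Omega)}\le C\qquad\text{for all }h.$$ -/

import Mathlib

noncomputable section

namespace CompressibleStokes

open MeasureTheory

/-- The Euclidean space `ℝ^N`. -/
abbrev Pt (N : ℕ) := EuclideanSpace ℝ (Fin N)

/-! ### Domains and meshes -/

/-- The boundary of `Ω` is Lipschitz: near each boundary point there is a unit direction `ν` such
that `Ω` is the set of points lying below the graph of a Lipschitz function over the hyperplane
orthogonal to `ν`. (The function `g` is only evaluated at the orthogonal projection
`x - ⟪ν, x⟫ ν` of `x` onto that hyperplane.) -/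
def HasLipschitzBoundary {N : ℕ} (Ω : Set (Pt N)) : Prop :=
  ∀ x₀ ∈ frontier Ω, ∃ U ∈ nhds x₀, ∃ (ν : Pt N) (K : NNReal) (g : Pt N → ℝ),
    ‖ν‖ = 1 ∧ LipschitzWith K g ∧
      ∀ x ∈ U, (x ∈ Ω ↔ inner ℝ ν x < g (x - (inner ℝ ν x) • ν))

/-- The closed simplex with vertex set `s`. -/
abbrev conv {N : ℕ} (s : Finset (Pt N)) : Set (Pt N) := convexHull ℝ (s : Set (Pt N))

/-- A (conforming) simplicial mesh of `Ω`: a finite pure `N`-dimensional simplicial complex whose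
underlying space is `closure Ω` (so a set that has a mesh is polygonal), together with a fixed
choice of one of the two unit normals on each `(N-1)`-dimensional face. Simplices are given by
their vertex sets. -/
structure Mesh {N : ℕ} (Ω : Set (Pt N)) where
  complex : Geometry.SimplicialComplex ℝ (Pt N)
  finite : complex.faces.Finite
  pure : ∀ s ∈ complex.faces, ∃ t ∈ complex.faces, s ⊆ t ∧ t.card = N + 1
  space_eq : complex.space = closure Ω
  normal : Finset (Pt N) → Pt N
  norm_normal : ∀ s ∈ complex.faces, s.card = N → ‖normal s‖ = 1
  normal_orthogonal : ∀ s ∈ complex.faces, s.card = N →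
    ∀ x ∈ s, ∀ y ∈ s, inner ℝ (normal s) (x - y) = 0

namespace Mesh

variable {N : ℕ} {Ω : Set (Pt N)} (T : Mesh Ω)

/-- The elements `E ∈ E_h` (triangles if `N = 2`, tetrahedra if `N = 3`). -/
def elements : Finset (Finset (Pt N)) := {s ∈ T.finite.toFinset | s.card = N + 1}

/-- The faces `Γ ∈ Γ_h`, of dimension `N - 1`. -/
def faces : Finset (Finset (Pt N)) := {s ∈ T.finite.toFinset | s.card = N}

open Classical in
/-- The interior faces `Γ ∈ Γ_h`, those not contained in `∂Ω`. -/
def interiorFaces : Finset (Finset (Pt N)) := {s ∈ T.faces | ¬ conv s ⊆ frontier Ω}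

/-- The maximal diameter `h` of the elements. -/
def size : ℝ := sSup ((fun s => Metric.diam (conv s)) '' (T.elements : Set (Finset (Pt N))))

/-- Shape regularity with constant `κ`: every element `E` contains a ball of radius at least
`diam E / κ`. -/
def ShapeRegular (κ : ℝ) : Prop :=
  ∀ s ∈ T.elements, ∃ (x : Pt N) (r : ℝ), Metric.diam (conv s) / κ ≤ r ∧
    Metric.ball x r ⊆ conv s

open Classical in
/-- The elements adjacent to `Γ` that lie on the side of `Γ` that the vector `n` points to. An
interior face of a mesh has exactly one such element for `n = ν` (the element `E_+`) and exactly
one for `n = -ν` (the element `E_-`), `ν` being the chosen normal. -/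
def side (Γ : Finset (Pt N)) (n : Pt N) : Finset (Finset (Pt N)) :=
  {s ∈ T.elements | Γ ⊆ s ∧ ∀ x ∈ s, ∀ y ∈ Γ, 0 ≤ inner ℝ n (x - y)}

/-- The trace `q_+` on the face `Γ` of an element-wise given quantity `q`, from within the element
`E_+` that the chosen normal points to. -/
def tracePlus {A : Type*} [AddCommMonoid A] (q : Finset (Pt N) → A) (Γ : Finset (Pt N)) : A :=
  ∑ s ∈ T.side Γ (T.normal Γ), q s

/-- The trace `q_-` on the face `Γ`, from within the element `E_-` that the chosen normal points
away from. -/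
def traceMinus {A : Type*} [AddCommMonoid A] (q : Finset (Pt N) → A) (Γ : Finset (Pt N)) : A :=
  ∑ s ∈ T.side Γ (-T.normal Γ), q s

end Mesh

/-! ### Finite element spaces

A function that is polynomial on each element is represented by the family, indexed by the
elements, of these polynomials (a value at an index that is not an element is never used). Its
trace on a face from within `E` is then the restriction of the polynomial belonging to `E`, and
its integral over `Ω` is the sum of the integrals over the elements. -/

/-- The integral over `Ω` of an element-wise given function. -/
def Mesh.integral {N : ℕ} {Ω : Set (Pt N)} (T : Mesh Ω) (g : Finset (Pt N) → Pt N → ℝ) : ℝ :=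
  ∑ s ∈ T.elements, ∫ x in conv s, g s x

/-- Piecewise constant functions, the space `Q_h`: one real number per element. -/
abbrev PiecewiseConst (N : ℕ) := Finset (Pt N) → ℝ

/-- The function on `ℝ^N` given by a member of `Q_h`. It takes the value `q s` in the open
simplex `s` (and `0` on the null set of the faces and outside of the mesh). -/
def Mesh.toFun {N : ℕ} {Ω : Set (Pt N)} (T : Mesh Ω) (q : PiecewiseConst N) (x : Pt N) : ℝ :=
  ∑ s ∈ T.elements, (interior (conv s)).indicator (fun _ => q s) x

/-- The number of components of the vorticity: a scalar if `N = 2`, a vector if `N = 3`. -/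
abbrev vortDim : ℕ → ℕ
  | 2 => 1
  | _ => 3

/-- The partial derivative `∂_j v_i` at `x`. -/
def partialDeriv {N k : ℕ} (j : Fin N) (v : Pt N → Pt k) (i : Fin k) (x : Pt N) : ℝ :=
  fderiv ℝ v x (EuclideanSpace.single j 1) i

/-- The divergence of a vector field. -/
def divergence {N : ℕ} (v : Pt N → Pt N) (x : Pt N) : ℝ := ∑ i, partialDeriv i v i x

/-- The curl. If `N = 2` it maps the scalar `w` to the vector field `(∂₂ w, -∂₁ w)`, and if
`N = 3` it is the usual curl of a vector field. Other dimensions are not used. -/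
def curl : (N : ℕ) → (Pt N → Pt (vortDim N)) → Pt N → Pt N
  | 2, w, x => !₂[partialDeriv 1 w 0 x, -partialDeriv 0 w 0 x]
  | 3, w, x => !₂[partialDeriv 1 w 2 x - partialDeriv 2 w 1 x,
      partialDeriv 2 w 0 x - partialDeriv 0 w 2 x,
      partialDeriv 0 w 1 x - partialDeriv 1 w 0 x]
  | _, _, _ => 0

/-- The `(N-1)`-dimensional surface measure `dS` on the face `Γ`. -/
def surface {N : ℕ} (Γ : Finset (Pt N)) : Measure (Pt N) :=
  (Measure.euclideanHausdorffMeasure (N - 1)).restrict (conv Γ)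

/-- The space `V_h`: on each element the field is of the form `a + b x` with `a ∈ ℝ^N`, `b ∈ ℝ`;
the degrees of freedom `∫_Γ v · ν dS` of the elements sharing a face match, and they vanish on
the faces on the boundary. -/
structure Mesh.MemV {N : ℕ} {Ω : Set (Pt N)} (T : Mesh Ω) (v : Finset (Pt N) → Pt N → Pt N) :
    Prop where
  local_form : ∀ s ∈ T.elements, ∃ (a : Pt N) (b : ℝ), ∀ x, v s x = a + b • x
  matching : ∀ Γ ∈ T.faces, ∀ s ∈ T.elements, ∀ t ∈ T.elements, Γ ⊆ s → Γ ⊆ t →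
    ∫ x, inner ℝ (v s x) (T.normal Γ) ∂surface Γ = ∫ x, inner ℝ (v t x) (T.normal Γ) ∂surface Γ
  boundary : ∀ Γ ∈ T.faces, conv Γ ⊆ frontier Ω → ∀ s ∈ T.elements, Γ ⊆ s →
    ∫ x, inner ℝ (v s x) (T.normal Γ) ∂surface Γ = 0

/-- The space `W_h` for `N = 2`, linear Lagrange elements: on each element an affine scalar
function; the values at shared vertices match, and they vanish at the vertices on the boundary. -/
structure Mesh.MemW2 {Ω : Set (Pt 2)} (T : Mesh Ω) (w : Finset (Pt 2) → Pt 2 → Pt 1) :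
    Prop where
  local_form : ∀ s ∈ T.elements, ∃ (a : ℝ) (b : Pt 2), ∀ x, w s x = !₂[a + inner ℝ b x]
  matching : ∀ s ∈ T.elements, ∀ t ∈ T.elements, ∀ p ∈ s, p ∈ t → w s p = w t p
  boundary : ∀ s ∈ T.elements, ∀ p ∈ s, p ∈ frontier Ω → w s p = 0

/-- The degree of freedom `∫_e w · τ` of a vector field on the edge `e` from `p` to `q`, where `τ`
is the unit tangent that points from `p` to `q`. -/
def edgeIntegral {N : ℕ} (w : Pt N → Pt N) (p q : Pt N) : ℝ :=
  ∫ t in (0 : ℝ)..1, inner ℝ (w (p + t • (q - p))) (q - p)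

/-- The space `W_h` for `N = 3`, lowest order curl-conforming Nédélec elements of the first kind:
on each element the field is of the form `a + b × x` with `a, b ∈ ℝ³`; the degrees of freedom
`∫_e w · τ` on shared edges match, and they vanish on the edges on the boundary. -/
structure Mesh.MemW3 {Ω : Set (Pt 3)} (T : Mesh Ω) (w : Finset (Pt 3) → Pt 3 → Pt 3) :
    Prop where
  local_form : ∀ s ∈ T.elements, ∃ a b : Pt 3, ∀ x, w s x = a +
    !₂[b 1 * x 2 - b 2 * x 1, b 2 * x 0 - b 0 * x 2, b 0 * x 1 - b 1 * x 0]
  matching : ∀ s ∈ T.elements, ∀ t ∈ T.elements, ∀ p ∈ s, ∀ q ∈ s, p ∈ t → q ∈ t →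
    edgeIntegral (w s) p q = edgeIntegral (w t) p q
  boundary : ∀ s ∈ T.elements, ∀ p ∈ s, ∀ q ∈ s, segment ℝ p q ⊆ frontier Ω →
    edgeIntegral (w s) p q = 0

/-- The space `W_h`. Only the dimensions `2` and `3` are used. -/
def Mesh.MemW : {N : ℕ} → {Ω : Set (Pt N)} → (T : Mesh Ω) →
    (Finset (Pt N) → Pt N → Pt (vortDim N)) → Prop
  | 2, _, T, w => T.MemW2 w
  | 3, _, T, w => T.MemW3 w
  | _, _, _, _ => False

/-! ### The numerical method -/

/-- The pressure `p(ϱ) = a ϱ^γ`. -/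
def pressure (a γ r : ℝ) : ℝ := a * r ^ γ

/-- The discrete source term on the element `s` in the time interval `(t^{m-1}, t^m)`,
`t^m = m Δt`: the time average of the `L²`-projection of `f` onto piecewise constants. -/
def discreteSource {N : ℕ} (f : ℝ → Pt N → Pt N) (dt : ℝ) (m : ℕ) (s : Finset (Pt N)) : Pt N :=
  dt⁻¹ • ∫ τ in (((m : ℝ) - 1) * dt)..((m : ℝ) * dt),
    (volume.real (conv s))⁻¹ • ∫ x in conv s, f τ x

/-- The upwind flux `ϱ_- (u·ν)^+ + ϱ_+ (u·ν)^-` at the point `x` of the interior face `Γ`. Here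
`u·ν` has the same trace from both sides for `u ∈ V_h`. -/
def Mesh.upwindFlux {N : ℕ} {Ω : Set (Pt N)} (T : Mesh Ω) (ρ : PiecewiseConst N)
    (u : Finset (Pt N) → Pt N → Pt N) (Γ : Finset (Pt N)) (x : Pt N) : ℝ :=
  T.traceMinus ρ Γ * max (inner ℝ (T.traceMinus u Γ x) (T.normal Γ)) 0 +
    T.tracePlus ρ Γ * min (inner ℝ (T.traceMinus u Γ x) (T.normal Γ)) 0

/-- `(ϱ^m, w^m, u^m)`, `m = 1, …, M`, solve the discrete problem on the mesh `T` with time step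
`dt`, initial density `ϱ^0`, viscosities `μ`, `lam` and pressure `a ϱ^γ`. -/
structure IsNumericalSolution {N : ℕ} {Ω : Set (Pt N)} (a γ μ lam : ℝ) (f : ℝ → Pt N → Pt N)
    (T : Mesh Ω) (dt : ℝ) (M : ℕ) (ρ : ℕ → PiecewiseConst N)
    (w : ℕ → Finset (Pt N) → Pt N → Pt (vortDim N))
    (u : ℕ → Finset (Pt N) → Pt N → Pt N) : Prop where
  /-- The initial density is strictly positive. -/
  initial_pos : ∀ s ∈ T.elements, 0 < ρ 0 s
  memW : ∀ m ∈ Finset.Icc 1 M, T.MemW (w m)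
  memV : ∀ m ∈ Finset.Icc 1 M, T.MemV (u m)
  /-- The upwind discontinuous Galerkin scheme for the continuity equation. -/
  continuity : ∀ m ∈ Finset.Icc 1 M, ∀ φ : PiecewiseConst N,
    T.integral (fun s _ => ρ m s * φ s) -
      dt * ∑ Γ ∈ T.interiorFaces, ∫ x,
        T.upwindFlux (ρ m) (u m) Γ x * (T.tracePlus φ Γ - T.traceMinus φ Γ) ∂surface Γ =
    T.integral (fun s _ => ρ (m - 1) s * φ s)
  /-- The momentum equation. -/
  momentum : ∀ m ∈ Finset.Icc 1 M, ∀ v, T.MemV v →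
    T.integral (fun s x => μ * inner ℝ (curl N (w m s) x) (v s x) +
      ((μ + lam) * divergence (u m s) x - pressure a γ (ρ m s)) * divergence (v s) x) =
    T.integral (fun s x => inner ℝ (discreteSource f dt m s) (v s x))
  /-- The equation for the vorticity. -/
  vorticity : ∀ m ∈ Finset.Icc 1 M, ∀ η, T.MemW η →
    T.integral (fun s x => inner ℝ (w m s x) (η s x) - inner ℝ (u m s x) (curl N (η s) x)) = 0

/-- The extension of the densities `ϱ^0, …, ϱ^M` to a function of `(t, x)`: it equals `ϱ^m` for
`t ∈ (t^{m-1}, t^m]`, and `ϱ^0` at `t = 0`. -/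
def densityFun {N : ℕ} {Ω : Set (Pt N)} (T : Mesh Ω) (dt : ℝ) (ρ : ℕ → PiecewiseConst N)
    (t : ℝ) (x : Pt N) : ℝ :=
  T.toFun (ρ ⌈t / dt⌉₊) x

end CompressibleStokes

end

open MeasureTheory

namespace CompressibleStokes

/-! ### Geometry of simplices -/

/-! Let `ν = μ + lam`, and let `G = ν div u - p` be the effective viscous flux, a constant on each
element. The momentum equation bounds the oscillation of `G` by the source alone. The energy balance
then bounds `ν div u`, so `p = ν div u - G` is bounded up to a constant at each time level, and
conservation of mass bounds that constant.

Oscillation of `G`. The momentum equation is tested with the Raviart–Thomas field `v` whose flux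
through an interior face `Γ` is `diam(Γ)^(N-2)` times the jump of `G`. By discrete integration by
parts, `∫ G div v` is the jump energy of `G`, and shape regularity bounds `‖v‖²` by a multiple of
the same energy (`integral_norm_raviartThomas_sq_le`). The vorticity term disappears when the `L²`
projection of `v` onto the line spanned by `curl w` is subtracted: `curl w` belongs to `V_h`
(`memV_curl`), and since it is constant on each element its divergence is zero. Hence the jump
energy of `G` is at most a constant times `‖f_h‖²`, with no estimate of `w` or `u`
(`jumpEnergy_le_of_momentum`).

Poincaré inequality. The jump energy dominates the squared `L²` distance to a constant, uniformly
over all shape regular meshes (`hasPoincare`). On a convex set, the values at `x` and `y` differ by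
at most the jumps along the segment between them. A face `Γ` matters only for `y` in its shadow as
seen from `x`, whose volume is at most of order `(diam Γ / (diam Γ + dist))^(N-1)`. Weighted
Cauchy–Schwarz and the integrability of the Riesz kernel finish the convex case; chains of
overlapping convex sets give the connected domain.

Energy. Testing the upwind scheme with the derivative of the convex function `a r^γ / (γ - 1)` gives
an energy inequality containing `∫ p div u` (`energy_of_upwind`). As `div u` has mean zero,
expanding the square of `ν div u - p - c` turns this into a bound for `‖ν div u‖²` by the initial
energy and the oscillation of `G` (`dissipation_le`). Finally, by Markov's inequality the density is
at most twice a bound for its mean on half of the domain, which controls the remaining constant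
(`sum_sq_le_of_mass`). -/

theorem measurableSet_conv {N : ℕ} (s : Finset (Pt N)) : MeasurableSet (conv s) :=
  (s.finite_toSet.isCompact_convexHull ℝ).isClosed.measurableSet

theorem isCompact_conv {N : ℕ} (s : Finset (Pt N)) : IsCompact (conv s) :=
  s.finite_toSet.isCompact_convexHull ℝ

theorem inner_eq_of_mem_conv {N : ℕ} {s : Finset (Pt N)} {n g : Pt N}
    (h : ∀ x ∈ s, inner ℝ n (x - g) = 0) {z : Pt N} (hz : z ∈ conv s) :
    inner ℝ n (z - g) = 0 := by
  have hconv : Convex ℝ {z : Pt N | inner ℝ n (z - g) = 0} := by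
    intro x hx y hy a b _ _ hab
    simp only [Set.mem_ofPred_eq, inner_sub_right, inner_add_right, inner_smul_right] at *
    have : inner ℝ n x = inner ℝ n g := by linarith
    have h2 : inner ℝ n y = inner ℝ n g := by linarith
    rw [this, h2, ← add_mul, hab]; ring
  exact convexHull_min (t := {z : Pt N | inner ℝ n (z - g) = 0}) (fun x hx => h x hx) hconv hz

theorem mem_conv_insert {N : ℕ} [DecidableEq (Pt N)] {Γ : Finset (Pt N)} (hΓ : Γ.Nonempty) {p y : Pt N} :
    y ∈ conv (insert p Γ) ↔ ∃ z ∈ conv Γ, ∃ r ∈ Set.Icc (0 : ℝ) 1, y = p + r • (z - p) := by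
  rw [conv, Finset.coe_insert, convexHull_insert (by simpa using hΓ)]
  simp only [convexJoin_singleton_left, Set.mem_iUnion, segment_eq_image', Set.mem_image,
    exists_prop]
  constructor
  · rintro ⟨z, hz, r, hr, rfl⟩; exact ⟨z, hz, r, hr, rfl⟩
  · rintro ⟨z, hz, r, hr, rfl⟩; exact ⟨z, hz, r, hr, rfl⟩

theorem lintegral_Ioc_zero_one_ofReal_pow (d : ℕ) :
    ((d + 1 : ℕ) : ENNReal) * ∫⁻ x in Set.Ioc (0 : ℝ) 1, ENNReal.ofReal x ^ d = 1 := by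
  have h1 : ∫⁻ x in Set.Ioc (0 : ℝ) 1, ENNReal.ofReal x ^ d
      = ENNReal.ofReal (∫ x in Set.Ioc (0 : ℝ) 1, x ^ d) := by
    rw [ofReal_integral_eq_lintegral_ofReal]
    · refine setLIntegral_congr_fun measurableSet_Ioc fun x hx => ?_
      simp only [ENNReal.ofReal_pow hx.1.le]
    · exact (intervalIntegral.intervalIntegrable_pow d (a := 0) (b := 1)).1
    · filter_upwards [ae_restrict_mem measurableSet_Ioc] with x hx
      exact pow_nonneg hx.1.le d
  rw [h1, ← intervalIntegral.integral_of_le zero_le_one, integral_pow,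
    ← ENNReal.ofReal_natCast, ← ENNReal.ofReal_mul (by positivity)]
  rw [← ENNReal.ofReal_one]
  congr 1
  push_cast
  field_simp
  simp

/-- The volume of a cone: `N |conv (insert p Γ)|` is the height times the surface of the base. -/
theorem volume_conv_insert {N : ℕ} [DecidableEq (Pt N)] (hN : 1 ≤ N) {Γ : Finset (Pt N)} {p n g : Pt N} (hn : ‖n‖ = 1)
    (hg : g ∈ Γ) (hΓ : ∀ x ∈ Γ, inner ℝ n (x - g) = 0) (hp : inner ℝ n (p - g) ≠ 0) :
    (N : ENNReal) * volume (conv (insert p Γ)) =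
      ENNReal.ofReal |inner ℝ n (p - g)| *
        Measure.euclideanHausdorffMeasure (N - 1) (conv Γ) := by
  have hne : Γ.Nonempty := ⟨g, hg⟩
  set H : ℝ := inner ℝ n (g - p) with hH
  have hH' : inner ℝ n (p - g) = -H := by rw [hH, ← inner_neg_right]; congr 1; abel
  have hH0 : H ≠ 0 := by intro h; apply hp; rw [hH', h, neg_zero]
  have hz : ∀ z ∈ conv Γ, inner ℝ n (z - p) = H := by
    intro z hz
    have := inner_eq_of_mem_conv hΓ hz
    have e : z - p = (z - g) + (g - p) := by abel
    rw [e, inner_add_right, this, zero_add]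
  have hv : H • n ≠ 0 := smul_ne_zero hH0 (by intro h; simp [h] at hn)
  -- The volume is an integral over slices orthogonal to the height vector `H • n`, parametrised so
  -- that the apex is at 0 and the base at 1.
  have key := EuclideanGeometry.euclideanHausdorffMeasure_eq_lintegral p hv
    (measurableSet_conv (insert p Γ))
  rw [InnerProductSpace.euclideanHausdorffMeasure_eq_volume, finrank_euclideanSpace_fin] at key
  have hmem : ∀ (x : ℝ) (y : Pt N),
      y ∈ AffineSubspace.mk' (x • (H • n) +ᵥ p) (Submodule.span ℝ {H • n})ᗮ ↔
        inner ℝ n (y - p) = x * H := by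
    intro x y
    rw [AffineSubspace.mem_mk', Submodule.mem_orthogonal_singleton_iff_inner_right, vsub_eq_sub,
      vadd_eq_add, inner_smul_left]
    have e : y - (x • H • n + p) = (y - p) - (x * H) • n := by rw [smul_smul]; abel
    rw [e, inner_sub_right, inner_smul_right, real_inner_self_eq_norm_sq, hn]
    simp [hH0, sub_eq_zero]
  -- For `0 < x ≤ 1` the slice is the base shrunk by the factor `x` towards the apex, which scales
  -- its measure by `x ^ (N - 1)`. The degenerate slice `x = 0` is left out as a null set.
  have hslice : ∀ᵐ x : ℝ, Measure.euclideanHausdorffMeasure (N - 1)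
      (conv (insert p Γ) ∩ AffineSubspace.mk' (x • (H • n) +ᵥ p) (Submodule.span ℝ {H • n})ᗮ) =
      (Set.Ioc (0 : ℝ) 1).indicator (fun x => ENNReal.ofReal x ^ (N - 1) *
        Measure.euclideanHausdorffMeasure (N - 1) (conv Γ)) x := by
    have h0 : ∀ᵐ x : ℝ, x ≠ 0 := by simp [ae_iff]
    filter_upwards [h0] with x hx0
    by_cases hx : x ∈ Set.Ioc (0 : ℝ) 1
    · rw [Set.indicator_of_mem hx]
      have : conv (insert p Γ) ∩ AffineSubspace.mk' (x • (H • n) +ᵥ p)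
          (Submodule.span ℝ {H • n})ᗮ = AffineMap.homothety p x '' conv Γ := by
        ext y
        rw [Set.mem_inter_iff, mem_conv_insert hne, SetLike.mem_coe, hmem]
        simp only [Set.mem_image, AffineMap.homothety_apply, vsub_eq_sub, vadd_eq_add]
        constructor
        · rintro ⟨⟨z, hzΓ, r, hr, rfl⟩, h2⟩
          rw [add_sub_cancel_left, inner_smul_right, hz z hzΓ] at h2
          have : r = x := mul_right_cancel₀ hH0 h2
          exact ⟨z, hzΓ, by rw [this, add_comm]⟩
        · rintro ⟨z, hzΓ, rfl⟩
          refine ⟨⟨z, hzΓ, x, ⟨hx.1.le, hx.2⟩, by rw [add_comm]⟩, ?_⟩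
          rw [add_sub_cancel_right, inner_smul_right, hz z hzΓ]
      rw [this, euclideanHausdorffMeasure_homothety_image _ _ hx0]
      rw [ENNReal.smul_def, smul_eq_mul]
      congr 1
      rw [ENNReal.coe_pow]
      congr 1
      rw [Real.nnnorm_of_nonneg hx.1.le, ENNReal.ofReal, Real.toNNReal_of_nonneg hx.1.le]
    · rw [Set.indicator_of_notMem hx]
      have : conv (insert p Γ) ∩ AffineSubspace.mk' (x • (H • n) +ᵥ p)
          (Submodule.span ℝ {H • n})ᗮ = ∅ := by
        ext y
        rw [Set.mem_inter_iff, mem_conv_insert hne, SetLike.mem_coe, hmem]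
        simp only [Set.mem_empty_iff_false, iff_false]
        rintro ⟨⟨z, hzΓ, r, hr, rfl⟩, h2⟩
        rw [add_sub_cancel_left, inner_smul_right, hz z hzΓ] at h2
        have : r = x := mul_right_cancel₀ hH0 h2
        subst this
        exact hx ⟨lt_of_le_of_ne hr.1 (Ne.symm hx0), hr.2⟩
      rw [this, measure_empty]
  rw [lintegral_congr_ae hslice, lintegral_indicator measurableSet_Ioc,
    lintegral_mul_const _ (by fun_prop)] at key
  have hpow := lintegral_Ioc_zero_one_ofReal_pow (N - 1)
  rw [Nat.sub_add_cancel hN] at hpow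
  have hnorm : ‖H • n‖ₑ = ENNReal.ofReal |H| := by
    rw [← ofReal_norm, norm_smul, hn, mul_one, Real.norm_eq_abs]
  rw [key, hH', abs_neg, hnorm]
  calc _ = ENNReal.ofReal |H| * ((N * ∫⁻ a in Set.Ioc (0 : ℝ) 1, ENNReal.ofReal a ^ (N - 1)) *
        Measure.euclideanHausdorffMeasure (N - 1) (conv Γ)) := by ring
    _ = _ := by rw [hpow, one_mul]

/-- A vector that is orthogonal to all edges of an `N`-simplex vanishes. -/
theorem eq_zero_of_inner_sub_eq_zero {N : ℕ} {s : Finset (Pt N)}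
    (hs : AffineIndependent ℝ ((↑) : s → Pt N)) (hcard : s.card = N + 1) {b : Pt N}
    (h : ∀ x ∈ s, ∀ y ∈ s, inner ℝ b (x - y) = 0) : b = 0 := by
  have htop : affineSpan ℝ (Set.range ((↑) : s → Pt N)) = ⊤ := by
    rw [hs.affineSpan_eq_top_iff_card_eq_finrank_add_one]
    simp [hcard]
  have hv : vectorSpan ℝ (Set.range ((↑) : s → Pt N)) = ⊤ := by
    rw [← direction_affineSpan, htop, AffineSubspace.direction_top]
  have hb : b ∈ vectorSpan ℝ (Set.range ((↑) : s → Pt N)) := by rw [hv]; trivial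
  have hall : ∀ v ∈ vectorSpan ℝ (Set.range ((↑) : s → Pt N)), inner ℝ b v = 0 := by
    intro v hv
    rw [vectorSpan_def] at hv
    induction hv using Submodule.span_induction with
    | mem x hx =>
      obtain ⟨y, hy, z, hz, rfl⟩ := Set.mem_vsub.1 hx
      simp only [Subtype.range_coe_subtype, Set.mem_ofPred_eq] at hy hz
      exact h y hy z hz
    | zero => simp
    | add x y _ _ hx hy => rw [inner_add_right, hx, hy, add_zero]
    | smul a x _ hx => rw [inner_smul_right, hx, mul_zero]
  exact inner_self_eq_zero.1 (hall b hb)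

/-- The barycentric coordinates of an `N`-simplex, expressed through normals `n p` of the faces
opposite to the vertices `p`, and through points `g p` on these faces, sum up to one. -/
theorem sum_barycentric {N : ℕ} {s : Finset (Pt N)}
    (hs : AffineIndependent ℝ ((↑) : s → Pt N)) (hcard : s.card = N + 1)
    {n g : Pt N → Pt N}
    (hn : ∀ p ∈ s, ∀ x ∈ s, x ≠ p → inner ℝ (n p) (x - g p) = 0)
    (hp : ∀ p ∈ s, inner ℝ (n p) (p - g p) ≠ 0) (x : Pt N) :
    ∑ p ∈ s, inner ℝ (n p) (x - g p) / inner ℝ (n p) (p - g p) = 1 := by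
  classical
  have hvert : ∀ x ∈ s, ∑ p ∈ s, inner ℝ (n p) (x - g p) / inner ℝ (n p) (p - g p) = 1 := by
    intro x hx
    rw [Finset.sum_eq_single x]
    · exact div_self (hp x hx)
    · intro p hps hpx
      rw [hn p hps x hx (Ne.symm hpx), zero_div]
    · exact fun h => absurd hx h
  -- `B` is the gradient of the sum of the barycentric coordinates. That sum is 1 at every vertex,
  -- so `B` is orthogonal to all edges and vanishes.
  set B : Pt N := ∑ p ∈ s, (inner ℝ (n p) (p - g p))⁻¹ • n p with hB
  have hdiff : ∀ x y : Pt N, ∑ p ∈ s, inner ℝ (n p) (x - g p) / inner ℝ (n p) (p - g p) -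
      ∑ p ∈ s, inner ℝ (n p) (y - g p) / inner ℝ (n p) (p - g p) = inner ℝ B (x - y) := by
    intro x y
    rw [hB, sum_inner, ← Finset.sum_sub_distrib]
    refine Finset.sum_congr rfl fun p _ => ?_
    rw [real_inner_smul_left, ← sub_div, ← inner_sub_right, div_eq_inv_mul]
    congr 2
    abel_nf
  have hB0 : B = 0 := by
    refine eq_zero_of_inner_sub_eq_zero hs hcard fun x hx y hy => ?_
    rw [← hdiff, hvert x hx, hvert y hy, sub_self]
  obtain ⟨y, hy⟩ : s.Nonempty := by rw [← Finset.card_pos]; omega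
  have := hdiff x y
  rw [hvert y hy, hB0, inner_zero_left] at this
  linarith

end CompressibleStokes

namespace CompressibleStokes

/-! ### Structure of a mesh -/

/-- A point of the interior of the closure outside `Ω` would be a boundary point on or above the
local graph. Moving it slightly along `ν` brings it strictly above, where a whole neighbourhood
misses `Ω`, although the moved point is still in the closure. This rules out slits, so that the
interiors of the elements, whose union is only known inside `closure Ω`, lie in `Ω`. -/
theorem interior_closure_eq_of_hasLipschitzBoundary {N : ℕ} {Ω : Set (Pt N)}
    (h : HasLipschitzBoundary Ω) (ho : IsOpen Ω) : interior (closure Ω) = Ω := by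
  refine subset_antisymm (fun x hx => ?_) (ho.subset_interior_closure)
  by_contra hxΩ
  have hxf : x ∈ frontier Ω := by
    rw [ho.frontier_eq]; exact ⟨interior_subset hx, hxΩ⟩
  obtain ⟨U, hU, ν, K, g, hν, hg, hloc⟩ := h x hxf
  have hxU : x ∈ U := mem_of_mem_nhds hU
  have hx1 : g (x - (inner ℝ ν x) • ν) ≤ inner ℝ ν x := by
    by_contra hlt
    exact hxΩ ((hloc x hxU).2 (not_le.1 hlt))
  have hcont : Filter.Tendsto (fun δ : ℝ => x + δ • ν) (nhdsWithin 0 (Set.Ioi 0)) (nhds x) := by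
    have : Continuous fun δ : ℝ => x + δ • ν := by fun_prop
    have h2 := this.tendsto 0
    simp only [zero_smul, add_zero] at h2
    exact h2.mono_left nhdsWithin_le_nhds
  have hnh : interior U ∩ interior (closure Ω) ∈ nhds x :=
    Filter.inter_mem (interior_mem_nhds.2 hU) (isOpen_interior.mem_nhds hx)
  obtain ⟨δ, hδ, hδ0⟩ := ((hcont.eventually hnh).and self_mem_nhdsWithin).exists
  replace hδ0 : 0 < δ := hδ0
  set y := x + δ • ν with hy
  have hνν : inner ℝ ν ν = (1 : ℝ) := by rw [real_inner_self_eq_norm_sq, hν]; norm_num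
  have hproj : y - (inner ℝ ν y) • ν = x - (inner ℝ ν x) • ν := by
    rw [hy, inner_add_right, inner_smul_right, hνν, add_smul, mul_one]; abel
  have hlt : g (y - (inner ℝ ν y) • ν) < inner ℝ ν y := by
    rw [hproj, hy, inner_add_right, inner_smul_right, hνν]; linarith
  have hc : Continuous fun z : Pt N => inner ℝ ν z - g (z - (inner ℝ ν z) • ν) := by
    have := hg.continuous
    fun_prop
  have hV : {z : Pt N | 0 < inner ℝ ν z - g (z - (inner ℝ ν z) • ν)} ∈ nhds y :=
    (isOpen_lt continuous_const hc).mem_nhds (by simpa using hlt)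
  have hyc : y ∈ closure Ω := interior_subset hδ.2
  obtain ⟨z, ⟨hz1, hz2⟩, hzΩ⟩ := mem_closure_iff_nhds.1 hyc _
    (Filter.inter_mem hV (isOpen_interior.mem_nhds hδ.1))
  have := (hloc z (interior_subset hz2)).1 hzΩ
  simp only [Set.mem_ofPred_eq] at hz1
  linarith

/-- The affine basis formed by the vertices of a simplex of full dimension. -/
def vertexBasis {N : ℕ} (s : Finset (Pt N)) (hs : AffineIndependent ℝ ((↑) : s → Pt N))
    (hcard : s.card = N + 1) : AffineBasis s ℝ (Pt N) :=
  ⟨(↑), hs, by rw [hs.affineSpan_eq_top_iff_card_eq_finrank_add_one]; simp [hcard]⟩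

section Basis

variable {N : ℕ} {s : Finset (Pt N)} (hs : AffineIndependent ℝ ((↑) : s → Pt N))
  (hcard : s.card = N + 1)

theorem vertexBasis_apply (q : s) : vertexBasis s hs hcard q = q := rfl

theorem mem_conv_iff_coord {x : Pt N} :
    x ∈ conv s ↔ ∀ q, 0 ≤ (vertexBasis s hs hcard).coord q x := by
  have := (vertexBasis s hs hcard).convexHull_eq_nonneg_coord
  have hr : Set.range (vertexBasis s hs hcard) = (s : Set (Pt N)) := by
    ext y; simp [vertexBasis_apply]
  rw [hr] at this
  rw [conv, this]; rfl

/-- The height over the facet opposite to `p` is an affine function vanishing at all the other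
vertices, hence proportional to the barycentric coordinate of `p`. -/
theorem inner_sub_eq_coord_mul {p n g : Pt N} (hp : p ∈ s)
    (hΓ : ∀ x ∈ s, x ≠ p → inner ℝ n (x - g) = 0) (x : Pt N) :
    inner ℝ n (x - g) = (vertexBasis s hs hcard).coord ⟨p, hp⟩ x * inner ℝ n (p - g) := by
  set b := vertexBasis s hs hcard
  have h1 : ∑ q, b.coord q x = 1 := b.sum_coord_apply_eq_one x
  have h2 : ∑ q, b.coord q x • (b q) = x := b.linear_combination_coord_eq_self x
  have h3 : x - g = ∑ q, b.coord q x • (b q - g) := by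
    simp_rw [smul_sub]
    rw [Finset.sum_sub_distrib, h2, ← Finset.sum_smul, h1, one_smul]
  rw [h3, inner_sum, Finset.sum_eq_single (⟨p, hp⟩ : s)]
  · rw [inner_smul_right]; rfl
  · intro q _ hq
    rw [inner_smul_right]
    have : inner ℝ n (b q - g) = 0 := hΓ q q.2 (fun h => hq (Subtype.ext h))
    rw [this, mul_zero]
  · simp

theorem coord_eq_zero_of_mem_conv {t : Finset (Pt N)} {q : s} (hts : t ⊆ s)
    (hq : (q : Pt N) ∉ t) {x : Pt N} (hx : x ∈ conv t) :
    (vertexBasis s hs hcard).coord q x = 0 := by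
  have hconv : Convex ℝ ((vertexBasis s hs hcard).coord q ⁻¹' {0}) :=
    (convex_singleton (𝕜 := ℝ) (0 : ℝ)).affine_preimage _
  have hsub : (t : Set (Pt N)) ⊆ (vertexBasis s hs hcard).coord q ⁻¹' {0} := by
    intro y hy
    have hne : q ≠ ⟨y, hts hy⟩ := by
      rintro rfl
      exact hq hy
    have h := (vertexBasis s hs hcard).coord_apply_ne hne
    rw [vertexBasis_apply] at h
    rw [Set.mem_preimage, Set.mem_singleton_iff]
    exact h
  have h := convexHull_min hsub hconv hx
  rwa [Set.mem_preimage, Set.mem_singleton_iff] at h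

end Basis

theorem affineSpan_ne_top {N : ℕ} {s : Finset (Pt N)} (hcard : s.card ≤ N) :
    affineSpan ℝ (s : Set (Pt N)) ≠ ⊤ := by
  intro h
  rcases s.eq_empty_or_nonempty with rfl | hne
  · simp at h
  · have : Nonempty s := hne.to_subtype
    have h1 := finrank_vectorSpan_range_add_one_le ℝ ((↑) : s → Pt N)
    have h2 : vectorSpan ℝ (Set.range ((↑) : s → Pt N)) = ⊤ := by
      rw [← direction_affineSpan, Subtype.range_coe, h, AffineSubspace.direction_top]
    rw [h2, finrank_top, finrank_euclideanSpace_fin, Fintype.card_coe] at h1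
    omega

theorem volume_conv_eq_zero {N : ℕ} {s : Finset (Pt N)} (hcard : s.card ≤ N) :
    volume (conv s) = 0 :=
  measure_mono_null (convexHull_subset_affineSpan _)
    (Measure.addHaar_affineSubspace _ _ (affineSpan_ne_top hcard))

theorem interior_conv_nonempty {N : ℕ} {s : Finset (Pt N)}
    (hs : AffineIndependent ℝ ((↑) : s → Pt N)) (hcard : s.card = N + 1) :
    (interior (conv s)).Nonempty := by
  rw [interior_convexHull_nonempty_iff_affineSpan_eq_top]
  have := (vertexBasis s hs hcard).tot
  rwa [show Set.range (vertexBasis s hs hcard) = (s : Set (Pt N)) by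
    ext y; simp [vertexBasis_apply]] at this

theorem volume_interior_conv {N : ℕ} (s : Finset (Pt N)) :
    volume (interior (conv s)) = volume (conv s) :=
  (measure_interior_of_null_frontier ((convex_convexHull ℝ _).addHaar_frontier _))

theorem interior_conv_ae_eq {N : ℕ} (s : Finset (Pt N)) :
    interior (conv s) =ᵐ[volume] conv s :=
  interior_ae_eq_of_null_frontier ((convex_convexHull ℝ _).addHaar_frontier _)

theorem volume_conv_lt_top {N : ℕ} (s : Finset (Pt N)) : volume (conv s) < ⊤ :=
  (isCompact_conv s).measure_lt_top

theorem volume_real_conv_pos {N : ℕ} {s : Finset (Pt N)}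
    (hs : AffineIndependent ℝ ((↑) : s → Pt N)) (hcard : s.card = N + 1) :
    0 < volume.real (conv s) := by
  refine ENNReal.toReal_pos ?_ (volume_conv_lt_top s).ne
  rw [← volume_interior_conv]
  exact (isOpen_interior.measure_pos _ (interior_conv_nonempty hs hcard)).ne'

namespace Mesh

variable {N : ℕ} {Ω : Set (Pt N)} (T : Mesh Ω)

theorem mem_elements {s : Finset (Pt N)} :
    s ∈ T.elements ↔ s ∈ T.complex.faces ∧ s.card = N + 1 := by
  simp [elements]

theorem mem_faces {s : Finset (Pt N)} :
    s ∈ T.faces ↔ s ∈ T.complex.faces ∧ s.card = N := by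
  simp [faces]

theorem mem_interiorFaces {s : Finset (Pt N)} :
    s ∈ T.interiorFaces ↔ s ∈ T.faces ∧ ¬ conv s ⊆ frontier Ω := by
  classical
  simp [interiorFaces]

variable {T}

theorem indep_of_mem_elements {s : Finset (Pt N)} (hs : s ∈ T.elements) :
    AffineIndependent ℝ ((↑) : s → Pt N) := T.complex.indep (T.mem_elements.1 hs).1

theorem card_of_mem_elements {s : Finset (Pt N)} (hs : s ∈ T.elements) : s.card = N + 1 :=
  (T.mem_elements.1 hs).2

theorem vol_pos {s : Finset (Pt N)} (hs : s ∈ T.elements) : 0 < volume.real (conv s) :=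
  volume_real_conv_pos (indep_of_mem_elements hs) (card_of_mem_elements hs)

theorem erase_mem_faces [DecidableEq (Pt N)] (hN : 1 ≤ N) {s : Finset (Pt N)}
    (hs : s ∈ T.elements) {p : Pt N} (hp : p ∈ s) : s.erase p ∈ T.faces := by
  rw [mem_faces]
  have hc : (s.erase p).card = N := by
    rw [Finset.card_erase_of_mem hp, card_of_mem_elements hs]; rfl
  exact ⟨T.complex.down_closed (T.mem_elements.1 hs).1 (Finset.erase_subset _ _)
    (Finset.card_pos.1 (by omega)), hc⟩

theorem exists_insert [DecidableEq (Pt N)] {s Γ : Finset (Pt N)} (hs : s ∈ T.elements)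
    (hΓ : Γ ∈ T.faces) (h : Γ ⊆ s) : ∃ p, p ∉ Γ ∧ s = insert p Γ := by
  have h1 := (T.mem_faces.1 hΓ).2
  have h2 := card_of_mem_elements hs
  have h3 : (s \ Γ).card = 1 := by rw [Finset.card_sdiff_of_subset h]; omega
  obtain ⟨p, hp⟩ := Finset.card_eq_one.1 h3
  have hmem : p ∈ s \ Γ := by rw [hp]; simp
  refine ⟨p, (Finset.mem_sdiff.1 hmem).2, ?_⟩
  rw [← Finset.sdiff_union_of_subset h, hp]; rfl

theorem face_nonempty {Γ : Finset (Pt N)} (hΓ : Γ ∈ T.faces) : Γ.Nonempty :=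
  T.complex.nonempty_of_mem_faces (T.mem_faces.1 hΓ).1

/-- If the apex were in the hyperplane of its opposite face, the normal would be orthogonal to all
edges of a full-dimensional simplex. -/
theorem inner_ne_zero {s Γ : Finset (Pt N)} (hs : s ∈ T.elements) {p : Pt N}
    (hΓ : ∀ x ∈ s, x ≠ p → x ∈ Γ) {n g : Pt N} (hn : n ≠ 0)
    (hg : ∀ x ∈ Γ, inner ℝ n (x - g) = 0) : inner ℝ n (p - g) ≠ 0 := by
  intro h0
  apply hn
  have hall : ∀ x ∈ s, inner ℝ n (x - g) = 0 := by
    intro x hx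
    by_cases hxp : x = p
    · rw [hxp]; exact h0
    · exact hg x (hΓ x hx hxp)
  refine eq_zero_of_inner_sub_eq_zero (indep_of_mem_elements hs) (card_of_mem_elements hs)
    fun x hx y hy => ?_
  have e : x - y = (x - g) - (y - g) := by abel
  rw [e, inner_sub_right, hall x hx, hall y hy, sub_zero]

/-- Purity of the complex makes the lower-dimensional simplices redundant. -/
theorem closure_eq_iUnion : closure Ω = ⋃ s ∈ T.elements, conv s := by
  rw [← T.space_eq, Geometry.SimplicialComplex.space]
  apply subset_antisymm
  · refine Set.iUnion₂_subset fun s hs => ?_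
    obtain ⟨t, ht, hst, hc⟩ := T.pure s hs
    exact (convexHull_mono (by exact_mod_cast hst)).trans
      (Set.subset_biUnion_of_mem (u := fun s : Finset (Pt N) => conv s)
        (T.mem_elements.2 ⟨ht, hc⟩))
  · refine Set.iUnion₂_subset fun s hs => ?_
    exact Set.subset_biUnion_of_mem (u := fun s : Finset (Pt N) => convexHull ℝ (s : Set (Pt N)))
        (T.mem_elements.1 hs).1

theorem conv_subset_closure {s : Finset (Pt N)} (hs : s ∈ T.elements) : conv s ⊆ closure Ω := by
  rw [T.closure_eq_iUnion]
  exact Set.subset_biUnion_of_mem (u := fun s : Finset (Pt N) => conv s) hs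

theorem interior_conv_subset (hΩ : interior (closure Ω) = Ω) {s : Finset (Pt N)}
    (hs : s ∈ T.elements) : interior (conv s) ⊆ Ω :=
  (interior_mono (conv_subset_closure hs)).trans hΩ.subset

theorem conv_inter_subset [DecidableEq (Pt N)] {s t : Finset (Pt N)} (hs : s ∈ T.complex.faces)
    (ht : t ∈ T.complex.faces) : conv s ∩ conv t ⊆ conv (s ∩ t) := by
  have := T.complex.inter_subset_convexHull hs ht
  rwa [← Finset.coe_inter] at this

theorem card_inter_le [DecidableEq (Pt N)] {s t : Finset (Pt N)} (hs : s ∈ T.elements)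
    (ht : t ∈ T.elements) (hst : s ≠ t) : (s ∩ t).card ≤ N := by
  have h1 := card_of_mem_elements hs
  have h2 := card_of_mem_elements ht
  by_contra hlt
  have h3 : s ∩ t = s := Finset.eq_of_subset_of_card_le Finset.inter_subset_left (by omega)
  have h4 : s ∩ t = t := Finset.eq_of_subset_of_card_le Finset.inter_subset_right (by omega)
  exact hst (h3.symm.trans h4)

theorem volume_inter_eq_zero {s t : Finset (Pt N)} (hs : s ∈ T.elements)
    (ht : t ∈ T.elements) (hst : s ≠ t) : volume (conv s ∩ conv t) = 0 := by
  classical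
  exact measure_mono_null (conv_inter_subset (T.mem_elements.1 hs).1 (T.mem_elements.1 ht).1)
    (volume_conv_eq_zero (card_inter_le hs ht hst))

theorem disjoint_interior {s t : Finset (Pt N)} (hs : s ∈ T.elements)
    (ht : t ∈ T.elements) (hst : s ≠ t) : Disjoint (interior (conv s)) (interior (conv t)) := by
  rw [Set.disjoint_iff_inter_eq_empty, ← interior_inter]
  by_contra hne
  have hpos := isOpen_interior.measure_pos (volume : Measure (Pt N))
    (Set.nonempty_iff_ne_empty.2 hne)
  exact hpos.ne' (measure_mono_null interior_subset (volume_inter_eq_zero hs ht hst))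

end Mesh

end CompressibleStokes

/-! ### The two elements adjacent to an interior face -/

namespace CompressibleStokes

/-- The centroid of `Γ` is a point in the relative interior of the face. -/
theorem exists_pos_coord {N : ℕ} {s Γ : Finset (Pt N)} (hs : AffineIndependent ℝ ((↑) : s → Pt N))
    (hcard : s.card = N + 1) (hΓ : Γ.Nonempty) (h : Γ ⊆ s) :
    ∃ c ∈ conv Γ, ∀ q : s, (q : Pt N) ∈ Γ → 0 < (vertexBasis s hs hcard).coord q c := by
  classical
  set S : Finset s := Γ.subtype (· ∈ s) with hS
  have hmap : S.map (Function.Embedding.subtype _) = Γ :=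
    Finset.subtype_map_of_mem fun x hx => h hx
  have hc : Γ.centroid ℝ id = S.centroid ℝ (vertexBasis s hs hcard) := by
    conv_lhs => rw [← hmap]
    rw [Finset.centroid_map]
    rfl
  refine ⟨Γ.centroid ℝ id, ?_, fun q hq => ?_⟩
  · exact Γ.centroid_mem_convexHull hΓ
  · rw [hc, AffineBasis.coord_apply_centroid _ (by simpa [hS] using hq)]
    have : 0 < S.card := Finset.card_pos.2 ⟨q, by simpa [hS] using hq⟩
    positivity

namespace Mesh

variable {N : ℕ} {Ω : Set (Pt N)} {T : Mesh Ω}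

theorem mem_side {Γ : Finset (Pt N)} {n : Pt N} {s : Finset (Pt N)} :
    s ∈ T.side Γ n ↔ s ∈ T.elements ∧ Γ ⊆ s ∧ ∀ x ∈ s, ∀ y ∈ Γ, 0 ≤ inner ℝ n (x - y) := by
  classical
  simp [side]

/-- Two elements that are adjacent to the same face from the same side coincide. -/
theorem eq_of_mem_side {Γ : Finset (Pt N)} (hΓ : Γ ∈ T.faces) {n : Pt N} (hn : n ≠ 0)
    (horth : ∀ x ∈ Γ, ∀ y ∈ Γ, inner ℝ n (x - y) = 0) {s t : Finset (Pt N)}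
    (hs : s ∈ T.side Γ n) (ht : t ∈ T.side Γ n) : s = t := by
  classical
  obtain ⟨hs, hΓs, hs0⟩ := mem_side.1 hs
  obtain ⟨ht, hΓt, ht0⟩ := mem_side.1 ht
  by_contra hst
  obtain ⟨g, hg⟩ := face_nonempty hΓ
  obtain ⟨p, hp, rfl⟩ := exists_insert hs hΓ hΓs
  obtain ⟨p', hp', rfl⟩ := exists_insert ht hΓ hΓt
  have horth' : ∀ x ∈ Γ, inner ℝ n (x - g) = 0 := fun x hx => horth x hx g hg
  have hpos : 0 < inner ℝ n (p - g) := lt_of_le_of_ne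
    (hs0 p (Finset.mem_insert_self _ _) g hg)
    (inner_ne_zero hs (fun x hx hxp => (Finset.mem_insert.1 hx).resolve_left hxp) hn horth').symm
  have hpos' : 0 < inner ℝ n (p' - g) := lt_of_le_of_ne
    (ht0 p' (Finset.mem_insert_self _ _) g hg)
    (inner_ne_zero ht (fun x hx hxp => (Finset.mem_insert.1 hx).resolve_left hxp) hn horth').symm
  have hi := indep_of_mem_elements ht
  have hcd := card_of_mem_elements ht
  obtain ⟨c, hc, hcpos⟩ := exists_pos_coord hi hcd ⟨g, hg⟩ hΓt
  set b := vertexBasis _ hi hcd with hb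
  have hp't : p' ∈ insert p' Γ := Finset.mem_insert_self _ _
  have hcoordp : 0 ≤ b.coord ⟨p', hp't⟩ p := by
    have h1 := inner_sub_eq_coord_mul hi hcd (n := n) (g := g) hp't
      (fun x hx hxp => horth' x ((Finset.mem_insert.1 hx).resolve_left hxp)) p
    by_contra hneg
    have := mul_neg_of_neg_of_pos (not_le.1 hneg) hpos'
    rw [← hb] at h1
    linarith
  have hcont : ∀ q, Continuous fun ε : ℝ => b.coord q (AffineMap.lineMap c p ε) := by
    intro q
    exact (AffineMap.continuous_of_finiteDimensional (b.coord q)).comp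
      AffineMap.lineMap_continuous
  -- A short move from the centroid `c` of `Γ` towards the apex `p` of one element stays in the
  -- other: coordinates of the vertices of `Γ` stay positive by continuity, and that of `p'` grows
  -- from 0 because `p` is on the same side.
  have hev : ∀ᶠ ε in nhdsWithin (0 : ℝ) (Set.Ioi 0), ∀ q, 0 ≤ b.coord q (AffineMap.lineMap c p ε) := by
    rw [Filter.eventually_all]
    intro q
    by_cases hq : (q : Pt N) ∈ Γ
    · have h0 : 0 < b.coord q (AffineMap.lineMap c p (0 : ℝ)) := by
        rw [AffineMap.lineMap_apply_zero]; exact hcpos q hq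
      have := (hcont q).continuousAt.eventually (lt_mem_nhds h0)
      exact (this.filter_mono nhdsWithin_le_nhds).mono fun _ h => h.le
    · have hqp : q = ⟨p', hp't⟩ := Subtype.ext ((Finset.mem_insert.1 q.2).resolve_right hq)
      filter_upwards [self_mem_nhdsWithin] with ε hε
      have h0 : b.coord q c = 0 := coord_eq_zero_of_mem_conv hi hcd hΓt hq hc
      rw [AffineMap.apply_lineMap, h0, AffineMap.lineMap_apply]
      simp only [vsub_eq_sub, sub_zero, smul_eq_mul, vadd_eq_add, add_zero]
      rw [hqp]
      exact mul_nonneg (le_of_lt hε) hcoordp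
  have hev1 : ∀ᶠ ε in nhdsWithin (0 : ℝ) (Set.Ioi 0), ε < 1 :=
    (eventually_lt_nhds zero_lt_one).filter_mono nhdsWithin_le_nhds
  obtain ⟨ε, ⟨hε, hε1⟩, hε0⟩ := ((hev.and hev1).and self_mem_nhdsWithin).exists
  replace hε0 : 0 < ε := hε0
  have hyt : AffineMap.lineMap c p ε ∈ conv (insert p' Γ) := (mem_conv_iff_coord hi hcd).2 hε
  have hys : AffineMap.lineMap c p ε ∈ conv (insert p Γ) := by
    refine (convex_convexHull ℝ _).lineMap_mem ?_ ?_ ⟨hε0.le, hε1.le⟩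
    · exact convexHull_mono (by exact_mod_cast hΓs) hc
    · exact subset_convexHull ℝ _ (by simp)
  -- By conformity the moved point would lie in `conv Γ`, but it has positive height over `Γ`.
  have hmem := conv_inter_subset (T.mem_elements.1 hs).1 (T.mem_elements.1 ht).1 ⟨hys, hyt⟩
  have hint : insert p Γ ∩ insert p' Γ = Γ := by
    have hne : p ≠ p' := by rintro rfl; exact hst rfl
    ext x
    simp only [Finset.mem_inter, Finset.mem_insert]
    constructor
    · rintro ⟨rfl | h, rfl | h'⟩
      · exact absurd rfl hne
      · exact h'
      · exact h
      · exact h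
    · exact fun h => ⟨Or.inr h, Or.inr h⟩
  rw [hint] at hmem
  have h0 := inner_eq_of_mem_conv horth' hmem
  have hc0 := inner_eq_of_mem_conv horth' hc
  rw [AffineMap.lineMap_apply, vsub_eq_sub, vadd_eq_add] at h0
  have e : ε • (p - c) + c - g = ε • ((p - g) - (c - g)) + (c - g) := by
    rw [show p - g - (c - g) = p - c by abel]; abel
  rw [e, inner_add_right, inner_smul_right, inner_sub_right, hc0] at h0
  have := mul_pos hε0 hpos
  linarith

/-- An interior face has an adjacent element on each side. -/
theorem exists_mem_side (ho : IsOpen Ω) {Γ : Finset (Pt N)}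
    (hΓ : Γ ∈ T.interiorFaces) {n : Pt N} (hn : n ≠ 0)
    (horth : ∀ x ∈ Γ, ∀ y ∈ Γ, inner ℝ n (x - y) = 0) : ∃ s, s ∈ T.side Γ n := by
  classical
  obtain ⟨hΓ, hfr⟩ := T.mem_interiorFaces.1 hΓ
  obtain ⟨hΓc, hΓN⟩ := T.mem_faces.1 hΓ
  obtain ⟨g, hg⟩ := face_nonempty hΓ
  have horth' : ∀ x ∈ Γ, inner ℝ n (x - g) = 0 := fun x hx => horth x hx g hg
  obtain ⟨s, hs, hΓs, hsc⟩ := T.pure Γ hΓc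
  have hi := T.complex.indep hs
  have hsE : s ∈ T.elements := T.mem_elements.2 ⟨hs, hsc⟩
  obtain ⟨x, hx, hxf⟩ := Set.not_subset.1 hfr
  have hxΩ : x ∈ Ω := by
    have h1 : x ∈ closure Ω :=
      conv_subset_closure hsE (convexHull_mono (by exact_mod_cast hΓs) hx)
    by_contra h2
    exact hxf (by rw [ho.frontier_eq]; exact ⟨h1, h2⟩)
  obtain ⟨c, hc, hcpos⟩ := exists_pos_coord hi hsc ⟨g, hg⟩ hΓs
  set b := vertexBasis s hi hsc with hb
  have hlm : Filter.Tendsto (fun ε : ℝ => AffineMap.lineMap x c ε) (nhdsWithin 0 (Set.Ioi 0))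
      (nhds x) := by
    have h1 : Continuous fun ε : ℝ => (AffineMap.lineMap x c ε : Pt N) :=
      AffineMap.lineMap_continuous
    have h2 := h1.tendsto 0
    rw [AffineMap.lineMap_apply_zero] at h2
    exact h2.mono_left nhdsWithin_le_nhds
  have hev1 : ∀ᶠ ε in nhdsWithin (0 : ℝ) (Set.Ioi 0), ε < 1 :=
    (eventually_lt_nhds zero_lt_one).filter_mono nhdsWithin_le_nhds
  obtain ⟨ε, ⟨hεΩ, hε1⟩, hε0⟩ :=
    (((hlm.eventually (ho.mem_nhds hxΩ)).and hev1).and self_mem_nhdsWithin).exists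
  replace hε0 : 0 < ε := hε0
  -- A point of `Γ` that is in `Ω` (near `x`) and also in the relative interior of `Γ` (shifted
  -- towards the centroid `c`).
  set x₀ : Pt N := AffineMap.lineMap x c ε with hx₀
  have hx₀Γ : x₀ ∈ conv Γ := (convex_convexHull ℝ _).lineMap_mem hx hc ⟨hε0.le, hε1.le⟩
  have hx₀pos : ∀ q : s, (q : Pt N) ∈ Γ → 0 < b.coord q x₀ := by
    intro q hq
    have h1 : 0 ≤ b.coord q x :=
      (mem_conv_iff_coord hi hsc).1 (convexHull_mono (by exact_mod_cast hΓs) hx) q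
    rw [hx₀, AffineMap.apply_lineMap, AffineMap.lineMap_apply_ring']
    have h2 := hcpos q hq
    have h3 := mul_pos hε0 h2
    have h4 := mul_nonneg (sub_nonneg.2 hε1.le) h1
    nlinarith
  -- Conformity puts `x₀` in the convex hull of `Γ ∩ t`; as all its coordinates on `Γ` are positive,
  -- no vertex of `Γ` can be missing from `t`.
  have hsub : ∀ t ∈ T.elements, x₀ ∈ conv t → Γ ⊆ t := by
    intro t ht hxt q hq
    by_contra hqt
    have hmem := conv_inter_subset hΓc (T.mem_elements.1 ht).1 ⟨hx₀Γ, hxt⟩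
    have h0 := coord_eq_zero_of_mem_conv hi hsc (q := ⟨q, hΓs hq⟩)
      (Finset.inter_subset_left.trans hΓs) (by simp [hqt]) hmem
    exact (hx₀pos ⟨q, hΓs hq⟩ hq).ne' h0
  have htend : Filter.Tendsto (fun δ : ℝ => x₀ + δ • n) (nhdsWithin 0 (Set.Ioi 0)) (nhds x₀) := by
    have : Continuous fun δ : ℝ => x₀ + δ • n := by fun_prop
    have h2 := this.tendsto 0
    simp only [zero_smul, add_zero] at h2
    exact h2.mono_left nhdsWithin_le_nhds
  have hev : ∀ᶠ δ in nhdsWithin (0 : ℝ) (Set.Ioi 0), ∃ t ∈ T.elements, x₀ + δ • n ∈ conv t := by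
    filter_upwards [htend.eventually (ho.mem_nhds hεΩ)] with δ hδ
    have h1 := subset_closure (s := Ω) hδ
    rw [T.closure_eq_iUnion] at h1
    obtain ⟨t, ht, hxt⟩ := Set.mem_iUnion₂.1 h1
    exact ⟨t, ht, hxt⟩
  -- The points `x₀ + δ • n` are covered by finitely many elements, so one of them contains such
  -- points for arbitrarily small `δ`. Being closed it contains `x₀`, and it lies on the side of
  -- `n`.
  have hfreq : ∃ t ∈ T.elements, ∃ᶠ δ in nhdsWithin (0 : ℝ) (Set.Ioi 0), x₀ + δ • n ∈ conv t := by
    by_contra hcon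
    push Not at hcon
    have hall := (Filter.eventually_all_finset T.elements).2 hcon
    obtain ⟨δ, ⟨t, ht, h1⟩, h2⟩ := (hev.and hall).exists
    exact h2 t ht h1
  obtain ⟨t, ht, hft⟩ := hfreq
  have hx₀t : x₀ ∈ conv t :=
    (isCompact_conv t).isClosed.mem_of_frequently_of_tendsto hft htend
  have hΓt := hsub t ht hx₀t
  obtain ⟨δ, hδt, hδ0⟩ := (hft.and_eventually self_mem_nhdsWithin).exists
  replace hδ0 : 0 < δ := hδ0
  refine ⟨t, mem_side.2 ⟨ht, hΓt, ?_⟩⟩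
  obtain ⟨p, hp, rfl⟩ := exists_insert ht hΓ hΓt
  have hti := indep_of_mem_elements ht
  have htc := card_of_mem_elements ht
  have hpt : p ∈ insert p Γ := Finset.mem_insert_self _ _
  have h1 := inner_sub_eq_coord_mul hti htc (n := n) (g := g) hpt
      (fun x hx hxp => horth' x ((Finset.mem_insert.1 hx).resolve_left hxp)) (x₀ + δ • n)
  have h2 := (mem_conv_iff_coord hti htc).1 hδt ⟨p, hpt⟩
  have h3 : inner ℝ n (x₀ + δ • n - g) = δ * inner ℝ n n := by
    rw [show x₀ + δ • n - g = (x₀ - g) + δ • n by abel, inner_add_right, inner_smul_right,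
      inner_eq_of_mem_conv horth' hx₀Γ, zero_add]
  have h4 : 0 < inner ℝ n n := real_inner_self_pos.2 hn
  have h5 : 0 < inner ℝ n (p - g) := by
    rw [h3] at h1
    have := mul_pos hδ0 h4
    rw [h1] at this
    exact pos_of_mul_pos_right this h2
  intro x hx y hy
  have e : x - y = (x - g) - (y - g) := by abel
  rw [e, inner_sub_right, horth' y hy, sub_zero]
  rcases Finset.mem_insert.1 hx with rfl | hx
  · exact h5.le
  · rw [horth' x hx]

theorem normal_ne_zero {Γ : Finset (Pt N)} (hΓ : Γ ∈ T.faces) : T.normal Γ ≠ 0 := by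
  intro h
  have := T.norm_normal Γ (T.mem_faces.1 hΓ).1 (T.mem_faces.1 hΓ).2
  simp [h] at this

theorem normal_orth {Γ : Finset (Pt N)} (hΓ : Γ ∈ T.faces) :
    ∀ x ∈ Γ, ∀ y ∈ Γ, inner ℝ (T.normal Γ) (x - y) = 0 :=
  T.normal_orthogonal Γ (T.mem_faces.1 hΓ).1 (T.mem_faces.1 hΓ).2

theorem neg_normal_orth {Γ : Finset (Pt N)} (hΓ : Γ ∈ T.faces) :
    ∀ x ∈ Γ, ∀ y ∈ Γ, inner ℝ (-T.normal Γ) (x - y) = 0 := by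
  intro x hx y hy
  rw [inner_neg_left, normal_orth hΓ x hx y hy, neg_zero]

variable (T) in
/-- The element `E_+` adjacent to an interior face. -/
noncomputable def plus (Γ : Finset (Pt N)) : Finset (Pt N) :=
  open Classical in if h : ∃ s, s ∈ T.side Γ (T.normal Γ) then h.choose else ∅

variable (T) in
/-- The element `E_-` adjacent to an interior face. -/
noncomputable def minus (Γ : Finset (Pt N)) : Finset (Pt N) :=
  open Classical in if h : ∃ s, s ∈ T.side Γ (-T.normal Γ) then h.choose else ∅

theorem side_or_side_neg {Γ s : Finset (Pt N)} (hΓ : Γ ∈ T.faces) (hs : s ∈ T.elements)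
    (h : Γ ⊆ s) : s ∈ T.side Γ (T.normal Γ) ∨ s ∈ T.side Γ (-T.normal Γ) := by
  classical
  obtain ⟨g, hg⟩ := face_nonempty hΓ
  obtain ⟨p, hp, rfl⟩ := exists_insert hs hΓ h
  have key : ∀ n : Pt N, (∀ x ∈ Γ, ∀ y ∈ Γ, inner ℝ n (x - y) = 0) → 0 ≤ inner ℝ n (p - g) →
      insert p Γ ∈ T.side Γ n := by
    intro n hn h0
    refine mem_side.2 ⟨hs, h, fun x hx y hy => ?_⟩
    rw [show x - y = (x - g) - (y - g) by abel, inner_sub_right, hn y hy g hg, sub_zero]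
    rcases Finset.mem_insert.1 hx with rfl | hx
    · exact h0
    · rw [hn x hx g hg]
  rcases le_total 0 (inner ℝ (T.normal Γ) (p - g)) with h0 | h0
  · exact Or.inl (key _ (normal_orth hΓ) h0)
  · refine Or.inr (key _ (neg_normal_orth hΓ) ?_)
    rw [inner_neg_left]; linarith

section Adjacent

variable (ho : IsOpen Ω) {Γ : Finset (Pt N)}
  (hΓ : Γ ∈ T.interiorFaces)

include ho hΓ

theorem plus_mem_side : T.plus Γ ∈ T.side Γ (T.normal Γ) := by
  have hΓ' := (T.mem_interiorFaces.1 hΓ).1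
  have h := exists_mem_side ho hΓ (normal_ne_zero hΓ') (normal_orth hΓ')
  rw [plus, dif_pos h]
  exact h.choose_spec

theorem minus_mem_side : T.minus Γ ∈ T.side Γ (-T.normal Γ) := by
  have hΓ' := (T.mem_interiorFaces.1 hΓ).1
  have h := exists_mem_side ho hΓ (neg_ne_zero.2 (normal_ne_zero hΓ')) (neg_normal_orth hΓ')
  rw [minus, dif_pos h]
  exact h.choose_spec

theorem plus_mem : T.plus Γ ∈ T.elements := (mem_side.1 (plus_mem_side ho hΓ)).1

theorem minus_mem : T.minus Γ ∈ T.elements := (mem_side.1 (minus_mem_side ho hΓ)).1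

theorem subset_plus : Γ ⊆ T.plus Γ := (mem_side.1 (plus_mem_side ho hΓ)).2.1

theorem subset_minus : Γ ⊆ T.minus Γ := (mem_side.1 (minus_mem_side ho hΓ)).2.1

theorem side_eq_plus : T.side Γ (T.normal Γ) = {T.plus Γ} := by
  have hΓ' := (T.mem_interiorFaces.1 hΓ).1
  ext s
  rw [Finset.mem_singleton]
  refine ⟨fun h => eq_of_mem_side hΓ' (normal_ne_zero hΓ') (normal_orth hΓ') h
    (plus_mem_side ho hΓ), ?_⟩
  rintro rfl
  exact plus_mem_side ho hΓ

theorem side_eq_minus : T.side Γ (-T.normal Γ) = {T.minus Γ} := by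
  have hΓ' := (T.mem_interiorFaces.1 hΓ).1
  ext s
  rw [Finset.mem_singleton]
  refine ⟨fun h => eq_of_mem_side hΓ' (neg_ne_zero.2 (normal_ne_zero hΓ')) (neg_normal_orth hΓ') h
    (minus_mem_side ho hΓ), ?_⟩
  rintro rfl
  exact minus_mem_side ho hΓ

theorem tracePlus_eq {A : Type*} [AddCommMonoid A] (q : Finset (Pt N) → A) :
    T.tracePlus q Γ = q (T.plus Γ) := by
  rw [tracePlus, side_eq_plus ho hΓ, Finset.sum_singleton]

theorem traceMinus_eq {A : Type*} [AddCommMonoid A] (q : Finset (Pt N) → A) :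
    T.traceMinus q Γ = q (T.minus Γ) := by
  rw [traceMinus, side_eq_minus ho hΓ, Finset.sum_singleton]

theorem plus_ne_minus : T.plus Γ ≠ T.minus Γ := by
  classical
  intro h
  have hΓ' := (T.mem_interiorFaces.1 hΓ).1
  have h1 := mem_side.1 (plus_mem_side ho hΓ)
  have h2 := mem_side.1 (minus_mem_side ho hΓ)
  rw [← h] at h2
  obtain ⟨g, hg⟩ := face_nonempty hΓ'
  obtain ⟨p, hp, hpe⟩ := exists_insert h1.1 hΓ' h1.2.1
  have hpm : p ∈ T.plus Γ := by rw [hpe]; exact Finset.mem_insert_self _ _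
  have h3 := h1.2.2 p hpm g hg
  have h4 := h2.2.2 p hpm g hg
  rw [inner_neg_left] at h4
  refine inner_ne_zero h1.1 (p := p) (fun x hx hxp => ?_) (normal_ne_zero hΓ')
    (fun x hx => normal_orth hΓ' x hx g hg) (le_antisymm (by linarith) h3)
  rw [hpe] at hx
  exact (Finset.mem_insert.1 hx).resolve_left hxp

theorem eq_plus_or_eq_minus {s : Finset (Pt N)} (hs : s ∈ T.elements) (h : Γ ⊆ s) :
    s = T.plus Γ ∨ s = T.minus Γ := by
  have hΓ' := (T.mem_interiorFaces.1 hΓ).1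
  rcases side_or_side_neg hΓ' hs h with h1 | h1
  · rw [side_eq_plus ho hΓ] at h1
    exact Or.inl (Finset.mem_singleton.1 h1)
  · rw [side_eq_minus ho hΓ] at h1
    exact Or.inr (Finset.mem_singleton.1 h1)

end Adjacent

end Mesh

end CompressibleStokes

namespace CompressibleStokes

/-! ### The divergence theorem for the space `V_h` and the Raviart–Thomas interpolation -/

theorem divergence_of_affine {N : ℕ} {v : Pt N → Pt N} {a : Pt N} {b : ℝ}
    (hv : ∀ x, v x = a + b • x) (x : Pt N) : divergence v x = N * b := by
  have hv' : v = fun x => a + b • x := funext hv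
  have hd : HasFDerivAt v (b • ContinuousLinearMap.id ℝ (Pt N)) x := by
    rw [hv']
    exact ((hasFDerivAt_id x).const_smul b).const_add a
  simp [divergence, partialDeriv, hd.fderiv]

namespace Mesh

variable {N : ℕ} {Ω : Set (Pt N)} {T : Mesh Ω}

/-- The area of a face. -/
noncomputable def area {N : ℕ} (Γ : Finset (Pt N)) : ℝ :=
  (Measure.euclideanHausdorffMeasure (N - 1)).real (conv Γ)

theorem area_nonneg (Γ : Finset (Pt N)) : 0 ≤ area Γ := ENNReal.toReal_nonneg

theorem integral_surface_of_forall_eq {Γ : Finset (Pt N)} {φ : Pt N → ℝ} {c : ℝ}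
    (h : ∀ x ∈ conv Γ, φ x = c) : ∫ x, φ x ∂surface Γ = area Γ * c := by
  rw [surface, setIntegral_congr_fun (measurableSet_conv Γ) h, setIntegral_const, smul_eq_mul]
  rfl

variable (T) in
/-- The sign of the chosen normal of `Γ` with respect to the outward normal of `s`. -/
noncomputable def sgn (s Γ : Finset (Pt N)) : ℝ :=
  open Classical in if s ∈ T.side Γ (T.normal Γ) then -1 else 1

theorem sgn_mul_self (s Γ : Finset (Pt N)) : T.sgn s Γ * T.sgn s Γ = 1 := by
  unfold sgn; split_ifs <;> norm_num

theorem sgn_plus (ho : IsOpen Ω) {Γ : Finset (Pt N)} (hΓ : Γ ∈ T.interiorFaces) :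
    T.sgn (T.plus Γ) Γ = -1 := by
  rw [sgn, if_pos (plus_mem_side ho hΓ)]

theorem sgn_minus (ho : IsOpen Ω) {Γ : Finset (Pt N)} (hΓ : Γ ∈ T.interiorFaces) :
    T.sgn (T.minus Γ) Γ = 1 := by
  rw [sgn, if_neg]
  rw [side_eq_plus ho hΓ, Finset.mem_singleton]
  exact (plus_ne_minus ho hΓ).symm

section Face

variable [DecidableEq (Pt N)] (hN : 1 ≤ N) {s : Finset (Pt N)} (hs : s ∈ T.elements) {p g : Pt N}
  (hp : p ∈ s) (hg : g ∈ s.erase p)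

include hN hs hp hg

theorem inner_normal_ne_zero : inner ℝ (T.normal (s.erase p)) (p - g) ≠ 0 := by
  have hf := erase_mem_faces hN hs hp
  refine inner_ne_zero hs (Γ := s.erase p) (fun x hx hxp => Finset.mem_erase.2 ⟨hxp, hx⟩)
    (normal_ne_zero hf) fun x hx => normal_orth hf x hx g hg

theorem area_mul_abs_inner :
    area (s.erase p) * |inner ℝ (T.normal (s.erase p)) (p - g)| = N * volume.real (conv s) := by
  have hf := erase_mem_faces hN hs hp
  have key := volume_conv_insert hN (Γ := s.erase p) (p := p) (n := T.normal (s.erase p)) (g := g)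
    (T.norm_normal _ (T.mem_faces.1 hf).1 (T.mem_faces.1 hf).2) hg
    (fun x hx => normal_orth hf x hx g hg) (inner_normal_ne_zero hN hs hp hg)
  rw [Finset.insert_erase hp] at key
  have := congrArg ENNReal.toReal key
  rw [ENNReal.toReal_mul, ENNReal.toReal_mul, ENNReal.toReal_ofReal (abs_nonneg _),
    ENNReal.toReal_natCast] at this
  rw [mul_comm]
  exact this.symm

theorem sgn_mul_abs_inner :
    T.sgn s (s.erase p) * |inner ℝ (T.normal (s.erase p)) (p - g)| =
      -inner ℝ (T.normal (s.erase p)) (p - g) := by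
  have hf := erase_mem_faces hN hs hp
  unfold sgn
  split_ifs with h
  · have := (mem_side.1 h).2.2 p hp g hg
    rw [abs_of_nonneg this]; ring
  · have h2 := (side_or_side_neg hf hs (Finset.erase_subset _ _)).resolve_left h
    have := (mem_side.1 h2).2.2 p hp g hg
    rw [inner_neg_left] at this
    rw [abs_of_nonpos (by linarith)]; ring

/-- By the cone formula the area is `N |E|` divided by the height, so an outward flux becomes `-N
|E|` times a quotient of the shape that occurs in `sum_barycentric`. -/
theorem sgn_mul_area_mul (c : ℝ) :
    T.sgn s (s.erase p) * (area (s.erase p) * c) =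
      -(N * volume.real (conv s)) * (c / inner ℝ (T.normal (s.erase p)) (p - g)) := by
  have h1 := area_mul_abs_inner hN hs hp hg
  have h2 := sgn_mul_abs_inner hN hs hp hg
  have h0 := inner_normal_ne_zero hN hs hp hg
  have h3 := sgn_mul_self (T := T) s (s.erase p)
  set t := inner ℝ (T.normal (s.erase p)) (p - g)
  set σ := T.sgn s (s.erase p)
  have h4 : |t| = -(σ * t) := by
    have : σ * (σ * |t|) = σ * -t := by rw [h2]
    rw [← mul_assoc, h3, one_mul] at this
    rw [this]; ring
  rw [← h1, h4]
  field_simp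

end Face

/-- Along a face, `a + b x` varies only by `b (x - g)`, which is tangential; so the normal component
is constant there. -/
theorem flux_eq {Γ : Finset (Pt N)} (hΓ : Γ ∈ T.faces) {v : Pt N → Pt N} {a : Pt N} {b : ℝ}
    (hv : ∀ x, v x = a + b • x) {g : Pt N} (hg : g ∈ Γ) :
    (∀ x ∈ conv Γ, inner ℝ (v x) (T.normal Γ) = inner ℝ (v g) (T.normal Γ)) ∧
    ∫ x, inner ℝ (v x) (T.normal Γ) ∂surface Γ = area Γ * inner ℝ (v g) (T.normal Γ) := by
  have h : ∀ x ∈ conv Γ, inner ℝ (v x) (T.normal Γ) = inner ℝ (v g) (T.normal Γ) := by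
    intro x hx
    have h0 := inner_eq_of_mem_conv (fun x hx => normal_orth hΓ x hx g hg) hx
    rw [hv, hv, real_inner_comm, real_inner_comm (T.normal Γ)]
    have e : a + b • x = a + b • g + b • (x - g) := by rw [smul_sub]; abel
    rw [e, inner_add_right _ _ (b • (x - g)), inner_smul_right, h0, mul_zero, add_zero]
  exact ⟨h, integral_surface_of_forall_eq h⟩

/-- The divergence theorem on an element. -/
theorem sum_sgn_mul_flux [DecidableEq (Pt N)] (hN : 1 ≤ N) {s : Finset (Pt N)}
    (hs : s ∈ T.elements) {v : Pt N → Pt N} {a : Pt N} {b : ℝ} (hv : ∀ x, v x = a + b • x) :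
    ∑ p ∈ s, T.sgn s (s.erase p) *
      ∫ x, inner ℝ (v x) (T.normal (s.erase p)) ∂surface (s.erase p) =
      volume.real (conv s) * (N * b) := by
  have hcard := card_of_mem_elements hs
  have hex : ∀ p, ∃ g, p ∈ s → g ∈ s.erase p := by
    intro p
    by_cases hp : p ∈ s
    · obtain ⟨g, hg⟩ := face_nonempty (erase_mem_faces hN hs hp)
      exact ⟨g, fun _ => hg⟩
    · exact ⟨0, fun h => absurd h hp⟩
  choose g hg using hex
  have hbary := sum_barycentric (indep_of_mem_elements hs) hcard
    (n := fun p => T.normal (s.erase p)) (g := g)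
    (fun p hp x hx hxp => normal_orth (erase_mem_faces hN hs hp) x
      (Finset.mem_erase.2 ⟨hxp, hx⟩) _ (hg p hp))
    (fun p hp => inner_normal_ne_zero hN hs hp (hg p hp))
  -- With `λ_p` the barycentric coordinates, each term is `-N |E| (λ_p(a) - (1 + b) λ_p(0))`. Since
  -- the `λ_p` sum up to 1 at every point, the total is `N |E| b`.
  have hterm : ∀ p ∈ s, T.sgn s (s.erase p) *
      ∫ x, inner ℝ (v x) (T.normal (s.erase p)) ∂surface (s.erase p) =
      -(N * volume.real (conv s)) *
      (inner ℝ (T.normal (s.erase p)) (a - g p) / inner ℝ (T.normal (s.erase p)) (p - g p)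
        - (1 + b) * (inner ℝ (T.normal (s.erase p)) (0 - g p)
          / inner ℝ (T.normal (s.erase p)) (p - g p))) := by
    intro p hp
    rw [(flux_eq (erase_mem_faces hN hs hp) hv (hg p hp)).2,
      sgn_mul_area_mul hN hs hp (hg p hp), real_inner_comm, hv, ← mul_div_assoc (1 + b), ← sub_div]
    congr 2
    simp only [inner_add_right, inner_sub_right, inner_smul_right, inner_zero_right]
    ring
  rw [Finset.sum_congr rfl hterm, ← Finset.mul_sum, Finset.sum_sub_distrib, ← Finset.mul_sum,
    hbary, hbary]
  ring

/-- Deleting a vertex is a bijection from the vertices of `s` to its facets, and the non-interior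
facets contribute nothing. -/
theorem sum_erase_eq_sum_interiorFaces [DecidableEq (Pt N)] (hN : 1 ≤ N) {s : Finset (Pt N)}
    (hs : s ∈ T.elements) {f : Finset (Pt N) → ℝ} (hf : ∀ Γ ∉ T.interiorFaces, Γ ∈ T.faces →
      Γ ⊆ s → f Γ = 0) :
    ∑ p ∈ s, f (s.erase p) = ∑ Γ ∈ T.interiorFaces, if Γ ⊆ s then f Γ else 0 := by
  rw [← Finset.sum_filter]
  have hinj : Set.InjOn (fun p => s.erase p) (s : Set (Pt N)) := by
    intro p hp q _ hpq
    by_contra hne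
    have : p ∈ s.erase q := Finset.mem_erase.2 ⟨hne, hp⟩
    rw [← show s.erase p = s.erase q from hpq] at this
    simp at this
  rw [← Finset.sum_image (f := f) (g := fun p => s.erase p) hinj]
  symm
  refine Finset.sum_subset ?_ ?_
  · intro Γ hΓ
    obtain ⟨hΓ, hsub⟩ := Finset.mem_filter.1 hΓ
    obtain ⟨p, hp, he⟩ := exists_insert hs (T.mem_interiorFaces.1 hΓ).1 hsub
    refine Finset.mem_image.2 ⟨p, by rw [he]; simp, ?_⟩
    subst he
    simp [hp]
  · intro Γ hΓ hnot
    obtain ⟨p, hp, rfl⟩ := Finset.mem_image.1 hΓ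
    have hsub := Finset.erase_subset p s
    exact hf _ (fun h => hnot (Finset.mem_filter.2 ⟨h, hsub⟩)) (erase_mem_faces hN hs hp) hsub

/-- The order of summation is exchanged; an interior face belongs to exactly two elements. -/
theorem sum_elements_interiorFaces [DecidableEq (Pt N)] {A : Type*} [AddCommMonoid A]
    (ho : IsOpen Ω) (f : Finset (Pt N) → Finset (Pt N) → A) :
    ∑ s ∈ T.elements, ∑ Γ ∈ T.interiorFaces, (if Γ ⊆ s then f s Γ else 0) =
      ∑ Γ ∈ T.interiorFaces, (f (T.plus Γ) Γ + f (T.minus Γ) Γ) := by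
  rw [Finset.sum_comm]
  refine Finset.sum_congr rfl fun Γ hΓ => ?_
  rw [← Finset.sum_filter]
  have : T.elements.filter (fun s => Γ ⊆ s) = {T.plus Γ, T.minus Γ} := by
    ext s
    simp only [Finset.mem_filter, Finset.mem_insert, Finset.mem_singleton]
    constructor
    · rintro ⟨h1, h2⟩; exact eq_plus_or_eq_minus ho hΓ h1 h2
    · rintro (rfl | rfl)
      · exact ⟨plus_mem ho hΓ, subset_plus ho hΓ⟩
      · exact ⟨minus_mem ho hΓ, subset_minus ho hΓ⟩
  rw [this, Finset.sum_pair (plus_ne_minus ho hΓ)]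

variable (T) in
/-- The flux of a member of `V_h` through an interior face. -/
noncomputable def flux (v : Finset (Pt N) → Pt N → Pt N) (Γ : Finset (Pt N)) : ℝ :=
  ∫ x, inner ℝ (v (T.minus Γ) x) (T.normal Γ) ∂surface Γ

/-- Discrete integration by parts. -/
theorem sum_mul_divergence (hN : 1 ≤ N) (ho : IsOpen Ω) {v : Finset (Pt N) → Pt N → Pt N}
    (hv : T.MemV v) (φ : Finset (Pt N) → ℝ) :
    ∑ s ∈ T.elements, volume.real (conv s) * (φ s * divergence (v s) 0) =
      ∑ Γ ∈ T.interiorFaces, T.flux v Γ * (φ (T.minus Γ) - φ (T.plus Γ)) := by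
  classical
  have h1 : ∀ s ∈ T.elements, volume.real (conv s) * (φ s * divergence (v s) 0) =
      ∑ Γ ∈ T.interiorFaces, if Γ ⊆ s then
        φ s * (T.sgn s Γ * ∫ x, inner ℝ (v s x) (T.normal Γ) ∂surface Γ) else 0 := by
    intro s hs
    obtain ⟨a, b, hab⟩ := hv.local_form s hs
    rw [divergence_of_affine hab, mul_left_comm, ← sum_sgn_mul_flux hN hs hab, Finset.mul_sum]
    refine sum_erase_eq_sum_interiorFaces hN hs (f := fun Γ => φ s * (T.sgn s Γ *
      ∫ x, inner ℝ (v s x) (T.normal Γ) ∂surface Γ)) fun Γ hΓi hΓ hsub => ?_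
    have hfr : conv Γ ⊆ frontier Ω := by
      by_contra h
      exact hΓi (T.mem_interiorFaces.2 ⟨hΓ, h⟩)
    rw [hv.boundary Γ hΓ hfr s hs hsub, mul_zero, mul_zero]
  rw [Finset.sum_congr rfl h1, sum_elements_interiorFaces ho fun s Γ =>
    φ s * (T.sgn s Γ * ∫ x, inner ℝ (v s x) (T.normal Γ) ∂surface Γ)]
  refine Finset.sum_congr rfl fun Γ hΓ => ?_
  have hm := hv.matching Γ (T.mem_interiorFaces.1 hΓ).1 _ (plus_mem ho hΓ) _ (minus_mem ho hΓ)
    (subset_plus ho hΓ) (subset_minus ho hΓ)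
  rw [sgn_plus ho hΓ, sgn_minus ho hΓ, hm, flux]
  ring

variable (T) in
/-- The lowest order Raviart–Thomas field with given fluxes through the interior faces. -/
noncomputable def raviartThomas (F : Finset (Pt N) → ℝ) (s : Finset (Pt N)) (x : Pt N) : Pt N :=
  open Classical in ∑ p ∈ s, ((if s.erase p ∈ T.interiorFaces then
    T.sgn s (s.erase p) * F (s.erase p) else 0) / (N * volume.real (conv s))) • (x - p)

theorem raviartThomas_form (F : Finset (Pt N) → ℝ) (s : Finset (Pt N)) :
    ∃ (a : Pt N) (b : ℝ), ∀ x, T.raviartThomas F s x = a + b • x := by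
  classical
  refine ⟨-∑ p ∈ s, ((if s.erase p ∈ T.interiorFaces then
    T.sgn s (s.erase p) * F (s.erase p) else 0) / (N * volume.real (conv s))) • p,
    ∑ p ∈ s, ((if s.erase p ∈ T.interiorFaces then
    T.sgn s (s.erase p) * F (s.erase p) else 0) / (N * volume.real (conv s))), fun x => ?_⟩
  rw [raviartThomas, Finset.sum_smul]
  simp_rw [smul_sub]
  rw [Finset.sum_sub_distrib]
  abel

/-- The field `x - q` is tangential to every face through `q`, so only the vertex opposite to `Γ`
contributes. There the normal component is the height, and height times area cancels the
normalisation `N |E|`. -/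
theorem flux_raviartThomas (hN : 1 ≤ N) (F : Finset (Pt N) → ℝ) {s Γ : Finset (Pt N)}
    (hs : s ∈ T.elements) (hΓ : Γ ∈ T.faces) (h : Γ ⊆ s) :
    ∫ x, inner ℝ (T.raviartThomas F s x) (T.normal Γ) ∂surface Γ =
      open Classical in if Γ ∈ T.interiorFaces then F Γ else 0 := by
  classical
  obtain ⟨g, hg⟩ := face_nonempty hΓ
  obtain ⟨a, b, hab⟩ := raviartThomas_form (T := T) F s
  rw [(flux_eq hΓ hab hg).2]
  obtain ⟨p, hpΓ, hsp⟩ := exists_insert hs hΓ h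
  have hps : p ∈ s := by rw [hsp]; simp
  have hΓe : Γ = s.erase p := by rw [hsp]; simp [hpΓ]
  have hg' : g ∈ s.erase p := hΓe ▸ hg
  rw [raviartThomas, sum_inner, Finset.sum_eq_single p]
  · rw [← hΓe, real_inner_smul_left, real_inner_comm]
    have h1 := area_mul_abs_inner hN hs hps hg'
    have h2 := sgn_mul_abs_inner hN hs hps hg'
    have h3 := sgn_mul_self (T := T) s (s.erase p)
    rw [← hΓe] at h1 h2 h3
    have hv := vol_pos hs
    have hN' : (0 : ℝ) < N := by exact_mod_cast hN
    have e : inner ℝ (T.normal Γ) (g - p) = T.sgn s Γ * |inner ℝ (T.normal Γ) (p - g)| := by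
      rw [h2, ← inner_neg_right, neg_sub]
    rw [e]
    split_ifs with hi
    · calc _ = (T.sgn s Γ * T.sgn s Γ) * F Γ * (area Γ * |inner ℝ (T.normal Γ) (p - g)|) /
            (N * volume.real (conv s)) := by ring
        _ = F Γ := by rw [h1, h3]; field_simp
    · simp
  · intro q hq hqp
    have hqΓ : q ∈ Γ := by rw [hΓe]; exact Finset.mem_erase.2 ⟨hqp, hq⟩
    rw [real_inner_smul_left, real_inner_comm, normal_orth hΓ g hg q hqΓ, mul_zero]
  · exact fun h => absurd hps h

theorem memV_raviartThomas (hN : 1 ≤ N) (F : Finset (Pt N) → ℝ) :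
    T.MemV (T.raviartThomas F) where
  local_form s _ := raviartThomas_form F s
  matching Γ hΓ s hs t ht hΓs hΓt := by
    rw [flux_raviartThomas hN F hs hΓ hΓs, flux_raviartThomas hN F ht hΓ hΓt]
  boundary Γ hΓ hfr s hs hΓs := by
    rw [flux_raviartThomas hN F hs hΓ hΓs, if_neg]
    exact fun h => (T.mem_interiorFaces.1 h).2 hfr

theorem flux_raviartThomas_eq (hN : 1 ≤ N) (ho : IsOpen Ω) (F : Finset (Pt N) → ℝ)
    {Γ : Finset (Pt N)} (hΓ : Γ ∈ T.interiorFaces) : T.flux (T.raviartThomas F) Γ = F Γ := by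
  rw [flux, flux_raviartThomas hN F (minus_mem ho hΓ) (T.mem_interiorFaces.1 hΓ).1
    (subset_minus ho hΓ), if_pos hΓ]

/-- Each `|x - p|` is at most the diameter; the factor `N + 1` comes from Cauchy–Schwarz over the
vertices. -/
theorem norm_raviartThomas_sq_le [DecidableEq (Pt N)] (F : Finset (Pt N) → ℝ) {s : Finset (Pt N)}
    (hs : s ∈ T.elements) {x : Pt N} (hx : x ∈ conv s) :
    ‖T.raviartThomas F s x‖ ^ 2 ≤ (N + 1) * ∑ p ∈ s,
      (if s.erase p ∈ T.interiorFaces then F (s.erase p) ^ 2 else 0) *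
        (Metric.diam (conv s) / (N * volume.real (conv s))) ^ 2 := by
  set V := (N : ℝ) * volume.real (conv s)
  have h1 : ‖T.raviartThomas F s x‖ ≤ ∑ p ∈ s,
      |(if s.erase p ∈ T.interiorFaces then F (s.erase p) else 0)| *
        (Metric.diam (conv s) / V) := by
    rw [raviartThomas]
    refine (norm_sum_le _ _).trans (Finset.sum_le_sum fun p hp => ?_)
    have hV : 0 ≤ V := by have := vol_pos hs; positivity
    have hd : ‖x - p‖ ≤ Metric.diam (conv s) := by
      rw [← dist_eq_norm]
      exact Metric.dist_le_diam_of_mem (isCompact_conv s).isBounded hx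
        (subset_convexHull ℝ _ hp)
    rw [norm_smul, norm_div, Real.norm_eq_abs, Real.norm_eq_abs, abs_of_nonneg hV]
    have hσ : |T.sgn s (s.erase p)| = 1 := by
      have := sgn_mul_self (T := T) s (s.erase p)
      rw [← abs_mul_abs_self] at this
      nlinarith [abs_nonneg (T.sgn s (s.erase p))]
    have he : |(if s.erase p ∈ T.interiorFaces then T.sgn s (s.erase p) * F (s.erase p) else 0)|
        = |(if s.erase p ∈ T.interiorFaces then F (s.erase p) else 0)| := by
      split_ifs
      · rw [abs_mul, hσ, one_mul]
      · rfl
    calc _ = |(if s.erase p ∈ T.interiorFaces then F (s.erase p) else 0)| / V * ‖x - p‖ := by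
          rw [← he]
          congr!
      _ ≤ |(if s.erase p ∈ T.interiorFaces then F (s.erase p) else 0)| / V *
          Metric.diam (conv s) := by gcongr
      _ = _ := by ring
  calc ‖T.raviartThomas F s x‖ ^ 2 ≤ (∑ p ∈ s,
      |(if s.erase p ∈ T.interiorFaces then F (s.erase p) else 0)| *
        (Metric.diam (conv s) / V)) ^ 2 := by gcongr
    _ ≤ s.card * ∑ p ∈ s, (|(if s.erase p ∈ T.interiorFaces then F (s.erase p) else 0)| *
        (Metric.diam (conv s) / V)) ^ 2 := sq_sum_le_card_mul_sum_sq
    _ = _ := by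
      rw [card_of_mem_elements hs]
      push_cast
      congr 1
      refine Finset.sum_congr rfl fun p _ => ?_
      rw [mul_pow, sq_abs]
      split_ifs <;> simp

end Mesh

end CompressibleStokes

namespace CompressibleStokes

/-! ### The curl maps `W_h` into the divergence free members of `V_h` -/

theorem partialDeriv_of_affine {N k : ℕ} {v : Pt N → Pt k} {a : Pt k} (L : Pt N →ₗ[ℝ] Pt k)
    (hv : ∀ x, v x = a + L x) (j : Fin N) (i : Fin k) (x : Pt N) :
    partialDeriv j v i x = L (EuclideanSpace.single j 1) i := by
  have hv' : v = fun x => a + L.toContinuousLinearMap x := funext hv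
  have hd : HasFDerivAt v L.toContinuousLinearMap x := by
    rw [hv']
    exact (L.toContinuousLinearMap.hasFDerivAt).const_add a
  rw [partialDeriv, hd.fderiv]
  rfl

theorem curl_of_affine_two {w : Pt 2 → Pt 1} {a : ℝ} {b : Pt 2}
    (hw : ∀ x, w x = !₂[a + inner ℝ b x]) (x : Pt 2) : curl 2 w x = !₂[b 1, -b 0] := by
  let L : Pt 2 →ₗ[ℝ] Pt 1 :=
    { toFun := fun h => !₂[inner ℝ b h]
      map_add' := fun x y => by ext i; fin_cases i; simp [inner_add_right]
      map_smul' := fun c x => by ext i; fin_cases i; simp [inner_smul_right] }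
  have hL : ∀ x, w x = WithLp.toLp 2 ![a] + L x := by
    intro x; rw [hw]; ext i; fin_cases i; simp [L]
  ext i
  fin_cases i <;> simp [curl, partialDeriv_of_affine L hL, L, EuclideanSpace.inner_single_right]

theorem curl_of_affine_three {w : Pt 3 → Pt 3} {a b : Pt 3}
    (hw : ∀ x, w x = a +
      !₂[b 1 * x 2 - b 2 * x 1, b 2 * x 0 - b 0 * x 2, b 0 * x 1 - b 1 * x 0]) (x : Pt 3) :
    curl 3 w x = (2 : ℝ) • b := by
  let L : Pt 3 →ₗ[ℝ] Pt 3 :=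
    { toFun := fun x => !₂[b 1 * x 2 - b 2 * x 1, b 2 * x 0 - b 0 * x 2, b 0 * x 1 - b 1 * x 0]
      map_add' := fun x y => by ext i; fin_cases i <;> simp <;> ring
      map_smul' := fun c x => by ext i; fin_cases i <;> simp <;> ring }
  have hL : ∀ x, w x = a + L x := hw
  ext i
  fin_cases i <;> simp [curl, partialDeriv_of_affine L hL, L] <;> ring

/-- The tangential component is constant along the edge, because `(b × (p + t (q - p))) · (q - p) =
b · (p × q)`. -/
theorem edgeIntegral_eq {w : Pt 3 → Pt 3} {a b : Pt 3}
    (hw : ∀ x, w x = a +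
      !₂[b 1 * x 2 - b 2 * x 1, b 2 * x 0 - b 0 * x 2, b 0 * x 1 - b 1 * x 0]) (p q : Pt 3) :
    edgeIntegral w p q = a 0 * (q 0 - p 0) + a 1 * (q 1 - p 1) + a 2 * (q 2 - p 2) +
      (b 0 * (p 1 * q 2 - p 2 * q 1) + b 1 * (p 2 * q 0 - p 0 * q 2) +
        b 2 * (p 0 * q 1 - p 1 * q 0)) := by
  have h : ∀ t : ℝ, inner ℝ (w (p + t • (q - p))) (q - p) =
      a 0 * (q 0 - p 0) + a 1 * (q 1 - p 1) + a 2 * (q 2 - p 2) +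
      (b 0 * (p 1 * q 2 - p 2 * q 1) + b 1 * (p 2 * q 0 - p 0 * q 2) +
        b 2 * (p 0 * q 1 - p 1 * q 0)) := by
    intro t
    rw [hw, PiLp.inner_apply, Fin.sum_univ_three]
    simp
    ring
  rw [edgeIntegral]
  simp_rw [h]
  simp

namespace Mesh

theorem memV_of_const {N : ℕ} {Ω : Set (Pt N)} {T : Mesh Ω} {v : Finset (Pt N) → Pt N → Pt N}
    {z : Finset (Pt N) → Pt N} (hv : ∀ s ∈ T.elements, ∀ x, v s x = z s)
    (hmatch : ∀ Γ ∈ T.faces, ∀ s ∈ T.elements, ∀ t ∈ T.elements, Γ ⊆ s → Γ ⊆ t →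
      inner ℝ (z s - z t) (T.normal Γ) = 0)
    (hbd : ∀ Γ ∈ T.faces, conv Γ ⊆ frontier Ω → ∀ s ∈ T.elements, Γ ⊆ s →
      inner ℝ (z s) (T.normal Γ) = 0) : T.MemV v where
  local_form s hs := ⟨z s, 0, fun x => by rw [hv s hs, zero_smul, add_zero]⟩
  matching Γ hΓ s hs t ht h1 h2 := by
    simp_rw [hv s hs, hv t ht]
    have := hmatch Γ hΓ s hs t ht h1 h2
    rw [inner_sub_left, sub_eq_zero] at this
    rw [this]
  boundary Γ hΓ hfr s hs h := by
    simp_rw [hv s hs, hbd Γ hΓ hfr s hs h]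
    simp

/-- In the plane, two vectors orthogonal to `D ≠ 0` are parallel, so rotating one by a right angle
makes it orthogonal to the other. -/
theorem inner_rot_eq_zero {D ν b : Pt 2} (hD : D ≠ 0) (h1 : inner ℝ ν D = 0)
    (h2 : inner ℝ b D = 0) : inner ℝ (!₂[b 1, -b 0] : Pt 2) ν = 0 := by
  rw [PiLp.inner_apply, Fin.sum_univ_two] at *
  simp only [RCLike.inner_apply, conj_trivial, Matrix.cons_val_zero,
    Matrix.cons_val_one] at *
  have hor : D 0 ≠ 0 ∨ D 1 ≠ 0 := by
    by_contra hcon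
    push Not at hcon
    apply hD
    ext i
    fin_cases i
    · exact hcon.1
    · exact hcon.2
  rcases hor with h | h
  · apply mul_left_cancel₀ h
    linear_combination b 1 * h1 - ν 1 * h2
  · apply mul_left_cancel₀ h
    linear_combination -b 0 * h1 + ν 0 * h2

/-- The normal component of the rotated gradient is the tangential derivative, which the two vertex
values on the edge determine. -/
theorem memV_curl_two {Ω : Set (Pt 2)} {T : Mesh Ω} {w : Finset (Pt 2) → Pt 2 → Pt 1}
    (hw : T.MemW2 w) : ∃ z : Finset (Pt 2) → Pt 2, (∀ s ∈ T.elements, ∀ x, curl 2 (w s) x = z s) ∧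
      T.MemV (fun s => curl 2 (w s)) := by
  have hex : ∀ s, ∃ (a : ℝ) (b : Pt 2), s ∈ T.elements → ∀ x, w s x = !₂[a + inner ℝ b x] := by
    intro s
    by_cases hs : s ∈ T.elements
    · obtain ⟨a, b, h⟩ := hw.local_form s hs
      exact ⟨a, b, fun _ => h⟩
    · exact ⟨0, 0, fun h => absurd h hs⟩
  choose a b hab using hex
  have hz : ∀ s ∈ T.elements, ∀ x, curl 2 (w s) x = !₂[b s 1, -b s 0] :=
    fun s hs x => curl_of_affine_two (hab s hs) x
  refine ⟨fun s => !₂[b s 1, -b s 0], hz, memV_of_const hz ?_ ?_⟩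
  · intro Γ hΓ s hs t ht hΓs hΓt
    obtain ⟨p, q, hpq, rfl⟩ := Finset.card_eq_two.1 (T.mem_faces.1 hΓ).2
    have hp : p ∈ ({p, q} : Finset (Pt 2)) := by simp
    have hq : q ∈ ({p, q} : Finset (Pt 2)) := by simp
    have h1 := hw.matching s hs t ht p (hΓs hp) (hΓt hp)
    have h2 := hw.matching s hs t ht q (hΓs hq) (hΓt hq)
    rw [hab s hs, hab t ht] at h1 h2
    have h1 := congrArg (fun v : Pt 1 => v 0) h1
    have h2 := congrArg (fun v : Pt 1 => v 0) h2
    simp at h1 h2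
    have := inner_rot_eq_zero (b := b s - b t) (sub_ne_zero.2 hpq.symm)
      (normal_orth hΓ q hq p hp) (by
        simp only [inner_sub_left, inner_sub_right]; linarith)
    rw [← this]
    congr 1
    ext i
    fin_cases i <;> simp
    ring
  · intro Γ hΓ hfr s hs hΓs
    obtain ⟨p, q, hpq, rfl⟩ := Finset.card_eq_two.1 (T.mem_faces.1 hΓ).2
    have hp : p ∈ ({p, q} : Finset (Pt 2)) := by simp
    have hq : q ∈ ({p, q} : Finset (Pt 2)) := by simp
    have h1 := hw.boundary s hs p (hΓs hp) (hfr (subset_convexHull ℝ _ hp))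
    have h2 := hw.boundary s hs q (hΓs hq) (hfr (subset_convexHull ℝ _ hq))
    rw [hab s hs] at h1 h2
    have h1 := congrArg (fun v : Pt 1 => v 0) h1
    have h2 := congrArg (fun v : Pt 1 => v 0) h2
    simp at h1 h2
    exact inner_rot_eq_zero (b := b s) (sub_ne_zero.2 hpq.symm)
      (normal_orth hΓ q hq p hp) (by rw [inner_sub_right]; linarith)

/-- Hypothesis `h3` says `b · ((q - p) × (r - p)) = 0`. The normal `ν` is parallel to this cross
product, which is nonzero for a nondegenerate triangle. -/
theorem inner_eq_zero_of_circulation {p q r ν b : Pt 3}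
    (hi : AffineIndependent ℝ ![p, q, r]) (h1 : inner ℝ ν (q - p) = 0)
    (h2 : inner ℝ ν (r - p) = 0)
    (h3 : b 0 * ((q 1 - p 1) * (r 2 - p 2) - (q 2 - p 2) * (r 1 - p 1)) +
      b 1 * ((q 2 - p 2) * (r 0 - p 0) - (q 0 - p 0) * (r 2 - p 2)) +
      b 2 * ((q 0 - p 0) * (r 1 - p 1) - (q 1 - p 1) * (r 0 - p 0)) = 0) :
    inner ℝ b ν = 0 := by
  rw [PiLp.inner_apply, Fin.sum_univ_three] at *
  simp only [RCLike.inner_apply, conj_trivial, PiLp.sub_apply] at *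
  by_contra hne
  -- The product of `b · ν` with each component of the cross product vanishes, so `b · ν ≠ 0` would
  -- make the two edges parallel.
  have c0 : (q 1 - p 1) * (r 2 - p 2) - (q 2 - p 2) * (r 1 - p 1) = 0 := by
    by_contra hc
    apply hne
    apply mul_left_cancel₀ hc
    rw [mul_zero]
    linear_combination ν 0 * h3 + b 2 * ((q 1 - p 1) * h2 - (r 1 - p 1) * h1) -
      b 1 * ((q 2 - p 2) * h2 - (r 2 - p 2) * h1)
  have c1 : (q 2 - p 2) * (r 0 - p 0) - (q 0 - p 0) * (r 2 - p 2) = 0 := by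
    by_contra hc
    apply hne
    apply mul_left_cancel₀ hc
    rw [mul_zero]
    linear_combination ν 1 * h3 + b 0 * ((q 2 - p 2) * h2 - (r 2 - p 2) * h1) -
      b 2 * ((q 0 - p 0) * h2 - (r 0 - p 0) * h1)
  have c2 : (q 0 - p 0) * (r 1 - p 1) - (q 1 - p 1) * (r 0 - p 0) = 0 := by
    by_contra hc
    apply hne
    apply mul_left_cancel₀ hc
    rw [mul_zero]
    linear_combination ν 2 * h3 + b 1 * ((q 0 - p 0) * h2 - (r 0 - p 0) * h1) -
      b 0 * ((q 1 - p 1) * h2 - (r 1 - p 1) * h1)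
  have hpar : ∀ i j : Fin 3, (q i - p i) * (r j - p j) - (r i - p i) * (q j - p j) = 0 := by
    intro i j
    fin_cases i <;> fin_cases j <;> simp <;> linarith
  have hzero : ∀ i : Fin 3, q i - p i = 0 := by
    intro i
    -- The affine relation is `(q_i - p_i)(r - p) - (r_i - p_i)(q - p) = 0`; affine independence
    -- kills the coefficient of `r`.
    have h := (affineIndependent_iff.1 hi) Finset.univ
      ![(r i - p i) - (q i - p i), -(r i - p i), q i - p i] (by simp [Fin.sum_univ_three]) (by
        rw [Fin.sum_univ_three]
        ext j
        simp
        linear_combination hpar i j) 2 (Finset.mem_univ _)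
    simpa using h
  have hqp : q = p := by ext i; exact sub_eq_zero.1 (hzero i)
  have := hi.injective.ne (show (1 : Fin 3) ≠ 0 by decide)
  exact this (by simpa using hqp)

/-- By Stokes' theorem the flux of the curl through a triangle is the sum of the circulations along
its three edges, which are degrees of freedom of `W_h`. -/
theorem memV_curl_three {Ω : Set (Pt 3)} {T : Mesh Ω} {w : Finset (Pt 3) → Pt 3 → Pt 3}
    (hw : T.MemW3 w) : ∃ z : Finset (Pt 3) → Pt 3, (∀ s ∈ T.elements, ∀ x, curl 3 (w s) x = z s) ∧
      T.MemV (fun s => curl 3 (w s)) := by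
  have hex : ∀ s, ∃ a b : Pt 3, s ∈ T.elements → ∀ x, w s x = a +
      !₂[b 1 * x 2 - b 2 * x 1, b 2 * x 0 - b 0 * x 2, b 0 * x 1 - b 1 * x 0] := by
    intro s
    by_cases hs : s ∈ T.elements
    · obtain ⟨a, b, h⟩ := hw.local_form s hs
      exact ⟨a, b, fun _ => h⟩
    · exact ⟨0, 0, fun h => absurd h hs⟩
  choose a b hab using hex
  have hz : ∀ s ∈ T.elements, ∀ x, curl 3 (w s) x = (2 : ℝ) • b s :=
    fun s hs x => curl_of_affine_three (hab s hs) x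
  have hindep : ∀ {p q r : Pt 3}, p ≠ q → p ≠ r → q ≠ r → {p, q, r} ∈ T.faces →
      AffineIndependent ℝ ![p, q, r] := by
    intro p q r hpq hpr hqr hΓ
    have hi := T.complex.indep (T.mem_faces.1 hΓ).1
    let f : Fin 3 ↪ ({p, q, r} : Finset (Pt 3)) :=
      ⟨![⟨p, by simp⟩, ⟨q, by simp⟩, ⟨r, by simp⟩], by
        intro i j hij
        fin_cases i <;> fin_cases j <;> simp_all⟩
    have he : ![p, q, r] = ((↑) : ({p, q, r} : Finset (Pt 3)) → Pt 3) ∘ f := by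
      funext i
      fin_cases i <;> rfl
    rw [he]
    exact hi.comp_embedding f
  refine ⟨fun s => (2 : ℝ) • b s, hz, memV_of_const hz ?_ ?_⟩
  · intro Γ hΓ s hs t ht hΓs hΓt
    obtain ⟨p, q, r, hpq, hpr, hqr, rfl⟩ := Finset.card_eq_three.1 (T.mem_faces.1 hΓ).2
    have hp : p ∈ ({p, q, r} : Finset (Pt 3)) := by simp
    have hq : q ∈ ({p, q, r} : Finset (Pt 3)) := by simp
    have hr : r ∈ ({p, q, r} : Finset (Pt 3)) := by simp
    have h1 := hw.matching s hs t ht p (hΓs hp) q (hΓs hq) (hΓt hp) (hΓt hq)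
    have h2 := hw.matching s hs t ht q (hΓs hq) r (hΓs hr) (hΓt hq) (hΓt hr)
    have h3 := hw.matching s hs t ht r (hΓs hr) p (hΓs hp) (hΓt hr) (hΓt hp)
    rw [edgeIntegral_eq (hab s hs), edgeIntegral_eq (hab t ht)] at h1 h2 h3
    rw [← smul_sub, real_inner_smul_left, inner_eq_zero_of_circulation (hindep hpq hpr hqr hΓ)
      (normal_orth hΓ q hq p hp) (normal_orth hΓ r hr p hp), mul_zero]
    simp only [PiLp.sub_apply]
    linear_combination h1 + h2 + h3
  · intro Γ hΓ hfr s hs hΓs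
    obtain ⟨p, q, r, hpq, hpr, hqr, rfl⟩ := Finset.card_eq_three.1 (T.mem_faces.1 hΓ).2
    have hp : p ∈ ({p, q, r} : Finset (Pt 3)) := by simp
    have hq : q ∈ ({p, q, r} : Finset (Pt 3)) := by simp
    have hr : r ∈ ({p, q, r} : Finset (Pt 3)) := by simp
    have hseg : ∀ {x y : Pt 3}, x ∈ ({p, q, r} : Finset (Pt 3)) →
        y ∈ ({p, q, r} : Finset (Pt 3)) → segment ℝ x y ⊆ frontier Ω := fun hx hy =>
      (segment_subset_convexHull hx hy).trans hfr
    have h1 := hw.boundary s hs p (hΓs hp) q (hΓs hq) (hseg hp hq)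
    have h2 := hw.boundary s hs q (hΓs hq) r (hΓs hr) (hseg hq hr)
    have h3 := hw.boundary s hs r (hΓs hr) p (hΓs hp) (hseg hr hp)
    rw [edgeIntegral_eq (hab s hs)] at h1 h2 h3
    rw [real_inner_smul_left, inner_eq_zero_of_circulation (hindep hpq hpr hqr hΓ)
      (normal_orth hΓ q hq p hp) (normal_orth hΓ r hr p hp), mul_zero]
    linear_combination h1 + h2 + h3

/-- The curl of a member of `W_h` is an elementwise constant member of `V_h`. -/
theorem memV_curl {N : ℕ} (hN : N = 2 ∨ N = 3) {Ω : Set (Pt N)} {T : Mesh Ω}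
    {w : Finset (Pt N) → Pt N → Pt (vortDim N)} (hw : T.MemW w) :
    ∃ z : Finset (Pt N) → Pt N, (∀ s ∈ T.elements, ∀ x, curl N (w s) x = z s) ∧
      T.MemV (fun s => curl N (w s)) := by
  rcases hN with rfl | rfl
  · exact memV_curl_two hw
  · exact memV_curl_three hw

end Mesh

end CompressibleStokes

namespace CompressibleStokes

/-! ### The estimate of the effective viscous flux by the source term -/

/-- A lower bound for the volume of an element of unit diameter. -/
noncomputable def shapeConst (N : ℕ) (κ : ℝ) : ℝ :=
  κ⁻¹ ^ N * volume.real (Metric.ball (0 : Pt N) 1)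

theorem shapeConst_pos (N : ℕ) {κ : ℝ} (hκ : 0 < κ) : 0 < shapeConst N κ := by
  have h : 0 < volume.real (Metric.ball (0 : Pt N) 1) :=
    ENNReal.toReal_pos (Metric.measure_ball_pos volume _ one_pos).ne' measure_ball_lt_top.ne
  unfold shapeConst
  positivity

namespace Mesh

variable {N : ℕ} {Ω : Set (Pt N)} {T : Mesh Ω}

theorem shapeConst_mul_diam_pow_le (hN : 1 ≤ N) {κ : ℝ} (hκ : 0 < κ) (hT : T.ShapeRegular κ)
    {s : Finset (Pt N)} (hs : s ∈ T.elements) :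
    shapeConst N κ * Metric.diam (conv s) ^ N ≤ volume.real (conv s) := by
  obtain ⟨x, r, hr, hb⟩ := hT s hs
  have hd : 0 ≤ Metric.diam (conv s) / κ := by have := Metric.diam_nonneg (s := conv s); positivity
  have hb' : Metric.ball x (Metric.diam (conv s) / κ) ⊆ conv s :=
    (Metric.ball_subset_ball hr).trans hb
  have h1 := measureReal_mono hb' (volume_conv_lt_top s).ne
  refine le_trans (le_of_eq ?_) h1
  rcases hd.eq_or_lt with h0 | h0
  · rw [← h0, Metric.ball_zero, measureReal_empty]
    have hz : Metric.diam (conv s) = 0 := by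
      field_simp at h0
      rw [← h0, zero_mul]
    rw [hz, zero_pow (by omega), mul_zero]
  · rw [measureReal_def, Measure.addHaar_ball_of_pos _ _ h0, ENNReal.toReal_mul,
      ENNReal.toReal_ofReal (by positivity), finrank_euclideanSpace_fin, shapeConst,
      measureReal_def]
    ring

theorem diam_pos (hN : 1 ≤ N) {s : Finset (Pt N)} (hs : s ∈ T.elements) :
    0 < Metric.diam (conv s) := by
  obtain ⟨p, hp, q, hq, hpq⟩ := Finset.one_lt_card.1
    (show 1 < s.card by rw [card_of_mem_elements hs]; omega)
  exact lt_of_lt_of_le (dist_pos.2 hpq) (Metric.dist_le_diam_of_mem (isCompact_conv s).isBounded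
    (subset_convexHull ℝ _ hp) (subset_convexHull ℝ _ hq))

theorem diam_face_le {s Γ : Finset (Pt N)} (h : Γ ⊆ s) :
    Metric.diam (conv Γ) ≤ Metric.diam (conv s) :=
  Metric.diam_mono (convexHull_mono (by exact_mod_cast h)) (isCompact_conv s).isBounded

variable (T) in
/-- The discrete Dirichlet energy of a piecewise constant function. -/
noncomputable def jumpEnergy (q : PiecewiseConst N) : ℝ :=
  ∑ Γ ∈ T.interiorFaces, Metric.diam (conv Γ) ^ (N - 2) * (q (T.plus Γ) - q (T.minus Γ)) ^ 2

theorem jumpEnergy_nonneg (q : PiecewiseConst N) : 0 ≤ T.jumpEnergy q :=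
  Finset.sum_nonneg fun Γ _ => by have := Metric.diam_nonneg (s := conv Γ); positivity

/-- The fluxes of the test function for the effective viscous flux. -/
noncomputable def jumpFlux (T : Mesh Ω) (q : PiecewiseConst N) (Γ : Finset (Pt N)) : ℝ :=
  Metric.diam (conv Γ) ^ (N - 2) * (q (T.minus Γ) - q (T.plus Γ))

/-- Integration by parts pairs each flux with the jump of `q`; `jumpFlux` is the weighted jump
itself, so squares appear. -/
theorem sum_mul_divergence_raviartThomas (hN : 1 ≤ N) (ho : IsOpen Ω) (q : PiecewiseConst N) :
    ∑ s ∈ T.elements, volume.real (conv s) *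
      (q s * divergence (T.raviartThomas (T.jumpFlux q) s) 0) = T.jumpEnergy q := by
  rw [sum_mul_divergence hN ho (memV_raviartThomas hN _), jumpEnergy]
  refine Finset.sum_congr rfl fun Γ hΓ => ?_
  rw [flux_raviartThomas_eq hN ho _ hΓ, jumpFlux]
  ring

theorem continuous_of_local_form {v : Pt N → Pt N} {a : Pt N} {b : ℝ}
    (hv : ∀ x, v x = a + b • x) : Continuous v := by
  rw [show v = fun x => a + b • x from funext hv]; fun_prop

/-- A flux `F` through a face of `E` costs about `F² diam(E)² / |E|`. With `F = diam(Γ)^(N-2)` times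
the jump, one factor `diam(Γ)^(N-2)` is absorbed by `|E| ≥ c diam(E)^N`. The factor 2 counts the
elements at a face. -/
theorem integral_norm_raviartThomas_sq_le (hN : 2 ≤ N) (ho : IsOpen Ω) {κ : ℝ} (hκ : 0 < κ)
    (hT : T.ShapeRegular κ) (q : PiecewiseConst N) :
    ∑ s ∈ T.elements, ∫ x in conv s, ‖T.raviartThomas (T.jumpFlux q) s x‖ ^ 2 ≤
      2 * ((N + 1) / (N ^ 2 * shapeConst N κ)) * T.jumpEnergy q := by
  classical
  have hc := shapeConst_pos N hκ
  set C : ℝ := (N + 1) / (N ^ 2 * shapeConst N κ) with hC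
  have hC0 : 0 ≤ C := by positivity
  have h1 : ∀ s ∈ T.elements, ∫ x in conv s, ‖T.raviartThomas (T.jumpFlux q) s x‖ ^ 2 ≤
      ∑ Γ ∈ T.interiorFaces, if Γ ⊆ s then C * (Metric.diam (conv Γ) ^ (N - 2) *
        (q (T.plus Γ) - q (T.minus Γ)) ^ 2) else 0 := by
    intro s hs
    have hV := vol_pos hs
    have hd := diam_pos (by omega) hs
    obtain ⟨a, b, hab⟩ := raviartThomas_form (T := T) (T.jumpFlux q) s
    have hcont := continuous_of_local_form hab
    calc _ ≤ ∫ x in conv s, (N + 1) * ∑ p ∈ s,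
          (if s.erase p ∈ T.interiorFaces then T.jumpFlux q (s.erase p) ^ 2 else 0) *
          (Metric.diam (conv s) / (N * volume.real (conv s))) ^ 2 := by
          refine setIntegral_mono_on ?_ ?_ (measurableSet_conv s)
            fun x hx => norm_raviartThomas_sq_le _ hs hx
          · exact (by fun_prop : Continuous fun x => ‖T.raviartThomas (T.jumpFlux q) s x‖ ^ 2
              ).continuousOn.integrableOn_compact (isCompact_conv s)
          · exact integrableOn_const (volume_conv_lt_top s).ne
      _ = ∑ p ∈ s, (if s.erase p ∈ T.interiorFaces then T.jumpFlux q (s.erase p) ^ 2 else 0) *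
          ((N + 1) * Metric.diam (conv s) ^ 2 / (N ^ 2 * volume.real (conv s))) := by
          rw [setIntegral_const, smul_eq_mul, Finset.mul_sum, Finset.mul_sum]
          refine Finset.sum_congr rfl fun p _ => ?_
          have : (N : ℝ) ≠ 0 := by positivity
          field_simp
      _ = ∑ Γ ∈ T.interiorFaces, if Γ ⊆ s then
          (if Γ ∈ T.interiorFaces then T.jumpFlux q Γ ^ 2 else 0) *
          ((N + 1) * Metric.diam (conv s) ^ 2 / (N ^ 2 * volume.real (conv s))) else 0 := by
          refine sum_erase_eq_sum_interiorFaces (by omega) hs (f := fun Γ =>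
            (if Γ ∈ T.interiorFaces then T.jumpFlux q Γ ^ 2 else 0) *
            ((N + 1) * Metric.diam (conv s) ^ 2 / (N ^ 2 * volume.real (conv s)))) ?_
          intro Γ hΓ _ _
          rw [if_neg hΓ, zero_mul]
      _ ≤ _ := by
          refine Finset.sum_le_sum fun Γ hΓ => ?_
          split_ifs with hsub
          · have hle := diam_face_le hsub
            have h0 := Metric.diam_nonneg (s := conv Γ)
            set h := Metric.diam (conv Γ)
            set d := Metric.diam (conv s)
            have hvol := shapeConst_mul_diam_pow_le (by omega) hκ hT hs
            have hpow : h ^ (N - 2) * d ^ 2 ≤ d ^ N := by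
              calc h ^ (N - 2) * d ^ 2 ≤ d ^ (N - 2) * d ^ 2 := by gcongr
                _ = d ^ N := by rw [← pow_add]; congr 1; omega
            have hNr : (0 : ℝ) < N := by positivity
            have hkey : h ^ (N - 2) * ((N + 1) * d ^ 2 / (N ^ 2 * volume.real (conv s))) ≤ C := by
              rw [hC, ← mul_div_assoc, div_le_div_iff₀ (by positivity) (by positivity)]
              have : shapeConst N κ * (h ^ (N - 2) * d ^ 2) ≤ volume.real (conv s) :=
                le_trans (by gcongr) hvol
              calc h ^ (N - 2) * ((N + 1) * d ^ 2) * (N ^ 2 * shapeConst N κ) =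
                  ((N + 1) * N ^ 2) * (shapeConst N κ * (h ^ (N - 2) * d ^ 2)) := by ring
                _ ≤ ((N + 1) * N ^ 2) * volume.real (conv s) := by gcongr
                _ = _ := by ring
            rw [jumpFlux]
            calc _ = (h ^ (N - 2) * (q (T.plus Γ) - q (T.minus Γ)) ^ 2) *
                  (h ^ (N - 2) * ((N + 1) * d ^ 2 / (N ^ 2 * volume.real (conv s)))) := by ring
              _ ≤ (h ^ (N - 2) * (q (T.plus Γ) - q (T.minus Γ)) ^ 2) * C := by gcongr
              _ = _ := by ring
          · exact le_rfl
  refine (Finset.sum_le_sum h1).trans (le_of_eq ?_)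
  rw [sum_elements_interiorFaces ho fun s Γ => C * (Metric.diam (conv Γ) ^ (N - 2) *
        (q (T.plus Γ) - q (T.minus Γ)) ^ 2), jumpEnergy, Finset.mul_sum]
  refine Finset.sum_congr rfl fun Γ _ => ?_
  ring

theorem MemV.sub_smul {v z : Finset (Pt N) → Pt N → Pt N} (hv : T.MemV v) (hz : T.MemV z)
    (θ : ℝ) : T.MemV (fun s x => v s x - θ • z s x) where
  local_form s hs := by
    obtain ⟨a, b, h1⟩ := hv.local_form s hs
    obtain ⟨a', b', h2⟩ := hz.local_form s hs
    refine ⟨a - θ • a', b - θ * b', fun x => ?_⟩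
    rw [h1, h2, smul_add, _root_.sub_smul, smul_smul]
    abel
  matching Γ hΓ s hs t ht h1 h2 := by
    obtain ⟨g, hg⟩ := face_nonempty hΓ
    have hf : ∀ s ∈ T.elements, Γ ⊆ s →
        ∫ x, inner ℝ (v s x - θ • z s x) (T.normal Γ) ∂surface Γ =
        ∫ x, inner ℝ (v s x) (T.normal Γ) ∂surface Γ -
          θ * ∫ x, inner ℝ (z s x) (T.normal Γ) ∂surface Γ := by
      intro s hs h
      obtain ⟨a, b, h1⟩ := hv.local_form s hs
      obtain ⟨a', b', h2⟩ := hz.local_form s hs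
      have h3 : ∀ x, v s x - θ • z s x = (a - θ • a') + (b - θ * b') • x := by
        intro x
        rw [h1, h2, smul_add, _root_.sub_smul, smul_smul]
        abel
      rw [(flux_eq hΓ h3 hg).2, (flux_eq hΓ h1 hg).2, (flux_eq hΓ h2 hg).2, inner_sub_left,
        real_inner_smul_left]
      ring
    rw [hf s hs h1, hf t ht h2, hv.matching Γ hΓ s hs t ht h1 h2,
      hz.matching Γ hΓ s hs t ht h1 h2]
  boundary Γ hΓ hfr s hs h := by
    obtain ⟨g, hg⟩ := face_nonempty hΓ
    obtain ⟨a, b, h1⟩ := hv.local_form s hs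
    obtain ⟨a', b', h2⟩ := hz.local_form s hs
    have h3 : ∀ x, v s x - θ • z s x = (a - θ • a') + (b - θ * b') • x := by
      intro x
      rw [h1, h2, smul_add, _root_.sub_smul, smul_smul]
      abel
    have h4 := hv.boundary Γ hΓ hfr s hs h
    have h5 := hz.boundary Γ hΓ hfr s hs h
    rw [(flux_eq hΓ h1 hg).2] at h4
    rw [(flux_eq hΓ h2 hg).2] at h5
    rw [(flux_eq hΓ h3 hg).2, inner_sub_left, real_inner_smul_left]
    linear_combination h4 - θ * h5

theorem divergence_sub_smul_const {v : Pt N → Pt N} {a z : Pt N} {b : ℝ}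
    (hv : ∀ x, v x = a + b • x) (θ : ℝ) (x : Pt N) :
    divergence (fun x => v x - θ • z) x = divergence v x := by
  rw [divergence_of_affine hv, divergence_of_affine (a := a - θ • z) (b := b)]
  intro x
  rw [hv]; abel

/-- If `G` and the elementwise constant field `z ∈ V_h` satisfy the momentum equation with source
`F`, then the jumps of `G` are controlled by `F`. -/
theorem jumpEnergy_le_of_momentum (hN : 2 ≤ N) (ho : IsOpen Ω) {κ : ℝ} (hκ : 0 < κ)
    (hT : T.ShapeRegular κ) {μ : ℝ} {z' : Finset (Pt N) → Pt N → Pt N} {z F : Finset (Pt N) → Pt N}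
    (hz : ∀ s ∈ T.elements, ∀ x, z' s x = z s) (hzV : T.MemV z') {G : PiecewiseConst N}
    (hmom : ∀ v, T.MemV v →
      T.integral (fun s x => μ * inner ℝ (z' s x) (v s x) + G s * divergence (v s) x) =
      T.integral (fun s x => inner ℝ (F s) (v s x))) :
    T.jumpEnergy G ≤ 2 * ((N + 1) / (N ^ 2 * shapeConst N κ)) *
      ∑ s ∈ T.elements, volume.real (conv s) * ‖F s‖ ^ 2 := by
  have hc := shapeConst_pos N hκ
  set C : ℝ := 2 * ((N + 1) / (N ^ 2 * shapeConst N κ)) with hC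
  have hNr : (0 : ℝ) < N := by positivity
  have hC0 : 0 < C := by positivity
  set v := T.raviartThomas (T.jumpFlux G) with hvdef
  have hvV : T.MemV v := memV_raviartThomas (by omega) _
  have hvform := raviartThomas_form (T := T) (T.jumpFlux G)
  have hvc : ∀ s, Continuous (v s) := fun s => by
    obtain ⟨a, b, h⟩ := hvform s
    exact continuous_of_local_form h
  set I : Finset (Pt N) → Pt N := fun s => ∫ x in conv s, v s x with hI
  have hvint : ∀ s, IntegrableOn (v s) (conv s) := fun s =>
    (hvc s).continuousOn.integrableOn_compact (isCompact_conv s)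
  set A : ℝ := ∑ s ∈ T.elements, inner ℝ (z s) (I s) with hA
  set B : ℝ := ∑ s ∈ T.elements, volume.real (conv s) * ‖z s‖ ^ 2 with hB
  have hBnn : ∀ s ∈ T.elements, 0 ≤ volume.real (conv s) * ‖z s‖ ^ 2 := fun s _ => by positivity
  -- The coefficient of the `L²` projection of `v` onto `z`. If `B = 0`, then `z` and `A` vanish as
  -- well, so that `θ * B = A` also holds for the default value of the quotient.
  set θ : ℝ := A / B with hθ
  have hθB : θ * B = A := by
    by_cases h0 : B = 0
    · have hz0 : ∀ s ∈ T.elements, z s = 0 := by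
        intro s hs
        have := (Finset.sum_eq_zero_iff_of_nonneg hBnn).1 h0 s hs
        have hV := vol_pos hs
        have h2 : ‖z s‖ ^ 2 = 0 := by
          rcases mul_eq_zero.1 this with h | h
          · exact absurd h hV.ne'
          · exact h
        simpa using h2
      have hA0 : A = 0 := Finset.sum_eq_zero fun s hs => by rw [hz0 s hs, inner_zero_left]
      rw [h0, hA0, mul_zero]
    · rw [hθ]; field_simp
  have hcz : ∀ s, Continuous fun x => v s x - θ • z s := fun s => by
    have := hvc s
    fun_prop
  have key := hmom _ (hvV.sub_smul hzV θ)
  -- The curl term vanishes by orthogonality, and subtracting the elementwise constant `θ • z`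
  -- leaves the divergence unchanged.
  have hL : T.integral (fun s x => μ * inner ℝ (z' s x) (v s x - θ • z' s x) +
      G s * divergence (fun x => v s x - θ • z' s x) x) = T.jumpEnergy G := by
    rw [← sum_mul_divergence_raviartThomas (by omega) ho G]
    have h1 : ∀ s ∈ T.elements, ∫ x in conv s, (μ * inner ℝ (z' s x) (v s x - θ • z' s x) +
        G s * divergence (fun x => v s x - θ • z' s x) x) =
        μ * (inner ℝ (z s) (I s) - θ * (volume.real (conv s) * ‖z s‖ ^ 2)) +
        volume.real (conv s) * (G s * divergence (v s) 0) := by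
      intro s hs
      obtain ⟨a, b, hab⟩ := hvform s
      have h2 : ∀ x, μ * inner ℝ (z' s x) (v s x - θ • z' s x) +
          G s * divergence (fun x => v s x - θ • z' s x) x =
          μ * inner ℝ (z s) (v s x) + (G s * (N * b) - μ * θ * ‖z s‖ ^ 2) := by
        intro x
        have h3 : (fun x => v s x - θ • z' s x) = fun x => v s x - θ • z s := by
          funext x; rw [hz s hs]
        rw [h3, divergence_sub_smul_const hab, divergence_of_affine hab, hz s hs, inner_sub_right,
          inner_smul_right, real_inner_self_eq_norm_sq]
        ring
      simp_rw [h2]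
      rw [integral_add, setIntegral_const, integral_const_mul, integral_inner (hvint s),
        divergence_of_affine hab, smul_eq_mul]
      · ring
      · exact ((hvint s).const_inner (𝕜 := ℝ) (z s)).const_mul μ
      · exact integrableOn_const (volume_conv_lt_top s).ne
    rw [Mesh.integral, Finset.sum_congr rfl h1, Finset.sum_add_distrib, ← Finset.mul_sum,
      Finset.sum_sub_distrib, ← Finset.mul_sum, ← hA, ← hB, hθB]
    ring
  -- Young's inequality, weighted so that the bound `‖v‖² ≤ C * jumpEnergy` lets half of the energy
  -- be absorbed at the end.
  have hR : T.integral (fun s x => inner ℝ (F s) (v s x - θ • z' s x)) ≤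
      C / 2 * (∑ s ∈ T.elements, volume.real (conv s) * ‖F s‖ ^ 2) + C⁻¹ / 2 *
      ∑ s ∈ T.elements, ∫ x in conv s, ‖v s x - θ • z s‖ ^ 2 := by
    rw [Mesh.integral, Finset.mul_sum, Finset.mul_sum, ← Finset.sum_add_distrib]
    refine Finset.sum_le_sum fun s hs => ?_
    have hc1 := hcz s
    calc ∫ x in conv s, inner ℝ (F s) (v s x - θ • z' s x)
        ≤ ∫ x in conv s, (C / 2 * ‖F s‖ ^ 2 + C⁻¹ / 2 * ‖v s x - θ • z s‖ ^ 2) := by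
          simp_rw [hz s hs]
          refine setIntegral_mono_on ?_ ?_ (measurableSet_conv s) fun x _ => ?_
          · exact (by fun_prop : Continuous fun x => inner ℝ (F s) (v s x - θ • z s)
              ).continuousOn.integrableOn_compact (isCompact_conv s)
          · exact (by fun_prop : Continuous fun x => C / 2 * ‖F s‖ ^ 2 +
              C⁻¹ / 2 * ‖v s x - θ • z s‖ ^ 2).continuousOn.integrableOn_compact (isCompact_conv s)
          · refine (real_inner_le_norm _ _).trans ?_
            have h := sq_nonneg (C * ‖F s‖ - ‖v s x - θ • z s‖)
            have h2 : C⁻¹ * C = 1 := inv_mul_cancel₀ hC0.ne'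
            have h3 : 0 ≤ C⁻¹ / 2 * (C * ‖F s‖ - ‖v s x - θ • z s‖) ^ 2 := by positivity
            nlinarith [h3, h2]
      _ = _ := by
          rw [integral_add, setIntegral_const, integral_const_mul, smul_eq_mul]
          · ring
          · exact integrableOn_const (volume_conv_lt_top s).ne
          · exact (by fun_prop : Continuous fun x => C⁻¹ / 2 * ‖v s x - θ • z s‖ ^ 2
              ).continuousOn.integrableOn_compact (isCompact_conv s)
  -- Removing an orthogonal projection does not increase the norm.
  have hP : ∑ s ∈ T.elements, ∫ x in conv s, ‖v s x - θ • z s‖ ^ 2 ≤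
      ∑ s ∈ T.elements, ∫ x in conv s, ‖v s x‖ ^ 2 := by
    have h1 : ∀ s ∈ T.elements, ∫ x in conv s, ‖v s x - θ • z s‖ ^ 2 =
        (∫ x in conv s, ‖v s x‖ ^ 2) - 2 * θ * inner ℝ (z s) (I s) +
          θ ^ 2 * (volume.real (conv s) * ‖z s‖ ^ 2) := by
      intro s _
      have h2 : ∀ x, ‖v s x - θ • z s‖ ^ 2 =
          ‖v s x‖ ^ 2 - 2 * θ * inner ℝ (z s) (v s x) + θ ^ 2 * ‖z s‖ ^ 2 := by
        intro x
        rw [norm_sub_sq_real, inner_smul_right, norm_smul, mul_pow, Real.norm_eq_abs, sq_abs,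
          real_inner_comm]
        ring
      have hc1 := hvc s
      have hi1 : IntegrableOn (fun x => ‖v s x‖ ^ 2) (conv s) :=
        (by fun_prop : Continuous fun x => ‖v s x‖ ^ 2).continuousOn.integrableOn_compact
          (isCompact_conv s)
      have hi3 : IntegrableOn (fun _ : Pt N => θ ^ 2 * ‖z s‖ ^ 2) (conv s) :=
        integrableOn_const (volume_conv_lt_top s).ne
      have hi2 : IntegrableOn (fun x => 2 * θ * inner ℝ (z s) (v s x)) (conv s) :=
        ((hvint s).const_inner (𝕜 := ℝ) (z s)).const_mul _
      simp_rw [h2]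
      refine (integral_add (μ := volume.restrict (conv s)) (f := fun x => ‖v s x‖ ^ 2 - 2 * θ *
        inner ℝ (z s) (v s x)) (g := fun _ => θ ^ 2 * ‖z s‖ ^ 2) 
        (hi1.integrable.sub hi2.integrable) hi3).trans ?_
      rw [integral_sub hi1 hi2, integral_const_mul, integral_inner (hvint s), setIntegral_const,
        smul_eq_mul]
      ring
    have h2 := Finset.sum_congr rfl h1
    rw [h2, Finset.sum_add_distrib, Finset.sum_sub_distrib, ← Finset.mul_sum, ← Finset.mul_sum,
      ← hA, ← hB]
    have hB0 : 0 ≤ B := Finset.sum_nonneg hBnn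
    have h3 : 0 ≤ θ ^ 2 * B := by positivity
    have h4 : θ * A = θ ^ 2 * B := by rw [← hθB]; ring
    linarith
  have hbound := integral_norm_raviartThomas_sq_le hN ho hκ hT G
  rw [← hC, ← hvdef] at hbound
  have hfin : T.jumpEnergy G ≤ C / 2 * (∑ s ∈ T.elements, volume.real (conv s) * ‖F s‖ ^ 2) +
      C⁻¹ / 2 * (C * T.jumpEnergy G) :=
    (hL.symm.trans key).le.trans (hR.trans (by gcongr; exact hP.trans hbound))
  have h2 : C⁻¹ / 2 * (C * T.jumpEnergy G) = T.jumpEnergy G / 2 := by field_simp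
  rw [h2] at hfin
  linarith

end Mesh

end CompressibleStokes

namespace CompressibleStokes

/-! ### The upwind scheme: positivity, conservation of mass, energy -/

section Upwind

variable {α β : Type*} {E : Finset α} {F : Finset β} {vol ρ ρ' : α → ℝ} {minus plus : β → α}
  {U : β → ℝ} {dt : ℝ}

/-- The test function is the indicator of the set where `ρ ≤ 0`. Upwinding gives the flux term a
sign, so the left side is nonpositive, while the right side is positive if that set is nonempty. -/
theorem pos_of_upwind (hvol : ∀ s ∈ E, 0 < vol s) (hdt : 0 ≤ dt)
    (h : ∀ φ : α → ℝ, ∑ s ∈ E, vol s * (ρ s * φ s) - dt * ∑ Γ ∈ F, (ρ (minus Γ) * max (U Γ) 0 +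
      ρ (plus Γ) * min (U Γ) 0) * (φ (plus Γ) - φ (minus Γ)) = ∑ s ∈ E, vol s * (ρ' s * φ s))
    (hρ' : ∀ s ∈ E, 0 < ρ' s) : ∀ s ∈ E, 0 < ρ s := by
  classical
  by_contra hcon
  push Not at hcon
  obtain ⟨s₀, hs₀, hneg⟩ := hcon
  set φ : α → ℝ := fun s => if ρ s ≤ 0 then 1 else 0 with hφ
  have h1 := h φ
  have h2 : ∑ s ∈ E, vol s * (ρ s * φ s) ≤ 0 := by
    refine Finset.sum_nonpos fun s hs => ?_
    have hv := hvol s hs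
    simp only [hφ]
    split_ifs with hc
    · rw [mul_one]; exact mul_nonpos_of_nonneg_of_nonpos hv.le hc
    · simp
  have h3 : 0 < ∑ s ∈ E, vol s * (ρ' s * φ s) := by
    refine Finset.sum_pos' (fun s hs => ?_) ⟨s₀, hs₀, ?_⟩
    · have hv := hvol s hs
      have hr := hρ' s hs
      simp only [hφ]
      split_ifs
      · positivity
      · simp
    · have hv := hvol s₀ hs₀
      have hr := hρ' s₀ hs₀
      simp only [hφ, if_pos hneg]
      positivity
  have h4 : 0 ≤ ∑ Γ ∈ F, (ρ (minus Γ) * max (U Γ) 0 +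
      ρ (plus Γ) * min (U Γ) 0) * (φ (plus Γ) - φ (minus Γ)) := by
    refine Finset.sum_nonneg fun Γ _ => ?_
    have hmax : 0 ≤ max (U Γ) 0 := le_max_right _ _
    have hmin : min (U Γ) 0 ≤ 0 := min_le_right _ _
    simp only [hφ]
    split_ifs with c1 c2 c2
    · simp
    · push Not at c2
      nlinarith [mul_nonneg c2.le hmax, mul_nonneg_of_nonpos_of_nonpos c1 hmin]
    · push Not at c1
      have k1 := mul_nonpos_of_nonneg_of_nonpos c1.le hmin
      have k2 := mul_nonpos_of_nonpos_of_nonneg c2 hmax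
      linarith
    · simp
  have h5 := mul_nonneg hdt h4
  linarith

theorem mass_of_upwind
    (h : ∀ φ : α → ℝ, ∑ s ∈ E, vol s * (ρ s * φ s) - dt * ∑ Γ ∈ F, (ρ (minus Γ) * max (U Γ) 0 +
      ρ (plus Γ) * min (U Γ) 0) * (φ (plus Γ) - φ (minus Γ)) = ∑ s ∈ E, vol s * (ρ' s * φ s)) :
    ∑ s ∈ E, vol s * ρ s = ∑ s ∈ E, vol s * ρ' s := by
  simpa using h (fun _ => 1)

/-- Bernoulli's inequality at `s / r`: the convex power lies above its tangents. -/
theorem rpow_tangent {γ r s : ℝ} (hγ : 1 < γ) (hr : 0 < r) (hs : 0 < s) :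
    r ^ γ + γ * r ^ (γ - 1) * (s - r) ≤ s ^ γ := by
  have h1 := one_add_mul_self_le_rpow_one_add (s := s / r - 1) (by
    have := div_pos hs hr; linarith) hγ.le
  rw [add_sub_cancel, Real.div_rpow hs.le hr.le, le_div_iff₀ (Real.rpow_pos_of_pos hr _)] at h1
  rw [Real.rpow_sub hr, Real.rpow_one]
  refine le_trans (le_of_eq ?_) h1
  field_simp

/-- The test function is `D (ρ)`, where `D` is the derivative of the convex function `b(r) = A r^γ`,
`A = a / (γ - 1)`, for which `r b'(r) - b(r)` is the pressure. Convexity makes the errors of the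
implicit time step and of the upwinding dissipative. -/
theorem energy_of_upwind {a γ : ℝ} (ha : 0 < a) (hγ : 1 < γ) (hvol : ∀ s ∈ E, 0 < vol s)
    (hm : ∀ Γ ∈ F, minus Γ ∈ E) (hp : ∀ Γ ∈ F, plus Γ ∈ E) (hdt : 0 ≤ dt)
    (h : ∀ φ : α → ℝ, ∑ s ∈ E, vol s * (ρ s * φ s) - dt * ∑ Γ ∈ F, (ρ (minus Γ) * max (U Γ) 0 +
      ρ (plus Γ) * min (U Γ) 0) * (φ (plus Γ) - φ (minus Γ)) = ∑ s ∈ E, vol s * (ρ' s * φ s))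
    (hρ : ∀ s ∈ E, 0 < ρ s) (hρ' : ∀ s ∈ E, 0 < ρ' s) :
    (γ - 1)⁻¹ * ∑ s ∈ E, vol s * pressure a γ (ρ s) +
      dt * ∑ Γ ∈ F, U Γ * (pressure a γ (ρ (minus Γ)) - pressure a γ (ρ (plus Γ))) ≤
    (γ - 1)⁻¹ * ∑ s ∈ E, vol s * pressure a γ (ρ' s) := by
  have hγ1 : 0 < γ - 1 := by linarith
  set A : ℝ := (γ - 1)⁻¹ * a with hA
  have hA0 : 0 < A := by positivity
  have hAa : A * (γ - 1) = a := by rw [hA]; field_simp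
  set D : ℝ → ℝ := fun r => A * (γ * r ^ (γ - 1)) with hD
  have htan : ∀ r s, 0 < r → 0 < s → A * r ^ γ + D r * (s - r) ≤ A * s ^ γ := by
    intro r s hr hs
    have := mul_le_mul_of_nonneg_left (rpow_tangent hγ hr hs) hA0.le
    simp only [hD]
    linarith
  have hpr : ∀ r, 0 < r → r * D r = A * r ^ γ + a * r ^ γ := by
    intro r hr
    simp only [hD]
    rw [Real.rpow_sub hr, Real.rpow_one, ← hAa]
    field_simp
    ring
  have h1 := h fun s => D (ρ s)
  -- The tangent is taken at the downwind density and evaluated at the upwind one; so the sign of `U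
  -- Γ` decides the roles.
  have h2 : ∑ Γ ∈ F, (ρ (minus Γ) * max (U Γ) 0 + ρ (plus Γ) * min (U Γ) 0) *
      (D (ρ (plus Γ)) - D (ρ (minus Γ))) ≤
      ∑ Γ ∈ F, U Γ * (a * (ρ (plus Γ)) ^ γ - a * (ρ (minus Γ)) ^ γ) := by
    refine Finset.sum_le_sum fun Γ hΓ => ?_
    have hr := hρ _ (hm Γ hΓ)
    have hs := hρ _ (hp Γ hΓ)
    have e1 := hpr _ hr
    have e2 := hpr _ hs
    rcases le_total 0 (U Γ) with hU | hU
    · rw [max_eq_left hU, min_eq_right hU, mul_zero, add_zero, mul_comm (ρ (minus Γ)), mul_assoc]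
      refine mul_le_mul_of_nonneg_left ?_ hU
      have := htan _ _ hs hr
      linarith
    · rw [max_eq_right hU, min_eq_left hU, mul_zero, zero_add, mul_comm (ρ (plus Γ)), mul_assoc]
      refine mul_le_mul_of_nonpos_left ?_ hU
      have := htan _ _ hr hs
      linarith
  have h3 : ∑ s ∈ E, vol s * (A * ρ s ^ γ) - ∑ s ∈ E, vol s * (A * ρ' s ^ γ) ≤
      ∑ s ∈ E, vol s * (ρ s * D (ρ s)) - ∑ s ∈ E, vol s * (ρ' s * D (ρ s)) := by
    rw [← Finset.sum_sub_distrib, ← Finset.sum_sub_distrib]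
    refine Finset.sum_le_sum fun s hs => ?_
    have := mul_nonneg (hvol s hs).le (sub_nonneg.2 (htan _ _ (hρ s hs) (hρ' s hs)))
    linarith
  have h4 := mul_le_mul_of_nonneg_left h2 hdt
  have e3 : ∀ q : α → ℝ, (γ - 1)⁻¹ * ∑ s ∈ E, vol s * pressure a γ (q s) =
      ∑ s ∈ E, vol s * (A * q s ^ γ) := by
    intro q
    rw [Finset.mul_sum]
    refine Finset.sum_congr rfl fun s _ => ?_
    rw [pressure, hA]; ring
  have e4 : ∑ Γ ∈ F, U Γ * (pressure a γ (ρ (minus Γ)) - pressure a γ (ρ (plus Γ))) =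
      -∑ Γ ∈ F, U Γ * (a * (ρ (plus Γ)) ^ γ - a * (ρ (minus Γ)) ^ γ) := by
    rw [← Finset.sum_neg_distrib]
    refine Finset.sum_congr rfl fun Γ _ => ?_
    rw [pressure, pressure]; ring
  rw [e3, e3, e4]
  linarith

end Upwind

namespace Mesh

variable {N : ℕ} {Ω : Set (Pt N)} {T : Mesh Ω}

theorem integral_const_elements (q : PiecewiseConst N) :
    T.integral (fun s _ => q s) = ∑ s ∈ T.elements, volume.real (conv s) * q s := by
  simp [Mesh.integral]

/-- As the normal velocity is constant on the face, taking positive and negative parts commutes with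
integration. -/
theorem integral_upwindFlux (ho : IsOpen Ω) {ρ φ : PiecewiseConst N}
    {u : Finset (Pt N) → Pt N → Pt N} (hu : T.MemV u) {Γ : Finset (Pt N)}
    (hΓ : Γ ∈ T.interiorFaces) :
    ∫ x, T.upwindFlux ρ u Γ x * (T.tracePlus φ Γ - T.traceMinus φ Γ) ∂surface Γ =
      (ρ (T.minus Γ) * max (T.flux u Γ) 0 + ρ (T.plus Γ) * min (T.flux u Γ) 0) *
        (φ (T.plus Γ) - φ (T.minus Γ)) := by
  have hΓf := (T.mem_interiorFaces.1 hΓ).1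
  obtain ⟨g, hg⟩ := face_nonempty hΓf
  obtain ⟨a, b, hab⟩ := hu.local_form _ (minus_mem ho hΓ)
  obtain ⟨h1, h2⟩ := flux_eq hΓf hab hg
  set c := inner ℝ (u (T.minus Γ) g) (T.normal Γ)
  have h3 : ∀ x ∈ conv Γ, T.upwindFlux ρ u Γ x * (T.tracePlus φ Γ - T.traceMinus φ Γ) =
      (ρ (T.minus Γ) * max c 0 + ρ (T.plus Γ) * min c 0) *
        (φ (T.plus Γ) - φ (T.minus Γ)) := by
    intro x hx
    rw [upwindFlux, tracePlus_eq ho hΓ, tracePlus_eq ho hΓ, traceMinus_eq ho hΓ,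
      traceMinus_eq ho hΓ, traceMinus_eq ho hΓ, h1 x hx]
  have hA := area_nonneg Γ
  rw [integral_surface_of_forall_eq h3, flux, h2]
  have e1 : max (area Γ * c) 0 = area Γ * max c 0 := by
    rw [mul_max_of_nonneg _ _ hA, mul_zero]
  have e2 : min (area Γ * c) 0 = area Γ * min c 0 := by
    rw [mul_min_of_nonneg _ _ hA, mul_zero]
  rw [e1, e2]
  ring

end Mesh

/-! ### Positivity, mass and energy of a numerical solution -/

namespace IsNumericalSolution

variable {N : ℕ} {Ω : Set (Pt N)} {a γ μ lam : ℝ} {f : ℝ → Pt N → Pt N} {T : Mesh Ω} {dt : ℝ}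
  {M : ℕ} {ρ : ℕ → PiecewiseConst N} {w : ℕ → Finset (Pt N) → Pt N → Pt (vortDim N)}
  {u : ℕ → Finset (Pt N) → Pt N → Pt N} (hsol : IsNumericalSolution a γ μ lam f T dt M ρ w u)

include hsol

theorem upwind (ho : IsOpen Ω) {m : ℕ} (hm : m ∈ Finset.Icc 1 M) (φ : PiecewiseConst N) :
    ∑ s ∈ T.elements, volume.real (conv s) * (ρ m s * φ s) -
      dt * ∑ Γ ∈ T.interiorFaces, (ρ m (T.minus Γ) * max (T.flux (u m) Γ) 0 +
        ρ m (T.plus Γ) * min (T.flux (u m) Γ) 0) * (φ (T.plus Γ) - φ (T.minus Γ)) =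
    ∑ s ∈ T.elements, volume.real (conv s) * (ρ (m - 1) s * φ s) := by
  have h := hsol.continuity m hm φ
  rw [Mesh.integral_const_elements (fun s => ρ m s * φ s),
    Mesh.integral_const_elements (fun s => ρ (m - 1) s * φ s)] at h
  rw [← h]
  congr 2
  exact Finset.sum_congr rfl fun Γ hΓ => (Mesh.integral_upwindFlux ho (hsol.memV m hm) hΓ).symm

theorem density_pos (ho : IsOpen Ω) (hdt : 0 ≤ dt) {m : ℕ} (hm : m ≤ M) :
    ∀ s ∈ T.elements, 0 < ρ m s := by
  induction m with
  | zero => exact hsol.initial_pos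
  | succ m ih =>
    have hm' : m + 1 ∈ Finset.Icc 1 M := Finset.mem_Icc.2 ⟨by omega, hm⟩
    exact pos_of_upwind (fun s hs => Mesh.vol_pos hs) hdt
      (fun φ => hsol.upwind ho hm' φ) (ih (by omega))

theorem mass_eq (ho : IsOpen Ω) {m : ℕ} (hm : m ≤ M) :
    ∑ s ∈ T.elements, volume.real (conv s) * ρ m s =
      ∑ s ∈ T.elements, volume.real (conv s) * ρ 0 s := by
  induction m with
  | zero => rfl
  | succ m ih =>
    have hm' : m + 1 ∈ Finset.Icc 1 M := Finset.mem_Icc.2 ⟨by omega, hm⟩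
    rw [← ih (by omega)]
    exact mass_of_upwind (fun φ => hsol.upwind ho hm' φ)

theorem energy_le (hN : 1 ≤ N) (ho : IsOpen Ω) (ha : 0 < a) (hγ : 1 < γ) (hdt : 0 ≤ dt) {m : ℕ}
    (hm : m + 1 ≤ M) :
    (γ - 1)⁻¹ * ∑ s ∈ T.elements, volume.real (conv s) * pressure a γ (ρ (m + 1) s) +
      dt * ∑ s ∈ T.elements, volume.real (conv s) *
        (pressure a γ (ρ (m + 1) s) * divergence (u (m + 1) s) 0) ≤
    (γ - 1)⁻¹ * ∑ s ∈ T.elements, volume.real (conv s) * pressure a γ (ρ m s) := by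
  have hm' : m + 1 ∈ Finset.Icc 1 M := Finset.mem_Icc.2 ⟨by omega, hm⟩
  rw [Mesh.sum_mul_divergence hN ho (hsol.memV _ hm') fun s => pressure a γ (ρ (m + 1) s)]
  exact energy_of_upwind ha hγ (fun s hs => Mesh.vol_pos hs) (fun Γ hΓ => Mesh.minus_mem ho hΓ)
      (fun Γ hΓ => Mesh.plus_mem ho hΓ) hdt (fun φ => hsol.upwind ho hm' φ)
      (hsol.density_pos ho hdt hm) (hsol.density_pos ho hdt (by omega))

end IsNumericalSolution

end CompressibleStokes

namespace CompressibleStokes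

/-! ### Volumes of shadows and the Riesz kernel -/

/-- The constant in the estimate of the volume of a shadow. -/
noncomputable def shadowConst (N : ℕ) (D : ℝ) : ℝ :=
  2 * (8 * D) ^ N * volume.real (Metric.ball (0 : Pt N) 1)

theorem shadowConst_nonneg (N : ℕ) {D : ℝ} (hD : 0 ≤ D) : 0 ≤ shadowConst N D := by
  unfold shadowConst; positivity

theorem volume_closedBall_eq {N : ℕ} (x : Pt N) {r : ℝ} (hr : 0 ≤ r) :
    volume (Metric.closedBall x r) =
      ENNReal.ofReal (r ^ N * volume.real (Metric.ball (0 : Pt N) 1)) := by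
  rw [Measure.addHaar_closedBall _ _ hr, finrank_euclideanSpace_fin,
    ENNReal.ofReal_mul (by positivity), measureReal_def, ENNReal.ofReal_toReal]
  exact measure_ball_lt_top.ne

/-- The part within the distance `D` of the shadow of a ball of radius `h`, with `x` as the source
of light. -/
theorem volume_shadow_le {N : ℕ} (hN : 1 ≤ N) {D h : ℝ} (hD : 0 < D) (hh : 0 < h) (x g : Pt N) :
    volume {y : Pt N | dist x y ≤ D ∧ ∃ z ∈ segment ℝ x y, dist z g ≤ h} ≤
      ENNReal.ofReal (shadowConst N D * (h / (h + dist x g)) ^ (N - 1)) := by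
  set d := dist x g with hd
  have hd0 : 0 ≤ d := dist_nonneg
  set ω := volume.real (Metric.ball (0 : Pt N) 1) with hω
  have hω0 : 0 ≤ ω := measureReal_nonneg
  set β := h / (h + d) with hβ
  have hβ0 : 0 ≤ β := by positivity
  rcases le_or_gt d (2 * h) with hcase | hcase
  -- Close to the source of light the ratio `β` is bounded below, and the whole ball of radius `D`
  -- is an admissible bound.
  · have hsub : {y : Pt N | dist x y ≤ D ∧ ∃ z ∈ segment ℝ x y, dist z g ≤ h} ⊆
        Metric.closedBall x D := fun y hy => by
      rw [Metric.mem_closedBall, dist_comm]; exact hy.1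
    refine (measure_mono hsub).trans ?_
    rw [volume_closedBall_eq x hD.le]
    refine ENNReal.ofReal_le_ofReal ?_
    have hβ1 : 1 ≤ 8 * β := by
      rw [hβ, mul_div_assoc', le_div_iff₀ (by positivity)]; linarith
    have h1 : D ^ N ≤ 2 * (8 * D) ^ N * β ^ (N - 1) := by
      have h2 : (1 : ℝ) ≤ (8 * β) ^ (N - 1) := one_le_pow₀ hβ1
      have h3 : (8 : ℝ) ^ N = 8 * 8 ^ (N - 1) := by
        rw [← pow_succ']; congr 1; omega
      calc D ^ N = D ^ N * 1 := by ring
        _ ≤ D ^ N * (8 * β) ^ (N - 1) := by gcongr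
        _ ≤ 16 * (D ^ N * (8 * β) ^ (N - 1)) := by
          have : 0 ≤ D ^ N * (8 * β) ^ (N - 1) := by positivity
          linarith
        _ = _ := by rw [mul_pow, mul_pow, h3]; ring
    rw [shadowConst, ← hω]
    calc D ^ N * ω ≤ (2 * (8 * D) ^ N * β ^ (N - 1)) * ω := by gcongr
      _ = _ := by ring
  · have hdpos : 0 < d := by linarith
    set r := 2 * D * h / d with hr
    have hr0 : 0 < r := by positivity
    set e := d⁻¹ • (g - x) with he
    have hnorm : ‖g - x‖ = d := by rw [hd, dist_comm, dist_eq_norm]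
    have hge : g - x = d • e := by rw [he, smul_smul, mul_inv_cancel₀ hdpos.ne', one_smul]
    have hen : ‖e‖ = 1 := by
      rw [he, norm_smul, hnorm, norm_inv, Real.norm_of_nonneg hd0, inv_mul_cancel₀ hdpos.ne']
    -- Far from the source, the shadow lies within `r = 2 D h / d` of the ray from `x` through `g`,
    -- at a parameter at most `2 D`. About `d / h` balls of radius `2 r` cover it, with total volume
    -- of order `(d / h) (h / d) ^ N`.
    have hsub : {y : Pt N | dist x y ≤ D ∧ ∃ z ∈ segment ℝ x y, dist z g ≤ h} ⊆
        ⋃ j ∈ Finset.range (⌊d / h⌋₊ + 1), Metric.closedBall (x + ((j : ℝ) * r) • e) (2 * r) := by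
      rintro y ⟨hyD, z, hz, hzg⟩
      rw [segment_eq_image'] at hz
      obtain ⟨s, ⟨hs0, hs1⟩, rfl⟩ := hz
      have hzx : d / 2 ≤ s * ‖y - x‖ := by
        have h1 : d ≤ dist x (x + s • (y - x)) + dist (x + s • (y - x)) g := dist_triangle _ _ _
        rw [dist_self_add_right, norm_smul, Real.norm_of_nonneg hs0] at h1
        linarith
      have hyx : ‖y - x‖ ≤ D := by rw [← dist_eq_norm, dist_comm]; exact hyD
      have hspos : 0 < s := by
        rcases hs0.eq_or_lt with h0 | h0
        · rw [← h0, zero_mul] at hzx; linarith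
        · exact h0
      have hs' : s⁻¹ ≤ 2 * D / d := by
        rw [inv_le_iff_one_le_mul₀ hspos, div_mul_eq_mul_div, le_div_iff₀ hdpos]
        have : s * ‖y - x‖ ≤ s * D := by gcongr
        linarith
      -- Scaling `z` by `s⁻¹` from `x` gives `y` and carries `g` to the point of the ray at distance
      -- `τ`; the distance `dist z g ≤ h` grows to at most `r`.
      set τ := d * s⁻¹ with hτ
      have hτ0 : 0 ≤ τ := by positivity
      have hτD : τ ≤ 2 * D := by
        calc τ ≤ d * (2 * D / d) := mul_le_mul_of_nonneg_left hs' hd0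
          _ = 2 * D := by field_simp
      have hy : y = x + τ • e + s⁻¹ • (x + s • (y - x) - g) := by
        have h1 : s⁻¹ • (x + s • (y - x) - g) = (y - x) - s⁻¹ • (g - x) := by
          rw [show x + s • (y - x) - g = s • (y - x) - (g - x) by abel, smul_sub, smul_smul,
            inv_mul_cancel₀ hspos.ne', one_smul]
        rw [h1, hτ, mul_comm, mul_smul, ← hge]
        abel
      have herr : ‖s⁻¹ • (x + s • (y - x) - g)‖ ≤ r := by
        rw [norm_smul, norm_inv, Real.norm_of_nonneg hs0, ← dist_eq_norm]
        calc s⁻¹ * dist (x + s • (y - x)) g ≤ (2 * D / d) * h := by gcongr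
          _ = r := by rw [hr]; ring
      refine Set.mem_iUnion₂.2 ⟨⌊τ / r⌋₊, ?_, ?_⟩
      · rw [Finset.mem_range, Nat.lt_succ_iff]
        refine Nat.floor_mono ?_
        rw [hr, div_le_div_iff₀ (by positivity) hh, mul_div_assoc', div_eq_mul_inv]
        calc τ * h ≤ 2 * D * h := by gcongr
          _ = d * (2 * D * h) * d⁻¹ := by field_simp
      · rw [Metric.mem_closedBall, dist_eq_norm]
        have h1 : y - (x + ((⌊τ / r⌋₊ : ℝ) * r) • e) =
            (τ - ⌊τ / r⌋₊ * r) • e + s⁻¹ • (x + s • (y - x) - g) := by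
          nth_rewrite 1 [hy]
          rw [sub_smul]; abel
        rw [h1]
        refine (norm_add_le _ _).trans ?_
        have h2 : ‖(τ - ⌊τ / r⌋₊ * r) • e‖ ≤ r := by
          rw [norm_smul, hen, mul_one, Real.norm_eq_abs, abs_le]
          have h3 : (⌊τ / r⌋₊ : ℝ) ≤ τ / r := Nat.floor_le (by positivity)
          have h4 : τ / r < ⌊τ / r⌋₊ + 1 := Nat.lt_floor_add_one _
          rw [le_div_iff₀ hr0] at h3
          rw [div_lt_iff₀ hr0] at h4
          constructor <;> linarith
        linarith
    refine (measure_mono hsub).trans ((measure_biUnion_finset_le _ _).trans ?_)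
    simp_rw [volume_closedBall_eq _ (by positivity : 0 ≤ 2 * r)]
    rw [Finset.sum_const, Finset.card_range, nsmul_eq_mul, ← ENNReal.ofReal_natCast,
      ← ENNReal.ofReal_mul (by positivity)]
    refine ENNReal.ofReal_le_ofReal ?_
    rw [shadowConst, ← hω]
    have hcount : ((⌊d / h⌋₊ + 1 : ℕ) : ℝ) ≤ 2 * (d / h) := by
      push_cast
      have h3 : (⌊d / h⌋₊ : ℝ) ≤ d / h := Nat.floor_le (by positivity)
      have h4 : 1 ≤ d / h := by rw [le_div_iff₀ hh]; linarith
      linarith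
    have hβd : h / d ≤ 2 * β := by
      rw [hβ, mul_div_assoc', div_le_div_iff₀ hdpos (by positivity)]
      nlinarith
    calc ((⌊d / h⌋₊ + 1 : ℕ) : ℝ) * ((2 * r) ^ N * ω) ≤ (2 * (d / h)) * ((2 * r) ^ N * ω) := by
          gcongr
      _ = 2 * (4 * D) ^ N * ω * ((d / h) * (h / d) ^ N) := by
          rw [hr, show 2 * (2 * D * h / d) = (4 * D) * (h / d) by ring, mul_pow]; ring
      _ = 2 * (4 * D) ^ N * ω * (h / d) ^ (N - 1) := by
          congr 1
          obtain ⟨k, rfl⟩ : ∃ k, N = k + 1 := ⟨N - 1, by omega⟩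
          rw [pow_succ']
          simp only [Nat.add_sub_cancel]
          field_simp
      _ ≤ 2 * (4 * D) ^ N * ω * (2 * β) ^ (N - 1) := by gcongr
      _ ≤ 2 * (4 * D) ^ N * ω * (2 ^ N * β ^ (N - 1)) := by
          have h2 : (2 * β) ^ (N - 1) ≤ 2 ^ N * β ^ (N - 1) := by
            rw [mul_pow]
            exact mul_le_mul_of_nonneg_right (pow_le_pow_right₀ one_le_two (Nat.sub_le _ _))
              (by positivity)
          gcongr
      _ = _ := by
          rw [show (8 : ℝ) * D = 2 * (4 * D) by ring, mul_pow 2 (4 * D)]; ring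

/-- The integral of the Riesz kernel over a ball. -/
noncomputable def rieszConst (N : ℕ) (D : ℝ) : ENNReal :=
  ∫⁻ z in Metric.closedBall (0 : Pt N) D, (edist z 0 ^ (N - 1))⁻¹

theorem rieszConst_ne_top {N : ℕ} (hN : 1 ≤ N) (D : ℝ) : rieszConst N D ≠ ⊤ := by
  have hfin : Module.finrank ℝ (Pt N) = N := finrank_euclideanSpace_fin
  have : Nontrivial (Pt N) := Module.nontrivial_of_finrank_pos (R := ℝ) (by omega)
  have hint : IntegrableOn (fun z : Pt N => (‖z‖ ^ (N - 1))⁻¹) (Metric.ball 0 (D + 1)) := by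
    refine integrableOn_ball_of_norm_le_rpow (C := 1) (α := (N : ℝ) - 1) (by omega) ?_ ?_ ?_
    · rw [hfin]; linarith
    · refine Filter.Eventually.of_forall fun z => ?_
      rw [one_mul, Real.norm_of_nonneg (by positivity), Real.rpow_neg (norm_nonneg _)]
      have : ((N : ℝ) - 1) = ((N - 1 : ℕ) : ℝ) := by push_cast [hN]; rfl
      rw [this, Real.rpow_natCast]
    · exact (by fun_prop : Measurable fun z : Pt N => (‖z‖ ^ (N - 1))⁻¹).aestronglyMeasurable
  have h1 : ∫⁻ z in Metric.closedBall (0 : Pt N) D, (edist z 0 ^ (N - 1))⁻¹ ≤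
      ∫⁻ z in Metric.ball (0 : Pt N) (D + 1), ‖(‖z‖ ^ (N - 1))⁻¹‖ₑ := by
    refine (lintegral_mono_set (Metric.closedBall_subset_ball (lt_add_one D))).trans ?_
    refine lintegral_mono_ae ?_
    have h0 : ∀ᵐ z : Pt N, z ≠ 0 := by simp [ae_iff]
    filter_upwards [ae_restrict_of_ae h0] with z hz
    have hz' : 0 < ‖z‖ := norm_pos_iff.2 hz
    rw [edist_zero_right, Real.enorm_of_nonneg (by positivity),
      ENNReal.ofReal_inv_of_pos (by positivity), ENNReal.ofReal_pow hz'.le, ofReal_norm]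
  exact (lt_of_le_of_lt h1 hint.2).ne

theorem lintegral_riesz_eq {N : ℕ} (D : ℝ) (x : Pt N) :
    ∫⁻ z in Metric.closedBall x D, (edist z x ^ (N - 1))⁻¹ = rieszConst N D := by
  rw [rieszConst, ← lintegral_indicator Metric.isClosed_closedBall.measurableSet,
    ← lintegral_indicator Metric.isClosed_closedBall.measurableSet,
    ← lintegral_sub_right_eq_self ((Metric.closedBall (0 : Pt N) D).indicator
      fun z => (edist z 0 ^ (N - 1))⁻¹) x]
  refine lintegral_congr fun z => ?_
  simp only [Set.indicator, Metric.mem_closedBall, dist_eq_norm, sub_zero, edist_eq_enorm_sub]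

end CompressibleStokes

namespace CompressibleStokes

/-! ### The discrete Poincaré inequality on convex sets -/

namespace Mesh

variable {N : ℕ} {Ω : Set (Pt N)} {T : Mesh Ω}

theorem toFun_eq {s : Finset (Pt N)} (hs : s ∈ T.elements) {x : Pt N} (hx : x ∈ interior (conv s))
    (q : PiecewiseConst N) : T.toFun q x = q s := by
  rw [toFun, Finset.sum_eq_single s]
  · rw [Set.indicator_of_mem hx]
  · intro t ht hts
    refine Set.indicator_of_notMem (fun h => ?_) _
    exact Set.disjoint_left.1 (disjoint_interior ht hs hts) h hx
  · exact fun h => absurd hs h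

theorem measurable_toFun (q : PiecewiseConst N) : Measurable (T.toFun q) := by
  unfold toFun
  exact Finset.measurable_sum _ fun s _ => measurable_const.indicator isOpen_interior.measurableSet

theorem integrable_toFun (q : PiecewiseConst N) : Integrable (T.toFun q) := by
  unfold toFun
  refine integrable_finsetSum _ fun s _ => ?_
  rw [integrable_indicator_iff isOpen_interior.measurableSet]
  exact integrableOn_const ((volume_interior_conv s).trans_lt (volume_conv_lt_top s)).ne

theorem ae_mem_interior (T : Mesh Ω) :
    ∀ᵐ x ∂volume.restrict (closure Ω), ∃ s ∈ T.elements, x ∈ interior (conv s) := by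
  rw [ae_restrict_iff' isClosed_closure.measurableSet]
  have h : ∀ᵐ x : Pt N, ∀ s ∈ T.elements, x ∉ frontier (conv s) := by
    refine (Filter.eventually_all_finset T.elements).2 fun s _ => ?_
    exact measure_eq_zero_iff_ae_notMem.1 ((convex_convexHull ℝ _).addHaar_frontier _)
  filter_upwards [h] with x hx hxΩ
  rw [T.closure_eq_iUnion] at hxΩ
  obtain ⟨s, hs, hxs⟩ := Set.mem_iUnion₂.1 hxΩ
  refine ⟨s, hs, ?_⟩
  by_contra hni
  exact hx s hs ⟨subset_closure hxs, hni⟩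

theorem ae_forall_notMem_conv (T : Mesh Ω) :
    ∀ᵐ x : Pt N, ∀ e ∈ T.complex.faces, e.card < N → x ∉ conv e := by
  rw [ae_ball_iff T.finite.countable]
  intro e _
  by_cases he : e.card < N
  · have := measure_eq_zero_iff_ae_notMem.1 (volume_conv_eq_zero he.le)
    filter_upwards [this] with x hx _ using hx
  · exact Filter.Eventually.of_forall fun x h => absurd h he

/-- If the segment meets a face `e` with fewer than `N` vertices at a point other than `x`, then `y`
lies in the affine span of `x` and `e`, which is a null set. -/
theorem ae_segment_forall_notMem_conv {x : Pt N}
    (hx : ∀ e ∈ T.complex.faces, e.card < N → x ∉ conv e) :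
    ∀ᵐ y : Pt N, ∀ e ∈ T.complex.faces, e.card < N → ∀ z ∈ segment ℝ x y, z ∉ conv e := by
  classical
  rw [ae_ball_iff T.finite.countable]
  intro e he
  by_cases hc : e.card < N
  · have hnull : volume (affineSpan ℝ ((insert x e : Finset (Pt N)) : Set (Pt N)) : Set (Pt N)) = 0 :=
      Measure.addHaar_affineSubspace _ _
        (affineSpan_ne_top ((Finset.card_insert_le _ _).trans (by omega)))
    filter_upwards [measure_eq_zero_iff_ae_notMem.1 hnull] with y hy _ z hz hze
    apply hy
    rw [segment_eq_image_lineMap] at hz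
    obtain ⟨t, ht, rfl⟩ := hz
    have ht0 : t ≠ 0 := by
      rintro rfl
      rw [AffineMap.lineMap_apply_zero] at hze
      exact hx e he hc hze
    have h1 : x ∈ affineSpan ℝ ((insert x e : Finset (Pt N)) : Set (Pt N)) :=
      subset_affineSpan ℝ _ (by simp)
    have h2 : AffineMap.lineMap x y t ∈ affineSpan ℝ ((insert x e : Finset (Pt N)) : Set (Pt N)) :=
      affineSpan_mono ℝ (by simp) (convexHull_subset_affineSpan _ hze)
    have h3 := AffineMap.lineMap_mem t⁻¹ h1 h2
    rwa [AffineMap.lineMap_lineMap_right, inv_mul_cancel₀ ht0, AffineMap.lineMap_apply_one] at h3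
  · exact Filter.Eventually.of_forall fun y h => absurd h hc

/-- Distinct elements meet in a common simplex with at most `N` vertices; genericity of `z` excludes
fewer, and `z ∈ Ω` excludes boundary faces. -/
theorem mem_interiorFaces_of_inter [DecidableEq (Pt N)] (ho : IsOpen Ω) {s t : Finset (Pt N)}
    (hs : s ∈ T.elements) (ht : t ∈ T.elements) (hst : s ≠ t) {z : Pt N} (hzs : z ∈ conv s)
    (hzt : z ∈ conv t) (hzΩ : z ∈ Ω)
    (hgen : ∀ e ∈ T.complex.faces, e.card < N → z ∉ conv e) :
    s ∩ t ∈ T.interiorFaces ∧ z ∈ conv (s ∩ t) := by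
  have hs' := (T.mem_elements.1 hs).1
  have hz := conv_inter_subset hs' (T.mem_elements.1 ht).1 ⟨hzs, hzt⟩
  have hne : (s ∩ t).Nonempty := by
    have : (conv (s ∩ t)).Nonempty := ⟨z, hz⟩
    rwa [convexHull_nonempty_iff, Finset.coe_nonempty] at this
  have hface := T.complex.down_closed hs' Finset.inter_subset_left hne
  have hcard : (s ∩ t).card = N := by
    refine le_antisymm (card_inter_le hs ht hst) ?_
    by_contra hlt
    exact hgen _ hface (not_le.1 hlt) hz
  refine ⟨T.mem_interiorFaces.2 ⟨T.mem_faces.2 ⟨hface, hcard⟩, fun hfr => ?_⟩, hz⟩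
  have := hfr hz
  rw [ho.frontier_eq] at this
  exact this.2 hzΩ

/-- The values of a piecewise constant function at the ends of a generic segment differ by at most
the sum of the jumps across the faces that the segment meets. -/
theorem sub_le_sum_jumps (ho : IsOpen Ω) {x y : Pt N} (hxy : segment ℝ x y ⊆ Ω)
    (hgen : ∀ e ∈ T.complex.faces, e.card < N → ∀ z ∈ segment ℝ x y, z ∉ conv e)
    {s t : Finset (Pt N)} (hs : s ∈ T.elements) (ht : t ∈ T.elements) (hx : x ∈ conv s)
    (hy : y ∈ conv t) (q : PiecewiseConst N) :
    ENNReal.ofReal (q t - q s) ≤ ∑ Γ ∈ T.interiorFaces,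
      open Classical in if (segment ℝ x y ∩ conv Γ).Nonempty then
        ENNReal.ofReal |q (T.plus Γ) - q (T.minus Γ)| else 0 := by
  classical
  rw [← Finset.sum_filter]
  -- Every level `c` between the end values is crossed at some face. The elements with value at most
  -- `c` and those with value above `c` form two closed sets covering the connected segment, so they
  -- meet on it. Comparing lengths of intervals gives the claim.
  have hcover : Set.Ico (q s) (q t) ⊆
      ⋃ Γ ∈ T.interiorFaces.filter (fun Γ => (segment ℝ x y ∩ conv Γ).Nonempty),
        Set.Ico (min (q (T.plus Γ)) (q (T.minus Γ))) (max (q (T.plus Γ)) (q (T.minus Γ))) := by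
    rintro c ⟨hc1, hc2⟩
    set A := ⋃ E ∈ T.elements.filter (fun E => q E ≤ c), conv E with hA
    set B := ⋃ E ∈ T.elements.filter (fun E => c < q E), conv E with hB
    have hAc : IsClosed A :=
      isClosed_biUnion_finset fun E _ => (isCompact_conv E).isClosed
    have hBc : IsClosed B :=
      isClosed_biUnion_finset fun E _ => (isCompact_conv E).isClosed
    have hcov : segment ℝ x y ⊆ A ∪ B := by
      intro z hz
      have h1 := subset_closure (hxy hz)
      rw [T.closure_eq_iUnion] at h1
      obtain ⟨E, hE, hzE⟩ := Set.mem_iUnion₂.1 h1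
      rcases le_or_gt (q E) c with h | h
      · exact Or.inl (Set.mem_iUnion₂.2 ⟨E, Finset.mem_filter.2 ⟨hE, h⟩, hzE⟩)
      · exact Or.inr (Set.mem_iUnion₂.2 ⟨E, Finset.mem_filter.2 ⟨hE, h⟩, hzE⟩)
    obtain ⟨z, hz, hzA, hzB⟩ := isPreconnected_closed_iff.1
      (convex_segment x y).isPreconnected A B hAc hBc hcov
      ⟨x, left_mem_segment ℝ x y, Set.mem_iUnion₂.2 ⟨s, Finset.mem_filter.2 ⟨hs, hc1⟩, hx⟩⟩
      ⟨y, right_mem_segment ℝ x y, Set.mem_iUnion₂.2 ⟨t, Finset.mem_filter.2 ⟨ht, hc2⟩, hy⟩⟩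
    obtain ⟨E, hE, hzE⟩ := Set.mem_iUnion₂.1 hzA
    obtain ⟨E', hE', hzE'⟩ := Set.mem_iUnion₂.1 hzB
    obtain ⟨hE, hEc⟩ := Finset.mem_filter.1 hE
    obtain ⟨hE', hEc'⟩ := Finset.mem_filter.1 hE'
    have hne : E ≠ E' := by rintro rfl; linarith
    obtain ⟨hΓ, hzΓ⟩ := mem_interiorFaces_of_inter ho hE hE' hne hzE hzE' (hxy hz)
      fun e he hc => hgen e he hc z hz
    refine Set.mem_iUnion₂.2 ⟨E ∩ E', Finset.mem_filter.2 ⟨hΓ, z, hz, hzΓ⟩, ?_⟩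
    rcases eq_plus_or_eq_minus ho hΓ hE Finset.inter_subset_left with h1 | h1 <;>
    rcases eq_plus_or_eq_minus ho hΓ hE' Finset.inter_subset_right with h2 | h2
    · exact absurd (h1.trans h2.symm) hne
    · rw [← h1, ← h2]
      exact ⟨(min_le_left _ _).trans hEc, hEc'.trans_le (le_max_right _ _)⟩
    · rw [← h1, ← h2]
      exact ⟨(min_le_right _ _).trans hEc, hEc'.trans_le (le_max_left _ _)⟩
    · exact absurd (h1.trans h2.symm) hne
  calc ENNReal.ofReal (q t - q s) = volume (Set.Ico (q s) (q t)) := by rw [Real.volume_Ico]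
    _ ≤ _ := (measure_mono hcover).trans (measure_biUnion_finset_le _ _)
    _ = _ := by
      refine Finset.sum_congr rfl fun Γ _ => ?_
      rw [Real.volume_Ico, max_sub_min_eq_abs, abs_sub_comm]

/-- A vertex of a face. -/
noncomputable def basePoint {N : ℕ} (Γ : Finset (Pt N)) : Pt N :=
  open Classical in if h : Γ.Nonempty then h.choose else 0

theorem basePoint_mem {Γ : Finset (Pt N)} (h : Γ.Nonempty) : basePoint Γ ∈ Γ := by
  rw [basePoint, dif_pos h]
  exact h.choose_spec

/-- The relative size in which a face is seen from the point `x`, up to constants. -/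
noncomputable def visibility {N : ℕ} (Γ : Finset (Pt N)) (x : Pt N) : ℝ :=
  (Metric.diam (conv Γ) / (Metric.diam (conv Γ) + dist x (basePoint Γ))) ^ (N - 1)

theorem visibility_nonneg (Γ : Finset (Pt N)) (x : Pt N) : 0 ≤ visibility Γ x := by
  have := Metric.diam_nonneg (s := conv Γ)
  unfold visibility
  positivity

theorem diam_face_pos (hN : 2 ≤ N) {Γ : Finset (Pt N)} (hΓ : Γ ∈ T.faces) :
    0 < Metric.diam (conv Γ) := by
  obtain ⟨p, hp, q, hq, hpq⟩ := Finset.one_lt_card.1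
    (show 1 < Γ.card by rw [(T.mem_faces.1 hΓ).2]; omega)
  exact lt_of_lt_of_le (dist_pos.2 hpq) (Metric.dist_le_diam_of_mem (isCompact_conv Γ).isBounded
    (subset_convexHull ℝ _ hp) (subset_convexHull ℝ _ hq))

theorem measurable_visibility (hN : 2 ≤ N) {Γ : Finset (Pt N)} (hΓ : Γ ∈ T.faces) :
    Measurable (visibility Γ) := by
  have := diam_face_pos hN hΓ
  unfold visibility
  fun_prop

theorem volume_segment_meets_le (hN : 2 ≤ N) {Γ : Finset (Pt N)} (hΓ : Γ ∈ T.faces) {D : ℝ}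
    (hD : 0 < D) (x : Pt N) :
    volume {y : Pt N | dist x y ≤ D ∧ (segment ℝ x y ∩ conv Γ).Nonempty} ≤
      ENNReal.ofReal (shadowConst N D * visibility Γ x) := by
  refine (measure_mono ?_).trans
    (volume_shadow_le (by omega) hD (diam_face_pos hN hΓ) x (basePoint Γ))
  rintro y ⟨hy, z, hz, hzΓ⟩
  refine ⟨hy, z, hz, Metric.dist_le_diam_of_mem (isCompact_conv Γ).isBounded hzΓ ?_⟩
  exact subset_convexHull ℝ _ (basePoint_mem (face_nonempty hΓ))

theorem basePoint_mem_closure (ho : IsOpen Ω) {Γ : Finset (Pt N)} (hΓ : Γ ∈ T.interiorFaces) :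
    basePoint Γ ∈ closure Ω := by
  refine conv_subset_closure (minus_mem ho hΓ) (subset_convexHull ℝ _ ?_)
  exact subset_minus ho hΓ (basePoint_mem (face_nonempty (T.mem_interiorFaces.1 hΓ).1))

/-- The visibility is at most `(diam Γ / dist) ^ (N - 1)`, a multiple of the Riesz kernel centred at
the base point. -/
theorem lintegral_visibility_le (hN : 2 ≤ N) (ho : IsOpen Ω) {D : ℝ}
    (hD : ∀ x ∈ closure Ω, ∀ y ∈ closure Ω, dist x y ≤ D) {Γ : Finset (Pt N)}
    (hΓ : Γ ∈ T.interiorFaces) :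
    ∫⁻ x in Ω, ENNReal.ofReal (visibility Γ x) ≤
      ENNReal.ofReal (Metric.diam (conv Γ) ^ (N - 1)) * rieszConst N D := by
  have hh := diam_face_pos hN (T.mem_interiorFaces.1 hΓ).1
  have hsub : Ω ⊆ Metric.closedBall (basePoint Γ) D := fun x hx =>
    hD x (subset_closure hx) _ (basePoint_mem_closure ho hΓ)
  rw [← lintegral_riesz_eq D (basePoint Γ), ← lintegral_const_mul' _ _ ENNReal.ofReal_ne_top]
  refine (lintegral_mono_set hsub).trans (lintegral_mono fun x => ?_)
  rw [visibility, div_pow, div_eq_mul_inv, ENNReal.ofReal_mul (by positivity)]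
  gcongr
  rw [ENNReal.ofReal_inv_of_pos (by positivity), ENNReal.inv_le_inv, edist_dist,
    ← ENNReal.ofReal_pow dist_nonneg]
  refine ENNReal.ofReal_le_ofReal ?_
  gcongr
  linarith

/-- Each term is bounded by the integral of the Riesz kernel at `x` over an adjacent element: there
the kernel is at least `(k + d) ^ (1 - N)`, with `k` the diameter of the element and `d` the
distance to the base point, and its volume is at least `c k ^ N`. The elements have disjoint
interiors, and each is used at most `N + 1` times. -/
theorem sum_visibility_mul_diam_le (hN : 2 ≤ N) (ho : IsOpen Ω)
    {κ : ℝ} (hκ : 0 < κ) (hT : T.ShapeRegular κ) {D : ℝ}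
    (hD : ∀ x ∈ closure Ω, ∀ y ∈ closure Ω, dist x y ≤ D) {x : Pt N} (hx : x ∈ closure Ω) :
    ∑ Γ ∈ T.interiorFaces, ENNReal.ofReal (visibility Γ x * Metric.diam (conv Γ)) ≤
      (ENNReal.ofReal (shapeConst N κ))⁻¹ * ((N + 1) * rieszConst N D) := by
  classical
  have hc := shapeConst_pos N hκ
  set c := ENNReal.ofReal (shapeConst N κ) with hcdef
  have hc0 : c ≠ 0 := by simpa [hcdef] using hc
  have hctop : c ≠ ⊤ := ENNReal.ofReal_ne_top
  set I : Finset (Pt N) → ENNReal := fun s =>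
    ∫⁻ z in interior (conv s), (edist z x ^ (N - 1))⁻¹ with hI
  have hterm : ∀ Γ ∈ T.interiorFaces,
      ENNReal.ofReal (visibility Γ x * Metric.diam (conv Γ)) ≤ c⁻¹ * I (T.minus Γ) := by
    intro Γ hΓ
    have hE := minus_mem ho hΓ
    set E := T.minus Γ with hEdef
    have hhE := diam_pos (by omega) hE
    have hh := diam_face_pos hN (T.mem_interiorFaces.1 hΓ).1
    have hle : Metric.diam (conv Γ) ≤ Metric.diam (conv E) := diam_face_le (subset_minus ho hΓ)
    set d := dist x (basePoint Γ)
    have hd0 : 0 ≤ d := dist_nonneg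
    set h := Metric.diam (conv Γ)
    set k := Metric.diam (conv E)
    set X : ENNReal := ENNReal.ofReal (visibility Γ x * h)
    have hpt : ∀ z ∈ interior (conv E), X ≤ ENNReal.ofReal (k ^ N) * (edist z x ^ (N - 1))⁻¹ := by
      intro z hz
      have hzd : dist z x ≤ k + d := by
        have h1 : dist z (basePoint Γ) ≤ k :=
          Metric.dist_le_diam_of_mem (isCompact_conv E).isBounded (interior_subset hz)
            (subset_convexHull ℝ _ (subset_minus ho hΓ
              (basePoint_mem (face_nonempty (T.mem_interiorFaces.1 hΓ).1))))
        have h2 := dist_triangle z (basePoint Γ) x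
        rw [dist_comm (basePoint Γ) x] at h2
        linarith
      have h1 : visibility Γ x * h ≤ k ^ N * ((k + d) ^ (N - 1))⁻¹ := by
        have h2 : h / (h + d) ≤ k / (k + d) := by
          rw [div_le_div_iff₀ (by positivity) (by positivity)]
          nlinarith
        calc visibility Γ x * h ≤ (k / (k + d)) ^ (N - 1) * k := by
              unfold visibility
              gcongr
          _ = (k ^ (N - 1) * k) * ((k + d) ^ (N - 1))⁻¹ := by rw [div_pow]; ring
          _ = _ := by rw [← pow_succ]; congr 2; omega
      refine (ENNReal.ofReal_le_ofReal h1).trans ?_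
      rw [ENNReal.ofReal_mul (by positivity)]
      gcongr
      rw [ENNReal.ofReal_inv_of_pos (by positivity), ENNReal.inv_le_inv, edist_dist,
        ← ENNReal.ofReal_pow dist_nonneg]
      refine ENNReal.ofReal_le_ofReal ?_
      gcongr
    have hint : X * volume (interior (conv E)) ≤ ENNReal.ofReal (k ^ N) * I E := by
      rw [← setLIntegral_const, hI]
      simp only
      rw [← lintegral_const_mul' _ _ ENNReal.ofReal_ne_top]
      exact setLIntegral_mono' isOpen_interior.measurableSet hpt
    have hvol : c * ENNReal.ofReal (k ^ N) ≤ volume (interior (conv E)) := by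
      rw [volume_interior_conv, hcdef, ← ENNReal.ofReal_mul hc.le,
        ← ENNReal.ofReal_toReal (volume_conv_lt_top E).ne]
      exact ENNReal.ofReal_le_ofReal (shapeConst_mul_diam_pow_le (by omega) hκ hT hE)
    have hk0 : ENNReal.ofReal (k ^ N) ≠ 0 := by
      have : 0 < k ^ N := by positivity
      simpa using this
    have h3 : ENNReal.ofReal (k ^ N) * (c * X) ≤ ENNReal.ofReal (k ^ N) * I E :=
      calc _ = X * (c * ENNReal.ofReal (k ^ N)) := by ring
        _ ≤ X * volume (interior (conv E)) := by gcongr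
        _ ≤ _ := hint
    have h4 := (ENNReal.mul_le_mul_iff_right hk0 ENNReal.ofReal_ne_top).1 h3
    calc X = c⁻¹ * (c * X) := by rw [← mul_assoc, ENNReal.inv_mul_cancel hc0 hctop, one_mul]
      _ ≤ c⁻¹ * I E := by gcongr
  have hcount : ∑ Γ ∈ T.interiorFaces, I (T.minus Γ) ≤ (N + 1) * ∑ s ∈ T.elements, I s := by
    calc ∑ Γ ∈ T.interiorFaces, I (T.minus Γ)
        ≤ ∑ Γ ∈ T.interiorFaces, (I (T.plus Γ) + I (T.minus Γ)) :=
          Finset.sum_le_sum fun Γ _ => le_add_self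
      _ = ∑ s ∈ T.elements, ∑ Γ ∈ T.interiorFaces, (if Γ ⊆ s then I s else 0) :=
          (sum_elements_interiorFaces ho fun s _ => I s).symm
      _ ≤ ∑ s ∈ T.elements, (N + 1) * I s := by
          refine Finset.sum_le_sum fun s hs => ?_
          rw [← Finset.sum_filter, Finset.sum_const, nsmul_eq_mul]
          gcongr
          have hsub : T.interiorFaces.filter (fun Γ => Γ ⊆ s) ⊆ s.powersetCard N := by
            intro Γ hΓ
            obtain ⟨h1, h2⟩ := Finset.mem_filter.1 hΓ
            exact Finset.mem_powersetCard.2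
              ⟨h2, (T.mem_faces.1 (T.mem_interiorFaces.1 h1).1).2⟩
          have := Finset.card_le_card hsub
          rw [Finset.card_powersetCard, card_of_mem_elements hs, Nat.choose_succ_self_right] at this
          exact_mod_cast this
      _ = _ := by rw [Finset.mul_sum]
  have hsum : ∑ s ∈ T.elements, I s ≤ rieszConst N D := by
    rw [hI, ← lintegral_biUnion_finset (fun s hs t ht hst => disjoint_interior hs ht hst)
      fun s _ => isOpen_interior.measurableSet, ← lintegral_riesz_eq D x]
    refine lintegral_mono_set (Set.iUnion₂_subset fun s hs z hz => ?_)
    exact hD z (conv_subset_closure hs (interior_subset hz)) x hx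
  calc _ ≤ ∑ Γ ∈ T.interiorFaces, c⁻¹ * I (T.minus Γ) := Finset.sum_le_sum hterm
    _ = c⁻¹ * ∑ Γ ∈ T.interiorFaces, I (T.minus Γ) := by rw [Finset.mul_sum]
    _ ≤ c⁻¹ * ((N + 1) * rieszConst N D) := by
      gcongr
      exact hcount.trans (by gcongr)

end Mesh

end CompressibleStokes

/-! ### From segments to the Poincaré inequality, on convex sets and on the domain -/

namespace CompressibleStokes

namespace Mesh

variable {N : ℕ} {Ω : Set (Pt N)} {T : Mesh Ω}

/-- The sets `A` on which piecewise constant functions satisfy a Poincaré inequality in terms of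
their jumps, with a constant that is the same for all `κ`-shape regular meshes. -/
def HasPoincare (Ω : Set (Pt N)) (κ : ℝ) (A : Set (Pt N)) : Prop :=
  ∃ C : NNReal, ∀ T : Mesh Ω, T.ShapeRegular κ → ∀ q : PiecewiseConst N, ∃ m : ℝ,
    ∫⁻ x in A, ENNReal.ofReal ((T.toFun q x - m) ^ 2) ≤ C * ENNReal.ofReal (T.jumpEnergy q)

/-- The segment estimate is integrated over `y`: each jump is weighted by the volume of the shadow
of its face as seen from `x`. -/
theorem lintegral_abs_sub_le (hN : 2 ≤ N) (ho : IsOpen Ω) {D : ℝ} (hD0 : 0 < D)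
    (hD : ∀ x ∈ closure Ω, ∀ y ∈ closure Ω, dist x y ≤ D) {K : Set (Pt N)} (hK : Convex ℝ K)
    (hKΩ : K ⊆ Ω) (hKm : MeasurableSet K) (q : PiecewiseConst N) :
    ∀ᵐ x ∂volume.restrict K, ∫⁻ y in K, ENNReal.ofReal |T.toFun q x - T.toFun q y| ≤
      ENNReal.ofReal (shadowConst N D *
        ∑ Γ ∈ T.interiorFaces, |q (T.plus Γ) - q (T.minus Γ)| * visibility Γ x) := by
  classical
  have hae : ∀ᵐ x ∂volume.restrict K, ∃ s ∈ T.elements, x ∈ interior (conv s) :=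
    ae_mono (Measure.restrict_mono (hKΩ.trans subset_closure) le_rfl) T.ae_mem_interior
  filter_upwards [hae, ae_restrict_of_ae T.ae_forall_notMem_conv, ae_restrict_mem hKm]
    with x ⟨s, hs, hxs⟩ hxgen hxK
  set Y : Finset (Pt N) → Set (Pt N) := fun Γ =>
    {y : Pt N | dist x y ≤ D ∧ (segment ℝ x y ∩ conv Γ).Nonempty} with hY
  -- Shadows are replaced by measurable hulls, which have the same volume.
  have hpt : ∀ᵐ y ∂volume.restrict K, ENNReal.ofReal |T.toFun q x - T.toFun q y| ≤
      ∑ Γ ∈ T.interiorFaces, (toMeasurable volume (Y Γ)).indicator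
        (fun _ => ENNReal.ofReal |q (T.plus Γ) - q (T.minus Γ)|) y := by
    filter_upwards [hae, ae_restrict_of_ae (ae_segment_forall_notMem_conv hxgen),
      ae_restrict_mem hKm] with y ⟨t, ht, hyt⟩ hygen hyK
    have hseg : segment ℝ x y ⊆ Ω := (hK.segment_subset hxK hyK).trans hKΩ
    have h1 := sub_le_sum_jumps ho hseg hygen hs ht (interior_subset hxs) (interior_subset hyt) q
    have h2 := sub_le_sum_jumps (x := y) (y := x) ho (by rwa [segment_symm])
      (by rwa [segment_symm]) ht hs (interior_subset hyt) (interior_subset hxs) q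
    rw [segment_symm ℝ y x] at h2
    rw [toFun_eq hs hxs, toFun_eq ht hyt]
    refine le_trans ?_ (b := ∑ Γ ∈ T.interiorFaces, if (segment ℝ x y ∩ conv Γ).Nonempty then
        ENNReal.ofReal |q (T.plus Γ) - q (T.minus Γ)| else 0) ?_
    · rcases abs_cases (q s - q t) with h | h <;> rw [h.1]
      · exact h2
      · rw [neg_sub]; exact h1
    · refine Finset.sum_le_sum fun Γ _ => ?_
      split_ifs with h
      · have hyY : y ∈ Y Γ := ⟨hD _ (subset_closure (hKΩ hxK)) _ (subset_closure (hKΩ hyK)), h⟩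
        rw [Set.indicator_of_mem (subset_toMeasurable _ _ hyY)]
      · exact zero_le
  refine (lintegral_mono_ae hpt).trans ?_
  refine (lintegral_mono' Measure.restrict_le_self le_rfl).trans ?_
  rw [lintegral_finsetSum _ fun Γ _ =>
    measurable_const.indicator (measurableSet_toMeasurable _ _), Finset.mul_sum,
    ENNReal.ofReal_sum_of_nonneg fun Γ _ => mul_nonneg (shadowConst_nonneg N hD0.le)
      (mul_nonneg (abs_nonneg _) (visibility_nonneg Γ x))]
  refine Finset.sum_le_sum fun Γ hΓ => ?_
  rw [lintegral_indicator_const (measurableSet_toMeasurable _ _), measure_toMeasurable,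
    show shadowConst N D * (|q (T.plus Γ) - q (T.minus Γ)| * visibility Γ x) =
      |q (T.plus Γ) - q (T.minus Γ)| * (shadowConst N D * visibility Γ x) by ring,
    ENNReal.ofReal_mul (abs_nonneg _)]
  gcongr
  exact volume_segment_meets_le hN (T.mem_interiorFaces.1 hΓ).1 hD0 x

/-- With `m` the mean over `K`, the deviation at `x` is bounded by a sum of jumps times
visibilities. Weighted Cauchy–Schwarz separates `Σ visibility * diam`, bounded uniformly in `x`,
from `Σ J² / diam * visibility`. Integrating the latter in `x` gains `diam ^ (N - 1)` and leaves the
jump energy. -/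
theorem hasPoincare_of_convex (hN : 2 ≤ N) (ho : IsOpen Ω) (hb : Bornology.IsBounded Ω) {κ : ℝ}
    (hκ : 0 < κ) {K : Set (Pt N)} (hK : Convex ℝ K) (hKΩ : K ⊆ Ω) (hKo : IsOpen K)
    (hKne : K.Nonempty) : HasPoincare Ω κ K := by
  set D : ℝ := Metric.diam (closure Ω) + 1 with hDdef
  have hD0 : 0 < D := by have := Metric.diam_nonneg (s := closure Ω); linarith
  have hD : ∀ x ∈ closure Ω, ∀ y ∈ closure Ω, dist x y ≤ D := fun x hx y hy =>
    (Metric.dist_le_diam_of_mem hb.closure hx hy).trans (by linarith)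
  have hKtop : volume K ≠ ⊤ := ((measure_mono hKΩ).trans_lt hb.measure_lt_top).ne
  have hV : 0 < volume.real K := ENNReal.toReal_pos (hKo.measure_pos _ hKne).ne' hKtop
  set V := volume.real K with hVdef
  set S := shadowConst N D with hS
  have hS0 : 0 ≤ S := shadowConst_nonneg N hD0.le
  set BE : ENNReal := (ENNReal.ofReal (shapeConst N κ))⁻¹ * ((N + 1) * rieszConst N D) with hBE
  have hR := rieszConst_ne_top (N := N) (by omega) D
  have hBtop : BE ≠ ⊤ := by
    refine ENNReal.mul_ne_top (ENNReal.inv_ne_top.2 ?_) (ENNReal.mul_ne_top (by finiteness) hR)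
    simpa using shapeConst_pos N hκ
  set B := BE.toReal with hB
  have hB0 : 0 ≤ B := ENNReal.toReal_nonneg
  set R := (rieszConst N D).toReal with hRdef
  have hR0 : 0 ≤ R := ENNReal.toReal_nonneg
  refine ⟨(S ^ 2 * B / V ^ 2 * R).toNNReal, fun T hT q => ⟨⨍ y in K, T.toFun q y, ?_⟩⟩
  set m := ⨍ y in K, T.toFun q y with hm
  set J : Finset (Pt N) → ℝ := fun Γ => q (T.plus Γ) - q (T.minus Γ) with hJ
  have hQ : IntegrableOn (T.toFun q) K := (integrable_toFun q).integrableOn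
  have hpt : ∀ᵐ x ∂volume.restrict K, ENNReal.ofReal ((T.toFun q x - m) ^ 2) ≤
      ∑ Γ ∈ T.interiorFaces, ENNReal.ofReal (S ^ 2 * B / V ^ 2 *
        (J Γ ^ 2 / Metric.diam (conv Γ))) * ENNReal.ofReal (visibility Γ x) := by
    filter_upwards [lintegral_abs_sub_le (T := T) hN ho hD0 hD hK hKΩ hKo.measurableSet q,
      ae_restrict_mem hKo.measurableSet] with x hx hxK
    set W := ∑ Γ ∈ T.interiorFaces, |J Γ| * visibility Γ x with hW
    have hW0 : 0 ≤ W := Finset.sum_nonneg fun Γ _ =>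
      mul_nonneg (abs_nonneg _) (visibility_nonneg Γ x)
    have hd0 : ∀ Γ ∈ T.interiorFaces, 0 < Metric.diam (conv Γ) := fun Γ hΓ =>
      diam_face_pos hN (T.mem_interiorFaces.1 hΓ).1
    have hint : IntegrableOn (fun y => T.toFun q x - T.toFun q y) K :=
      (integrableOn_const hKtop).sub hQ
    have h1 : V * |T.toFun q x - m| ≤ S * W := by
      have e1 : V * (T.toFun q x - m) = ∫ y in K, (T.toFun q x - T.toFun q y) := by
        rw [integral_sub (integrableOn_const hKtop).integrable hQ.integrable, setIntegral_const,
          hm, setAverage_eq, smul_eq_mul, smul_eq_mul, mul_sub, mul_inv_cancel_left₀ hV.ne']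
      rw [show V * |T.toFun q x - m| = |V * (T.toFun q x - m)| by rw [abs_mul, abs_of_pos hV], e1]
      refine (abs_integral_le_integral_abs).trans ?_
      rw [integral_eq_lintegral_of_nonneg_ae (Filter.Eventually.of_forall fun _ => abs_nonneg _)
        hint.integrable.abs.aestronglyMeasurable]
      exact ENNReal.toReal_le_of_le_ofReal (by positivity) hx
    have h2 : W ^ 2 ≤ (∑ Γ ∈ T.interiorFaces, J Γ ^ 2 / Metric.diam (conv Γ) * visibility Γ x) *
        ∑ Γ ∈ T.interiorFaces, visibility Γ x * Metric.diam (conv Γ) := by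
      refine Finset.sum_sq_le_sum_mul_sum_of_sq_le_mul _ (fun Γ hΓ => ?_) (fun Γ hΓ => ?_)
        fun Γ hΓ => ?_
      · have := hd0 Γ hΓ; have := visibility_nonneg Γ x; positivity
      · have := hd0 Γ hΓ; have := visibility_nonneg Γ x; positivity
      · have := (hd0 Γ hΓ).ne'
        rw [mul_pow, sq_abs]
        field_simp
        rfl
    have h3 : ∑ Γ ∈ T.interiorFaces, visibility Γ x * Metric.diam (conv Γ) ≤ B := by
      have := sum_visibility_mul_diam_le hN ho hκ hT hD (subset_closure (hKΩ hxK))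
      rw [← ENNReal.ofReal_sum_of_nonneg fun Γ hΓ => mul_nonneg (visibility_nonneg Γ x)
        (hd0 Γ hΓ).le] at this
      exact (ENNReal.ofReal_le_iff_le_toReal hBtop).1 this
    have h4 : 0 ≤ ∑ Γ ∈ T.interiorFaces, J Γ ^ 2 / Metric.diam (conv Γ) * visibility Γ x :=
      Finset.sum_nonneg fun Γ hΓ => by
        have := hd0 Γ hΓ; have := visibility_nonneg Γ x; positivity
    have h5 : (T.toFun q x - m) ^ 2 ≤ ∑ Γ ∈ T.interiorFaces,
        S ^ 2 * B / V ^ 2 * (J Γ ^ 2 / Metric.diam (conv Γ)) * visibility Γ x := by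
      have e : ∑ Γ ∈ T.interiorFaces,
          S ^ 2 * B / V ^ 2 * (J Γ ^ 2 / Metric.diam (conv Γ)) * visibility Γ x =
          S ^ 2 * B * (∑ Γ ∈ T.interiorFaces,
            J Γ ^ 2 / Metric.diam (conv Γ) * visibility Γ x) / V ^ 2 := by
        rw [Finset.mul_sum, Finset.sum_div]
        exact Finset.sum_congr rfl fun Γ _ => by ring
      rw [e, le_div_iff₀ (by positivity)]
      calc (T.toFun q x - m) ^ 2 * V ^ 2 = (V * |T.toFun q x - m|) ^ 2 := by
            rw [mul_pow, sq_abs, mul_comm]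
        _ ≤ (S * W) ^ 2 := by gcongr
        _ = S ^ 2 * W ^ 2 := by ring
        _ ≤ S ^ 2 * ((∑ Γ ∈ T.interiorFaces,
            J Γ ^ 2 / Metric.diam (conv Γ) * visibility Γ x) * B) := by
            gcongr
            exact h2.trans (by gcongr)
        _ = _ := by ring
    refine (ENNReal.ofReal_le_ofReal h5).trans_eq ?_
    rw [ENNReal.ofReal_sum_of_nonneg fun Γ hΓ => by
      have := hd0 Γ hΓ; have := visibility_nonneg Γ x; positivity]
    refine Finset.sum_congr rfl fun Γ hΓ => ENNReal.ofReal_mul ?_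
    have := hd0 Γ hΓ
    positivity
  calc _ ≤ _ := lintegral_mono_ae hpt
    _ ≤ _ := lintegral_mono' (Measure.restrict_mono hKΩ le_rfl) le_rfl
    _ = ∑ Γ ∈ T.interiorFaces, ENNReal.ofReal (S ^ 2 * B / V ^ 2 *
        (J Γ ^ 2 / Metric.diam (conv Γ))) * ∫⁻ x in Ω, ENNReal.ofReal (visibility Γ x) := by
      rw [lintegral_finsetSum _ fun Γ hΓ => ((measurable_visibility hN
        (T.mem_interiorFaces.1 hΓ).1).ennreal_ofReal).const_mul _]
      exact Finset.sum_congr rfl fun Γ hΓ => lintegral_const_mul' _ _ ENNReal.ofReal_ne_top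
    _ ≤ ∑ Γ ∈ T.interiorFaces, ENNReal.ofReal (S ^ 2 * B / V ^ 2 * R *
          (Metric.diam (conv Γ) ^ (N - 2) * J Γ ^ 2)) := by
      refine Finset.sum_le_sum fun Γ hΓ => ?_
      have hd := diam_face_pos hN (T.mem_interiorFaces.1 hΓ).1
      refine (mul_le_mul_right (lintegral_visibility_le hN ho hD hΓ) _).trans_eq ?_
      rw [← ENNReal.ofReal_toReal hR, ← hRdef, ← ENNReal.ofReal_mul (by positivity),
        ← ENNReal.ofReal_mul (by positivity)]
      congr 1
      obtain ⟨k, rfl⟩ : ∃ k, N = k + 2 := ⟨N - 2, by omega⟩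
      rw [show k + 2 - 1 = k + 1 by omega, show k + 2 - 2 = k by omega, pow_succ]
      field_simp
      ring
    _ = _ := by
      rw [← ENNReal.ofReal_sum_of_nonneg fun Γ _ => by positivity, ← Finset.mul_sum,
        ENNReal.ofReal_mul (by positivity)]
      rfl

/-- Poincaré inequalities on overlapping sets combine to one on the union. -/
theorem HasPoincare.union {κ : ℝ} {A B : Set (Pt N)} (hA : HasPoincare Ω κ A)
    (hB : HasPoincare Ω κ B)
    (hAB : volume (A ∩ B) ≠ 0) (hBtop : volume B ≠ ⊤) :
    HasPoincare Ω κ (A ∪ B) := by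
  obtain ⟨C₁, hC₁⟩ := hA
  obtain ⟨C₂, hC₂⟩ := hB
  have hABtop : volume (A ∩ B) ≠ ⊤ := measure_ne_top_of_subset Set.inter_subset_right hBtop
  -- The constants `m₁` and `m₂` are compared on the overlap; `θ` is the price for transferring
  -- their difference to all of `B`.
  set θ : NNReal := (volume B / volume (A ∩ B)).toNNReal with hθ
  have hθ' : (θ : ENNReal) = volume B / volume (A ∩ B) :=
    ENNReal.coe_toNNReal (ENNReal.div_ne_top hBtop hAB)
  refine ⟨C₁ + 2 * C₂ + 4 * θ * (C₁ + C₂), fun T hT q => ?_⟩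
  obtain ⟨m₁, h₁⟩ := hC₁ T hT q
  obtain ⟨m₂, h₂⟩ := hC₂ T hT q
  refine ⟨m₁, ?_⟩
  set X := ENNReal.ofReal (T.jumpEnergy q)
  have hmeas : ∀ m : ℝ, Measurable fun x => ENNReal.ofReal ((T.toFun q x - m) ^ 2) := fun m =>
    (((measurable_toFun q).sub_const m).pow_const 2).ennreal_ofReal
  have hδ : ENNReal.ofReal ((m₁ - m₂) ^ 2) * volume (A ∩ B) ≤ 2 * (C₁ * X + C₂ * X) := by
    rw [← setLIntegral_const]
    calc _ ≤ ∫⁻ x in A ∩ B, 2 * (ENNReal.ofReal ((T.toFun q x - m₁) ^ 2) +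
            ENNReal.ofReal ((T.toFun q x - m₂) ^ 2)) := by
          refine lintegral_mono fun x => ?_
          rw [← ENNReal.ofReal_add (by positivity) (by positivity), ← ENNReal.ofReal_ofNat,
            ← ENNReal.ofReal_mul (by norm_num)]
          refine ENNReal.ofReal_le_ofReal ?_
          nlinarith [sq_nonneg ((T.toFun q x - m₁) + (T.toFun q x - m₂))]
      _ = 2 * ((∫⁻ x in A ∩ B, ENNReal.ofReal ((T.toFun q x - m₁) ^ 2)) +
            ∫⁻ x in A ∩ B, ENNReal.ofReal ((T.toFun q x - m₂) ^ 2)) := by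
          rw [lintegral_const_mul' _ _ (by norm_num), lintegral_add_left (hmeas _)]
      _ ≤ _ := by
          gcongr
          · exact (lintegral_mono_set Set.inter_subset_left).trans h₁
          · exact (lintegral_mono_set Set.inter_subset_right).trans h₂
  have hδB : ENNReal.ofReal ((m₁ - m₂) ^ 2) * volume B ≤ θ * (2 * (C₁ * X + C₂ * X)) := by
    rw [hθ', mul_comm (_ / _), ← mul_div_assoc]
    rw [ENNReal.le_div_iff_mul_le (Or.inl hAB) (Or.inl hABtop)]
    calc _ = (ENNReal.ofReal ((m₁ - m₂) ^ 2) * volume (A ∩ B)) * volume B := by ring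
      _ ≤ _ := by gcongr
  have hBle : ∫⁻ x in B, ENNReal.ofReal ((T.toFun q x - m₁) ^ 2) ≤
      2 * (C₂ * X + θ * (2 * (C₁ * X + C₂ * X))) := by
    calc _ ≤ ∫⁻ x in B, 2 * (ENNReal.ofReal ((T.toFun q x - m₂) ^ 2) +
            ENNReal.ofReal ((m₁ - m₂) ^ 2)) := by
          refine lintegral_mono fun x => ?_
          rw [← ENNReal.ofReal_add (by positivity) (by positivity), ← ENNReal.ofReal_ofNat,
            ← ENNReal.ofReal_mul (by norm_num)]
          refine ENNReal.ofReal_le_ofReal ?_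
          nlinarith [sq_nonneg ((T.toFun q x - m₂) + (m₁ - m₂))]
      _ = 2 * ((∫⁻ x in B, ENNReal.ofReal ((T.toFun q x - m₂) ^ 2)) +
            ENNReal.ofReal ((m₁ - m₂) ^ 2) * volume B) := by
          rw [lintegral_const_mul' _ _ (by norm_num), lintegral_add_left (hmeas _),
            setLIntegral_const]
      _ ≤ _ := by gcongr
  calc _ ≤ _ := lintegral_union_le _ A B
    _ ≤ C₁ * X + 2 * (C₂ * X + θ * (2 * (C₁ * X + C₂ * X))) := by gcongr
    _ = _ := by push_cast; ring

theorem HasPoincare.congr_ae {κ : ℝ} {A B : Set (Pt N)} (hB : HasPoincare Ω κ B)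
    (h : A =ᵐ[volume] B) : HasPoincare Ω κ A := by
  obtain ⟨C, hC⟩ := hB
  refine ⟨C, fun T hT q => ?_⟩
  obtain ⟨m, hm⟩ := hC T hT q
  exact ⟨m, by rwa [setLIntegral_congr h]⟩

/-- Any two points of a connected open set lie in a common open subset with a Poincaré
inequality. -/
theorem exists_hasPoincare_of_mem (hN : 2 ≤ N) (ho : IsOpen Ω) (hb : Bornology.IsBounded Ω)
    (hc : IsPreconnected Ω) {κ : ℝ} (hκ : 0 < κ) {x y : Pt N} (hx : x ∈ Ω) (hy : y ∈ Ω) :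
    ∃ A ⊆ Ω, IsOpen A ∧ x ∈ A ∧ y ∈ A ∧ HasPoincare Ω κ A := by
  -- The relation holds locally by balls, is transitive since open sets sharing a point overlap in
  -- positive measure, and is symmetric; connectedness extends it to all pairs.
  refine hc.induction₂ (fun x y => ∃ A ⊆ Ω, IsOpen A ∧ x ∈ A ∧ y ∈ A ∧ HasPoincare Ω κ A)
    (fun x hx => ?_) (fun x y z hx hy hz h1 h2 => ?_) (fun x y hx hy h => ?_) hx hy
  · obtain ⟨r, hr, hrΩ⟩ := Metric.isOpen_iff.1 ho x hx
    refine Filter.Eventually.filter_mono nhdsWithin_le_nhds ?_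
    filter_upwards [Metric.ball_mem_nhds x hr] with y hy
    exact ⟨Metric.ball x r, hrΩ, Metric.isOpen_ball, Metric.mem_ball_self hr, hy,
      hasPoincare_of_convex hN ho hb hκ (convex_ball x r) hrΩ Metric.isOpen_ball
        ⟨x, Metric.mem_ball_self hr⟩⟩
  · obtain ⟨A, hAΩ, hA, hxA, hyA, hAP⟩ := h1
    obtain ⟨B, hBΩ, hB, hyB, hzB, hBP⟩ := h2
    exact ⟨A ∪ B, Set.union_subset hAΩ hBΩ, hA.union hB, Or.inl hxA, Or.inr hzB,
      hAP.union hBP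
        ((hA.inter hB).measure_pos _ ⟨y, hyA, hyB⟩).ne'
        ((measure_mono hBΩ).trans_lt hb.measure_lt_top).ne⟩
  · obtain ⟨A, hAΩ, hA, hxA, hyA, hAP⟩ := h
    exact ⟨A, hAΩ, hA, hyA, hxA, hAP⟩

/-- The Poincaré inequality on a connected domain that has a mesh. -/
theorem hasPoincare (hN : 2 ≤ N) (ho : IsOpen Ω) (hb : Bornology.IsBounded Ω)
    (hΩ : interior (closure Ω) = Ω) (hc : IsPreconnected Ω) (T : Mesh Ω) {κ : ℝ} (hκ : 0 < κ) :
    HasPoincare Ω κ Ω := by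
  classical
  have hne : ∀ s ∈ T.elements, (interior (conv s)).Nonempty := fun s hs =>
    interior_conv_nonempty (indep_of_mem_elements hs) (card_of_mem_elements hs)
  have hsub : ∀ s ∈ T.elements, interior (conv s) ⊆ Ω := fun s hs => interior_conv_subset hΩ hs
  -- The given mesh serves only to exhaust `Ω`, up to a null set, by finitely many convex sets,
  -- which are attached one at a time through connecting sets. The resulting constant is valid for
  -- every other shape regular mesh.
  have key : ∀ E ⊆ T.elements, E.Nonempty → ∃ A ⊆ Ω, IsOpen A ∧ A.Nonempty ∧
      (∀ s ∈ E, interior (conv s) ⊆ A) ∧ HasPoincare Ω κ A := by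
    intro E hE hEne
    induction hEne using Finset.Nonempty.cons_induction with
    | singleton s =>
      have hs := hE (Finset.mem_singleton_self s)
      refine ⟨interior (conv s), hsub s hs, isOpen_interior, hne s hs, fun t ht => ?_,
        hasPoincare_of_convex hN ho hb hκ (convex_convexHull ℝ _).interior (hsub s hs)
          isOpen_interior (hne s hs)⟩
      rw [Finset.mem_singleton.1 ht]
    | cons s E hsE hEne ih =>
      obtain ⟨A, hAΩ, hA, ⟨x, hx⟩, hAE, hAP⟩ := ih fun t ht => hE (Finset.mem_cons_of_mem ht)
      have hs := hE (Finset.mem_cons_self s E)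
      obtain ⟨y, hy⟩ := hne s hs
      have hsP := hasPoincare_of_convex hN ho hb hκ (convex_convexHull ℝ _).interior (hsub s hs)
          isOpen_interior (hne s hs)
      obtain ⟨B, hBΩ, hB, hxB, hyB, hBP⟩ :=
        exists_hasPoincare_of_mem hN ho hb hc hκ (hAΩ hx) (hsub s hs hy)
      have htop : ∀ {B : Set (Pt N)}, B ⊆ Ω → volume B ≠ ⊤ := fun h =>
        ((measure_mono h).trans_lt hb.measure_lt_top).ne
      refine ⟨A ∪ B ∪ interior (conv s), Set.union_subset (Set.union_subset hAΩ hBΩ) (hsub s hs),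
        (hA.union hB).union isOpen_interior, ⟨x, Or.inl (Or.inl hx)⟩, fun t ht => ?_, ?_⟩
      · rcases Finset.mem_cons.1 ht with rfl | ht
        · exact Set.subset_union_right
        · exact (hAE t ht).trans (Set.subset_union_left.trans Set.subset_union_left)
      · refine (hAP.union hBP
          ((hA.inter hB).measure_pos _ ⟨x, hx, hxB⟩).ne' (htop hBΩ)).union hsP ?_ (htop (hsub s hs))
        exact (((hA.union hB).inter isOpen_interior).measure_pos _ ⟨y, Or.inr hyB, hy⟩).ne'
  rcases T.elements.eq_empty_or_nonempty with h | h
  · have hemp : Ω = ∅ := by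
      have := T.closure_eq_iUnion
      rw [h] at this
      simpa using this
    refine ⟨0, fun T hT q => ⟨0, ?_⟩⟩
    rw [Measure.restrict_eq_zero.2 (by rw [hemp, measure_empty]), lintegral_zero_measure]
    exact zero_le
  · obtain ⟨A, hAΩ, hA, -, hAE, hAP⟩ := key _ subset_rfl h
    refine hAP.congr_ae (Filter.EventuallyLE.antisymm ?_ hAΩ.eventuallyLE)
    have := T.ae_mem_interior
    rw [ae_restrict_iff' isClosed_closure.measurableSet] at this
    filter_upwards [this] with x hx hxΩ
    obtain ⟨s, hs, hxs⟩ := hx (subset_closure hxΩ)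
    exact hAE s hs hxs

end Mesh

end CompressibleStokes

namespace CompressibleStokes

/-! ### The estimate for one numerical solution -/

section WeightedSums

variable {α : Type*} {E : Finset α} {vol : α → ℝ}

/-- An energy inequality with a dissipation term, where the pressure is `ν d - G` with mean-free
`d`. -/
theorem dissipation_le {p d : α → ℝ} (hvol : ∀ s ∈ E, 0 < vol s) {ν τ e e' c Y : ℝ} (hν : 0 ≤ ν)
    (hτ : 0 ≤ τ) (hd : ∑ s ∈ E, vol s * d s = 0)
    (hY : ∑ s ∈ E, vol s * (ν * d s - p s - c) ^ 2 ≤ Y)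
    (hen : e' + τ * ∑ s ∈ E, vol s * (p s * d s) ≤ e) :
    τ * ∑ s ∈ E, vol s * (ν * d s) ^ 2 ≤ 2 * ν * e - 2 * ν * e' + τ * Y := by
  have h1 : ∑ s ∈ E, vol s * (ν * d s) ^ 2 ≤
      2 * ν * ∑ s ∈ E, vol s * (p s * d s) + ∑ s ∈ E, vol s * (ν * d s - p s - c) ^ 2 := by
    -- This drops `(p + c)²` from `(ν d)² = 2 ν d (p + c) + (ν d - p - c)² - (p + c)²`; the term
    -- with `c` then sums to zero because `d` has mean zero.
    have : ∑ s ∈ E, vol s * (ν * d s) ^ 2 ≤ ∑ s ∈ E, (2 * ν * (vol s * (p s * d s)) +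
        vol s * (ν * d s - p s - c) ^ 2 + 2 * ν * c * (vol s * d s)) := by
      refine Finset.sum_le_sum fun s hs => ?_
      have := hvol s hs
      have h2 : 0 ≤ vol s * (p s + c) ^ 2 := by positivity
      nlinarith
    rwa [Finset.sum_add_distrib, Finset.sum_add_distrib, ← Finset.mul_sum, ← Finset.mul_sum, hd,
      mul_zero, add_zero] at this
  have h2 := mul_le_mul_of_nonneg_left (h1.trans (add_le_add_right hY _)) hτ
  have h3 := mul_le_mul_of_nonneg_left hen (mul_nonneg zero_le_two hν)
  linarith

/-- A bound for the square sum of a nonnegative increasing function of the density, by its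
oscillation and the total mass. -/
theorem sum_sq_le_of_mass {p r : α → ℝ} (hvol : ∀ s ∈ E, 0 < vol s) (hp : ∀ s ∈ E, 0 ≤ p s)
    (hr : ∀ s ∈ E, 0 ≤ r s) {V A P : ℝ} (hV : ∑ s ∈ E, vol s = V) (hVpos : 0 < V) (hA : 0 < A)
    (hmass : ∑ s ∈ E, vol s * r s ≤ A) (hP : ∀ s ∈ E, r s ≤ 2 * A / V → p s ≤ P) (m : ℝ) :
    ∑ s ∈ E, vol s * p s ^ 2 ≤ 10 * ∑ s ∈ E, vol s * (p s - m) ^ 2 + 8 * V * P ^ 2 := by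
  classical
  set Y := ∑ s ∈ E, vol s * (p s - m) ^ 2 with hY
  set L := E.filter fun s => r s ≤ 2 * A / V with hL
  have hLE : L ⊆ E := Finset.filter_subset _ _
  -- Markov's inequality: the set where `r > 2 A / V` has at most half of the volume.
  have hhigh : 2 * A / V * (V - ∑ s ∈ L, vol s) ≤ A := by
    have hsplit := Finset.sum_filter_add_sum_filter_not E (fun s => r s ≤ 2 * A / V) vol
    rw [hV] at hsplit
    rw [show V - ∑ s ∈ L, vol s = ∑ s ∈ E with ¬ r s ≤ 2 * A / V, vol s by linarith,
      Finset.mul_sum]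
    refine le_trans ?_ hmass
    refine (Finset.sum_le_sum fun s hs => ?_).trans (Finset.sum_le_sum_of_subset_of_nonneg
      (Finset.filter_subset (fun s => ¬ r s ≤ 2 * A / V) E)
      fun s hs _ => mul_nonneg (hvol s hs).le (hr s hs))
    obtain ⟨hs, hlt⟩ := Finset.mem_filter.1 hs
    rw [mul_comm]
    exact mul_le_mul_of_nonneg_left (not_le.1 hlt).le (hvol s hs).le
  have hlow : V ≤ 2 * ∑ s ∈ L, vol s := by
    rw [div_mul_eq_mul_div, div_le_iff₀ hVpos] at hhigh
    nlinarith
  -- On `L` the pressure is at most `P`, so `m² ≤ 2 (p - m)² + 2 P²`. As `L` has at least half of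
  -- the volume, this gives `m² V ≤ 4 Y + 4 P² V`, which is inserted into `h2`.
  have h1 : m ^ 2 * ∑ s ∈ L, vol s ≤ 2 * Y + 2 * P ^ 2 * V := by
    calc m ^ 2 * ∑ s ∈ L, vol s = ∑ s ∈ L, vol s * m ^ 2 := by
          rw [Finset.mul_sum]; exact Finset.sum_congr rfl fun _ _ => mul_comm _ _
      _ ≤ ∑ s ∈ L, vol s * (2 * (p s - m) ^ 2 + 2 * P ^ 2) := by
          refine Finset.sum_le_sum fun s hs => ?_
          obtain ⟨hs, hle⟩ := Finset.mem_filter.1 hs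
          have h2 := hP s hs hle
          have h3 := hp s hs
          refine mul_le_mul_of_nonneg_left ?_ (hvol s hs).le
          nlinarith [sq_nonneg (2 * p s - m), mul_self_le_mul_self h3 h2]
      _ ≤ ∑ s ∈ E, vol s * (2 * (p s - m) ^ 2 + 2 * P ^ 2) :=
          Finset.sum_le_sum_of_subset_of_nonneg hLE fun s hs _ => by
            have := hvol s hs; positivity
      _ = _ := by
          rw [hY, ← hV, Finset.mul_sum, Finset.mul_sum, ← Finset.sum_add_distrib]
          exact Finset.sum_congr rfl fun _ _ => by ring
  have h2 : ∑ s ∈ E, vol s * p s ^ 2 ≤ 2 * Y + 2 * m ^ 2 * V := by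
    rw [hY, ← hV, Finset.mul_sum, Finset.mul_sum, ← Finset.sum_add_distrib]
    refine Finset.sum_le_sum fun s hs => ?_
    have := hvol s hs
    have h3 : 0 ≤ vol s * (p s - 2 * m) ^ 2 := by positivity
    nlinarith
  nlinarith [sq_nonneg m, mul_le_mul_of_nonneg_left hlow (sq_nonneg m)]

end WeightedSums

namespace IsNumericalSolution

variable {N : ℕ} {Ω : Set (Pt N)} {a γ μ lam : ℝ} {f : ℝ → Pt N → Pt N} {T : Mesh Ω} {dt : ℝ}
  {M : ℕ} {ρ : ℕ → PiecewiseConst N} {w : ℕ → Finset (Pt N) → Pt N → Pt (vortDim N)}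
  {u : ℕ → Finset (Pt N) → Pt N → Pt N} (hsol : IsNumericalSolution a γ μ lam f T dt M ρ w u)

include hsol

theorem sum_divergence_eq_zero (hN : 1 ≤ N) (ho : IsOpen Ω) {m : ℕ} (hm : m ∈ Finset.Icc 1 M) :
    ∑ s ∈ T.elements, volume.real (conv s) * divergence (u m s) 0 = 0 := by
  simpa using Mesh.sum_mul_divergence hN ho (hsol.memV m hm) fun _ => 1

/-- The jumps of the effective viscous flux are controlled by the source term. -/
theorem jumpEnergy_flux_le (hN : N = 2 ∨ N = 3) (ho : IsOpen Ω) {κ : ℝ} (hκ : 0 < κ)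
    (hT : T.ShapeRegular κ) {m : ℕ} (hm : m ∈ Finset.Icc 1 M) :
    T.jumpEnergy (fun s => (μ + lam) * divergence (u m s) 0 - pressure a γ (ρ m s)) ≤
      2 * ((N + 1) / (N ^ 2 * shapeConst N κ)) *
        ∑ s ∈ T.elements, volume.real (conv s) * ‖discreteSource f dt m s‖ ^ 2 := by
  obtain ⟨z, hz, hzV⟩ := Mesh.memV_curl hN (hsol.memW m hm)
  refine Mesh.jumpEnergy_le_of_momentum (by omega) ho hκ hT hz hzV (μ := μ) fun v hv => ?_
  rw [← hsol.momentum m hm v hv]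
  refine Finset.sum_congr rfl fun s hs => integral_congr_ae (Filter.Eventually.of_forall fun x => ?_)
  obtain ⟨b, c, hbc⟩ := (hsol.memV m hm).local_form s hs
  simp only [divergence_of_affine hbc]

/-- The square sum of the pressure. -/
theorem sum_pressure_sq_le (hN : N = 2 ∨ N = 3) (ho : IsOpen Ω) (ha : 0 < a) (hγ : 1 < γ)
    (hν : 0 ≤ μ + lam) {κ : ℝ} (hκ : 0 < κ) (hT : T.ShapeRegular κ) (hdt : 0 ≤ dt)
    {K V A : ℝ} (hK : 0 ≤ K) (hP : ∀ q : PiecewiseConst N, ∃ m : ℝ,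
      ∑ s ∈ T.elements, volume.real (conv s) * (q s - m) ^ 2 ≤ K * T.jumpEnergy q)
    (hV : ∑ s ∈ T.elements, volume.real (conv s) = V) (hVpos : 0 < V) (hA : 0 < A)
    (hmass : ∑ s ∈ T.elements, volume.real (conv s) * ρ 0 s ≤ A) :
    ∑ m ∈ Finset.range M, dt * ∑ s ∈ T.elements,
        volume.real (conv s) * pressure a γ (ρ (m + 1) s) ^ 2 ≤
      40 * (μ + lam) * ((γ - 1)⁻¹ * ∑ s ∈ T.elements,
          volume.real (conv s) * pressure a γ (ρ 0 s)) +
        40 * (K * (2 * ((N + 1) / (N ^ 2 * shapeConst N κ)))) * ∑ m ∈ Finset.range M,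
          dt * ∑ s ∈ T.elements, volume.real (conv s) * ‖discreteSource f dt (m + 1) s‖ ^ 2 +
        8 * V * pressure a γ (2 * A / V) ^ 2 * (M * dt) := by
  have hc := shapeConst_pos N hκ
  set ν := μ + lam with hνdef
  set C := K * (2 * ((N + 1) / (N ^ 2 * shapeConst N κ))) with hC
  set F : ℕ → ℝ := fun m => ∑ s ∈ T.elements,
    volume.real (conv s) * ‖discreteSource f dt m s‖ ^ 2 with hF
  set e : ℕ → ℝ := fun m => (γ - 1)⁻¹ * ∑ s ∈ T.elements,
    volume.real (conv s) * pressure a γ (ρ m s) with he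
  set X : ℕ → ℝ := fun m => ∑ s ∈ T.elements,
    volume.real (conv s) * (ν * divergence (u m s) 0) ^ 2 with hX
  have hvol : ∀ s ∈ T.elements, 0 < volume.real (conv s) := fun s hs => Mesh.vol_pos hs
  have hp0 : ∀ m ≤ M, ∀ s ∈ T.elements, 0 ≤ pressure a γ (ρ m s) := fun m hm s hs =>
    mul_nonneg ha.le (Real.rpow_nonneg (hsol.density_pos ho hdt hm s hs).le _)
  -- Poincaré inequality for the effective viscous flux, whose jump energy is bounded by the source.
  have step : ∀ m < M, ∃ c, ∑ s ∈ T.elements, volume.real (conv s) *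
      (ν * divergence (u (m + 1) s) 0 - pressure a γ (ρ (m + 1) s) - c) ^ 2 ≤ C * F (m + 1) := by
    intro m hm
    have hm' : m + 1 ∈ Finset.Icc 1 M := Finset.mem_Icc.2 ⟨by omega, hm⟩
    obtain ⟨c, hc⟩ := hP fun s => ν * divergence (u (m + 1) s) 0 - pressure a γ (ρ (m + 1) s)
    refine ⟨c, hc.trans ?_⟩
    rw [hC, mul_assoc]
    exact mul_le_mul_of_nonneg_left (hsol.jumpEnergy_flux_le hN ho hκ hT hm') hK
  have hdiss : ∀ m < M, dt * X (m + 1) ≤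
      2 * ν * e m - 2 * ν * e (m + 1) + dt * (C * F (m + 1)) := by
    intro m hm
    have hm' : m + 1 ∈ Finset.Icc 1 M := Finset.mem_Icc.2 ⟨by omega, hm⟩
    obtain ⟨c, hc⟩ := step m hm
    exact dissipation_le hvol hν hdt (hsol.sum_divergence_eq_zero (by omega) ho hm') hc
      (hsol.energy_le (by omega) ho ha hγ hdt hm)
  -- The oscillation is measured from `-c`, because `p + c` is `ν div u` minus the deviation of the
  -- flux from `c`. The 20 is the 10 of `sum_sq_le_of_mass` times the 2 from splitting this square.
  have hpm : ∀ m < M, ∑ s ∈ T.elements, volume.real (conv s) * pressure a γ (ρ (m + 1) s) ^ 2 ≤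
      20 * X (m + 1) + 20 * (C * F (m + 1)) + 8 * V * pressure a γ (2 * A / V) ^ 2 := by
    intro m hm
    obtain ⟨c, hc⟩ := step m hm
    have h1 := sum_sq_le_of_mass hvol (hp0 (m + 1) hm)
      (fun s hs => (hsol.density_pos ho hdt hm s hs).le) hV hVpos hA
      ((hsol.mass_eq ho hm).trans_le hmass) (P := pressure a γ (2 * A / V)) (fun s hs hle =>
        mul_le_mul_of_nonneg_left (Real.rpow_le_rpow (hsol.density_pos ho hdt hm s hs).le hle
          (by linarith)) ha.le) (-c)
    have h2 : ∑ s ∈ T.elements, volume.real (conv s) * (pressure a γ (ρ (m + 1) s) - -c) ^ 2 ≤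
        2 * X (m + 1) + 2 * ∑ s ∈ T.elements, volume.real (conv s) *
          (ν * divergence (u (m + 1) s) 0 - pressure a γ (ρ (m + 1) s) - c) ^ 2 := by
      rw [hX, Finset.mul_sum, Finset.mul_sum, ← Finset.sum_add_distrib]
      refine Finset.sum_le_sum fun s hs => ?_
      have := hvol s hs
      have h3 : 0 ≤ volume.real (conv s) * (2 * (ν * divergence (u (m + 1) s) 0) -
        (pressure a γ (ρ (m + 1) s) + c)) ^ 2 := by positivity
      nlinarith
    linarith
  have he0 : 0 ≤ e M := by
    refine mul_nonneg (inv_nonneg.2 (by linarith)) (Finset.sum_nonneg fun s hs => ?_)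
    exact mul_nonneg (hvol s hs).le (hp0 M le_rfl s hs)
  -- The energies telescope, and the final one is nonnegative.
  have hsum : ∑ m ∈ Finset.range M, dt * X (m + 1) ≤
      2 * ν * e 0 + ∑ m ∈ Finset.range M, dt * (C * F (m + 1)) := by
    have h1 := Finset.sum_le_sum fun m (hm : m ∈ Finset.range M) => hdiss m (Finset.mem_range.1 hm)
    rw [Finset.sum_add_distrib, Finset.sum_range_sub' (fun m => 2 * ν * e m)] at h1
    have : 0 ≤ 2 * ν * e M := by positivity
    linarith
  calc _ ≤ ∑ m ∈ Finset.range M, (20 * (dt * X (m + 1)) + 20 * (dt * (C * F (m + 1))) +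
          8 * V * pressure a γ (2 * A / V) ^ 2 * dt) := by
        refine Finset.sum_le_sum fun m hm => ?_
        have := mul_le_mul_of_nonneg_left (hpm m (Finset.mem_range.1 hm)) hdt
        linarith
    _ = 20 * ∑ m ∈ Finset.range M, dt * X (m + 1) +
          20 * ∑ m ∈ Finset.range M, dt * (C * F (m + 1)) +
          8 * V * pressure a γ (2 * A / V) ^ 2 * (M * dt) := by
        rw [Finset.sum_add_distrib, Finset.sum_add_distrib, Finset.mul_sum, Finset.mul_sum,
          Finset.sum_const, Finset.card_range, nsmul_eq_mul]
        ring
    _ ≤ 40 * ν * e 0 + 40 * ∑ m ∈ Finset.range M, dt * (C * F (m + 1)) +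
          8 * V * pressure a γ (2 * A / V) ^ 2 * (M * dt) := by linarith
    _ = _ := by
        rw [mul_assoc 40 C, Finset.mul_sum (a := C)]
        congr 3
        exact Finset.sum_congr rfl fun m _ => by ring

end IsNumericalSolution

end CompressibleStokes

namespace CompressibleStokes

/-! ### Integrals of discrete functions -/

/-- The Cauchy-Schwarz inequality against the constant function. -/
theorem sq_lintegral_le {α : Type*} [MeasurableSpace α] (ν : Measure α) {g : α → ENNReal}
    (hg : AEMeasurable g ν) : (∫⁻ x, g x ∂ν) ^ 2 ≤ ν Set.univ * ∫⁻ x, g x ^ 2 ∂ν := by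
  have h := ENNReal.lintegral_mul_le_Lp_mul_Lq ν Real.HolderConjugate.two_two
    (aemeasurable_const (b := (1 : ENNReal))) hg
  simp only [Pi.mul_apply, one_mul, ENNReal.rpow_ofNat] at h
  have hroot : ∀ y : ENNReal, (y ^ (1 / 2 : ℝ)) ^ 2 = y := fun y => by
    rw [← ENNReal.rpow_natCast, ← ENNReal.rpow_mul]
    norm_num
  refine (pow_le_pow_left₀ zero_le h 2).trans_eq ?_
  rw [mul_pow, hroot, hroot, one_pow, lintegral_one]

theorem eLpNorm_two_eq {α F : Type*} [MeasurableSpace α] [NormedAddCommGroup F] (ν : Measure α)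
    (g : α → F) : eLpNorm g 2 ν = (∫⁻ x, ‖g x‖ₑ ^ 2 ∂ν) ^ (1 / 2 : ℝ) := by
  rw [eLpNorm_eq_lintegral_rpow_enorm_toReal (by norm_num) (by norm_num)]
  simp

namespace Mesh

variable {N : ℕ} {Ω : Set (Pt N)} {T : Mesh Ω}

theorem ae_eq_iUnion_interior (hΩ : interior (closure Ω) = Ω) (T : Mesh Ω) :
    Ω =ᵐ[volume] ⋃ s ∈ T.elements, interior (conv s) := by
  have hsub : (⋃ s ∈ T.elements, interior (conv s)) ⊆ Ω :=
    Set.iUnion₂_subset fun s hs => interior_conv_subset hΩ hs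
  refine Filter.EventuallyLE.antisymm ?_ hsub.eventuallyLE
  have := T.ae_mem_interior
  rw [ae_restrict_iff' isClosed_closure.measurableSet] at this
  filter_upwards [this] with x hx hxΩ
  obtain ⟨s, hs, hxs⟩ := hx (subset_closure hxΩ)
  exact Set.mem_iUnion₂.2 ⟨s, hs, hxs⟩

theorem lintegral_comp_toFun (hΩ : interior (closure Ω) = Ω) (T : Mesh Ω) (q : PiecewiseConst N)
    (Φ : ℝ → ENNReal) :
    ∫⁻ x in Ω, Φ (T.toFun q x) = ∑ s ∈ T.elements, volume (conv s) * Φ (q s) := by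
  rw [setLIntegral_congr (ae_eq_iUnion_interior hΩ T),
    lintegral_biUnion_finset (fun s hs t ht hst => disjoint_interior hs ht hst)
      fun s _ => isOpen_interior.measurableSet]
  refine Finset.sum_congr rfl fun s hs => ?_
  rw [setLIntegral_congr_fun isOpen_interior.measurableSet (g := fun _ => Φ (q s))
    fun x hx => by simp only [toFun_eq hs hx], setLIntegral_const, volume_interior_conv, mul_comm]

theorem sum_ofReal_eq_lintegral (hΩ : interior (closure Ω) = Ω) (T : Mesh Ω)
    (q : PiecewiseConst N) {φ : ℝ → ℝ} (hφ : ∀ s ∈ T.elements, 0 ≤ φ (q s)) :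
    ENNReal.ofReal (∑ s ∈ T.elements, volume.real (conv s) * φ (q s)) =
      ∫⁻ x in Ω, ENNReal.ofReal (φ (T.toFun q x)) := by
  rw [lintegral_comp_toFun hΩ T q fun r => ENNReal.ofReal (φ r),
    ENNReal.ofReal_sum_of_nonneg fun s hs => mul_nonneg measureReal_nonneg (hφ s hs)]
  refine Finset.sum_congr rfl fun s _ => ?_
  rw [ENNReal.ofReal_mul measureReal_nonneg, ofReal_measureReal (volume_conv_lt_top s).ne]

theorem sum_volume_eq (hΩ : interior (closure Ω) = Ω) (T : Mesh Ω) :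
    ∑ s ∈ T.elements, volume.real (conv s) = volume.real Ω := by
  have h := sum_ofReal_eq_lintegral hΩ T (fun _ => 0) (φ := fun _ => 1) fun _ _ => zero_le_one
  simp only [mul_one, ENNReal.ofReal_one, setLIntegral_one] at h
  rw [measureReal_def (s := Ω), ← h, ENNReal.toReal_ofReal (Finset.sum_nonneg fun _ _ =>
    measureReal_nonneg)]

/-- The Poincaré inequality in terms of sums over the elements. -/
theorem HasPoincare.exists_sum_le (hΩ : interior (closure Ω) = Ω) {κ : ℝ}
    (h : HasPoincare Ω κ Ω) : ∃ K : ℝ, 0 ≤ K ∧ ∀ T : Mesh Ω, T.ShapeRegular κ →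
      ∀ q : PiecewiseConst N, ∃ m : ℝ,
        ∑ s ∈ T.elements, volume.real (conv s) * (q s - m) ^ 2 ≤ K * T.jumpEnergy q := by
  obtain ⟨K, hK⟩ := h
  refine ⟨K, K.coe_nonneg, fun T hT q => ?_⟩
  obtain ⟨m, hm⟩ := hK T hT q
  refine ⟨m, ?_⟩
  rw [← sum_ofReal_eq_lintegral hΩ T q (φ := fun r => (r - m) ^ 2) fun _ _ => sq_nonneg _,
    ← ENNReal.ofReal_coe_nnreal, ← ENNReal.ofReal_mul K.coe_nonneg] at hm
  exact (ENNReal.ofReal_le_ofReal_iff (mul_nonneg K.coe_nonneg (T.jumpEnergy_nonneg q))).1 hm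

/-- Bounds for a positive discrete density by its norm in `L^γ`. -/
theorem sum_rpow_le (hΩ : interior (closure Ω) = Ω) (T : Mesh Ω) {γ : ℝ}
    (hγ : 0 < γ) {q : PiecewiseConst N} (hq : ∀ s ∈ T.elements, 0 < q s) {R : NNReal}
    (hR : eLpNorm (T.toFun q) (ENNReal.ofReal γ) (volume.restrict Ω) ≤ R) :
    ∑ s ∈ T.elements, volume.real (conv s) * q s ^ γ ≤ (R : ℝ) ^ γ := by
  rw [eLpNorm_eq_lintegral_rpow_enorm_toReal (by simpa using hγ) ENNReal.ofReal_ne_top,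
    ENNReal.toReal_ofReal hγ.le, one_div, ENNReal.rpow_inv_le_iff hγ,
    lintegral_comp_toFun hΩ T q fun r => ‖r‖ₑ ^ γ] at hR
  rw [← ENNReal.ofReal_le_ofReal_iff (by positivity),
    ENNReal.ofReal_sum_of_nonneg fun s hs => mul_nonneg measureReal_nonneg
      (Real.rpow_nonneg (hq s hs).le _),
    ← ENNReal.ofReal_rpow_of_nonneg R.coe_nonneg hγ.le, ENNReal.ofReal_coe_nnreal]
  refine le_trans (Finset.sum_le_sum fun s hs => ?_) hR
  rw [ENNReal.ofReal_mul measureReal_nonneg, ofReal_measureReal (volume_conv_lt_top s).ne,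
    ← ENNReal.ofReal_rpow_of_nonneg (hq s hs).le hγ.le, Real.enorm_eq_ofReal (hq s hs).le]

/-- The contribution of a space-time cell to the square norm of the discrete source term. -/
theorem discreteSource_sq_le {f : ℝ → Pt N → Pt N} {dt : ℝ} (hdt : 0 < dt) (m : ℕ)
    {s : Finset (Pt N)} (hs : s ∈ T.elements)
    (hf : AEStronglyMeasurable (fun z : ℝ × Pt N => f z.1 z.2)
      (volume.restrict (Set.Ioo (m * dt) ((m + 1) * dt) ×ˢ interior (conv s)))) :
    ENNReal.ofReal dt * (volume (conv s) * ‖discreteSource f dt (m + 1) s‖ₑ ^ 2) ≤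
      ∫⁻ z in Set.Ioo (m * dt) ((m + 1) * dt) ×ˢ interior (conv s), ‖f z.1 z.2‖ₑ ^ 2 := by
  set D := ENNReal.ofReal dt with hD
  set W := volume (conv s) with hW
  have hD0 : D ≠ 0 := by simpa [hD] using hdt
  have hDt : D ≠ ⊤ := ENNReal.ofReal_ne_top
  have hWt : W ≠ ⊤ := (volume_conv_lt_top s).ne
  have hW0 : W ≠ 0 := fun h => by
    have := vol_pos hs
    rw [measureReal_def, ← hW, h] at this
    simp at this
  set I := Set.Ioo (m * dt) ((m + 1) * dt) with hI
  set ν := volume.restrict (I ×ˢ interior (conv s)) with hνdef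
  have hν : ν = (volume.restrict I).prod (volume.restrict (interior (conv s))) := by
    rw [hνdef, Measure.volume_eq_prod, Measure.prod_restrict]
  have hνu : ν Set.univ = D * W := by
    rw [hνdef, Measure.restrict_apply_univ, Measure.volume_eq_prod, Measure.prod_prod,
      volume_interior_conv, hI, Real.volume_Ioo, hD]
    congr 2
    ring
  -- The norm is moved inside both averages, which needs no integrability, and Tonelli joins them to
  -- one integral over the open cell.
  have h1 : ‖discreteSource f dt (m + 1) s‖ₑ ≤ D⁻¹ * (W⁻¹ * ∫⁻ z, ‖f z.1 z.2‖ₑ ∂ν) := by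
    have hle : ((m + 1 : ℕ) - 1 : ℝ) * dt ≤ ((m + 1 : ℕ) : ℝ) * dt := by
      have : 0 ≤ dt := hdt.le
      nlinarith
    rw [discreteSource, enorm_smul, intervalIntegral.integral_of_le hle, integral_Ioc_eq_integral_Ioo,
      show ((m + 1 : ℕ) - 1 : ℝ) * dt = m * dt by push_cast; ring,
      show ((m + 1 : ℕ) : ℝ) * dt = (m + 1) * dt by push_cast; ring, ← hI]
    rw [Real.enorm_eq_ofReal (inv_nonneg.2 hdt.le), ENNReal.ofReal_inv_of_pos hdt, ← hD]
    gcongr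
    refine (enorm_integral_le_lintegral_enorm _).trans ?_
    rw [hν, lintegral_prod _ (by rw [← hν]; exact hf.enorm),
      ← lintegral_const_mul' _ _ (ENNReal.inv_ne_top.2 hW0)]
    refine lintegral_mono fun τ => ?_
    rw [enorm_smul, Real.enorm_eq_ofReal (inv_nonneg.2 measureReal_nonneg),
      ENNReal.ofReal_inv_of_pos (vol_pos hs), ofReal_measureReal hWt,
      setIntegral_congr_set (interior_conv_ae_eq s).symm]
    gcongr
    exact enorm_integral_le_lintegral_enorm _
  calc D * (W * ‖discreteSource f dt (m + 1) s‖ₑ ^ 2)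
      ≤ D * (W * (D⁻¹ * (W⁻¹ * ∫⁻ z, ‖f z.1 z.2‖ₑ ∂ν)) ^ 2) := by gcongr
    _ = D * W * (D⁻¹ * W⁻¹) ^ 2 * (∫⁻ z, ‖f z.1 z.2‖ₑ ∂ν) ^ 2 := by ring
    _ ≤ D * W * (D⁻¹ * W⁻¹) ^ 2 * (D * W * ∫⁻ z, ‖f z.1 z.2‖ₑ ^ 2 ∂ν) := by
        gcongr
        rw [← hνu]
        exact sq_lintegral_le ν hf.enorm
    _ = (D * D⁻¹) ^ 2 * (W * W⁻¹) ^ 2 * ∫⁻ z, ‖f z.1 z.2‖ₑ ^ 2 ∂ν := by ring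
    _ = _ := by rw [ENNReal.mul_inv_cancel hD0 hDt, ENNReal.mul_inv_cancel hW0 hWt]; simp

/-- The discrete source term is bounded in the norm of `L²`. -/
theorem sum_discreteSource_sq_le (hΩ : interior (closure Ω) = Ω) (T : Mesh Ω)
    {f : ℝ → Pt N → Pt N} {dt : ℝ} (hdt : 0 < dt) (M : ℕ)
    (hf : MemLp (fun z : ℝ × Pt N => f z.1 z.2) 2
      (volume.restrict (Set.Ioo 0 (M * dt) ×ˢ Ω))) :
    ∑ m ∈ Finset.range M, dt * ∑ s ∈ T.elements,
        volume.real (conv s) * ‖discreteSource f dt (m + 1) s‖ ^ 2 ≤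
      (∫⁻ z in Set.Ioo 0 (M * dt) ×ˢ Ω, ‖f z.1 z.2‖ₑ ^ 2).toReal := by
  have hfin : ∫⁻ z in Set.Ioo 0 (M * dt) ×ˢ Ω, ‖f z.1 z.2‖ₑ ^ 2 ≠ ⊤ := by
    have h := hf.2.ne
    rw [eLpNorm_two_eq] at h
    intro h'
    rw [h'] at h
    simp at h
  -- Open space-time cells: they are pairwise disjoint and contained in the cylinder, so the local
  -- bounds add up.
  set B : ℕ × Finset (Pt N) → Set (ℝ × Pt N) := fun k =>
    Set.Ioo (k.1 * dt) ((k.1 + 1) * dt) ×ˢ interior (conv k.2) with hB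
  have hsub : ∀ k ∈ Finset.range M ×ˢ T.elements, B k ⊆ Set.Ioo 0 (M * dt) ×ˢ Ω := by
    intro k hk
    obtain ⟨h1, h2⟩ := Finset.mem_product.1 hk
    refine Set.prod_mono (Set.Ioo_subset_Ioo (by positivity) ?_) (interior_conv_subset hΩ h2)
    have : (k.1 : ℝ) + 1 ≤ M := by exact_mod_cast Finset.mem_range.1 h1
    gcongr
  have hdisj : Set.PairwiseDisjoint ((Finset.range M ×ˢ T.elements : Finset _) : Set _) B := by
    intro k hk l hl hkl
    obtain ⟨-, h1⟩ := Finset.mem_product.1 hk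
    obtain ⟨-, h2⟩ := Finset.mem_product.1 hl
    refine Set.disjoint_left.2 fun z hzk hzl => hkl (Prod.ext ?_ ?_)
    · obtain ⟨⟨a1, a2⟩, -⟩ := hzk
      obtain ⟨⟨b1, b2⟩, -⟩ := hzl
      have c1 := lt_of_mul_lt_mul_right (a1.trans b2) hdt.le
      have c2 := lt_of_mul_lt_mul_right (b1.trans a2) hdt.le
      norm_cast at c1 c2
      omega
    · by_contra hne
      exact Set.disjoint_left.1 (disjoint_interior h1 h2 hne) hzk.2 hzl.2
  refine (ENNReal.ofReal_le_iff_le_toReal hfin).1 ?_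
  have hnn : ∀ m, 0 ≤ ∑ s ∈ T.elements,
      volume.real (conv s) * ‖discreteSource f dt (m + 1) s‖ ^ 2 := fun m =>
    Finset.sum_nonneg fun s _ => mul_nonneg measureReal_nonneg (by positivity)
  calc _ = ∑ k ∈ Finset.range M ×ˢ T.elements, ENNReal.ofReal dt *
          (volume (conv k.2) * ‖discreteSource f dt (k.1 + 1) k.2‖ₑ ^ 2) := by
        rw [Finset.sum_product, ENNReal.ofReal_sum_of_nonneg fun m _ =>
          mul_nonneg hdt.le (hnn m)]
        refine Finset.sum_congr rfl fun m _ => ?_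
        rw [ENNReal.ofReal_mul hdt.le, ENNReal.ofReal_sum_of_nonneg fun s _ =>
          mul_nonneg measureReal_nonneg (by positivity), Finset.mul_sum]
        refine Finset.sum_congr rfl fun s _ => ?_
        rw [ENNReal.ofReal_mul measureReal_nonneg, ofReal_measureReal (volume_conv_lt_top s).ne,
          ENNReal.ofReal_pow (norm_nonneg _), ofReal_norm]
    _ ≤ ∑ k ∈ Finset.range M ×ˢ T.elements, ∫⁻ z in B k, ‖f z.1 z.2‖ₑ ^ 2 := by
        refine Finset.sum_le_sum fun k hk => ?_
        exact discreteSource_sq_le hdt k.1 (Finset.mem_product.1 hk).2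
          (hf.1.mono_measure (Measure.restrict_mono (hsub k hk) le_rfl))
    _ = ∫⁻ z in ⋃ k ∈ Finset.range M ×ˢ T.elements, B k, ‖f z.1 z.2‖ₑ ^ 2 :=
        (lintegral_biUnion_finset hdisj (fun k _ => measurableSet_Ioo.prod
          isOpen_interior.measurableSet) _).symm
    _ ≤ _ := lintegral_mono_set (Set.iUnion₂_subset hsub)

theorem measurable_densityFun (T : Mesh Ω) (dt : ℝ) (ρ : ℕ → PiecewiseConst N) :
    Measurable fun z : ℝ × Pt N => densityFun T dt ρ z.1 z.2 := by
  unfold densityFun toFun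
  refine Finset.measurable_sum _ fun s _ => ?_
  have h : Measurable fun z : ℝ × Pt N => ρ ⌈z.1 / dt⌉₊ s :=
    (Measurable.of_discrete (f := fun k : ℕ => ρ k s)).comp
      (Nat.measurable_ceil.comp (measurable_fst.div_const dt))
  exact h.indicator (measurable_snd isOpen_interior.measurableSet)

theorem lintegral_densityFun_le (hΩ : interior (closure Ω) = Ω) (T : Mesh Ω) {dt : ℝ}
    (hdt : 0 < dt) (M : ℕ) (ρ : ℕ → PiecewiseConst N) {Φ : ℝ → ENNReal} (hΦ : Measurable Φ) :
    ∫⁻ z in Set.Ioo 0 (M * dt) ×ˢ Ω, Φ (densityFun T dt ρ z.1 z.2) ≤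
      ∑ m ∈ Finset.range M, ENNReal.ofReal dt *
        ∑ s ∈ T.elements, volume (conv s) * Φ (ρ (m + 1) s) := by
  rw [Measure.volume_eq_prod, ← Measure.prod_restrict,
    lintegral_prod (fun z : ℝ × Pt N => Φ (densityFun T dt ρ z.1 z.2))
      (hΦ.comp (measurable_densityFun T dt ρ)).aemeasurable]
  set H : ℕ → ENNReal := fun m => ∑ s ∈ T.elements, volume (conv s) * Φ (ρ m s) with hH
  calc _ = ∫⁻ t in Set.Ioo 0 (M * dt), H ⌈t / dt⌉₊ :=
        lintegral_congr fun t => lintegral_comp_toFun hΩ T (ρ ⌈t / dt⌉₊) Φ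
    _ ≤ ∫⁻ t in Set.Ioo 0 (M * dt), ∑ m ∈ Finset.range M,
          (Set.Ioc (m * dt) ((m + 1) * dt)).indicator (fun _ => H (m + 1)) t := by
        refine setLIntegral_mono' measurableSet_Ioo fun t ht => ?_
        -- For `t > 0` the index is at least 1, so the initial density does not enter.
        have hpos : 0 < ⌈t / dt⌉₊ := Nat.ceil_pos.2 (div_pos ht.1 hdt)
        have hle : ⌈t / dt⌉₊ ≤ M := Nat.ceil_le.2 ((div_le_iff₀ hdt).2 ht.2.le)
        obtain ⟨k, hk⟩ : ∃ k, ⌈t / dt⌉₊ = k + 1 := ⟨⌈t / dt⌉₊ - 1, by omega⟩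
        have hmem : t ∈ Set.Ioc ((k : ℝ) * dt) ((k + 1) * dt) := by
          have h1 := Nat.le_ceil (t / dt)
          have h2 := Nat.ceil_lt_add_one (div_pos ht.1 hdt).le
          rw [hk] at h1 h2
          push_cast at h1 h2
          exact ⟨(lt_div_iff₀ hdt).1 (by linarith), (div_le_iff₀ hdt).1 h1⟩
        rw [hk]
        refine le_trans (le_of_eq ?_) (Finset.single_le_sum (fun _ _ => zero_le)
          (Finset.mem_range.2 (show k < M by omega)))
        rw [Set.indicator_of_mem hmem]
    _ ≤ ∫⁻ t, ∑ m ∈ Finset.range M,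
          (Set.Ioc (m * dt) ((m + 1) * dt)).indicator (fun _ => H (m + 1)) t :=
        lintegral_mono' Measure.restrict_le_self le_rfl
    _ = _ := by
        rw [lintegral_finsetSum _ fun m _ => measurable_const.indicator measurableSet_Ioc]
        refine Finset.sum_congr rfl fun m _ => ?_
        rw [lintegral_indicator_const measurableSet_Ioc, Real.volume_Ioc, mul_comm]
        congr 2
        ring

theorem lintegral_sq_pressure_le (hΩ : interior (closure Ω) = Ω) (T : Mesh Ω) {dt : ℝ}
    (hdt : 0 < dt) (M : ℕ) (ρ : ℕ → PiecewiseConst N) (a γ : ℝ) :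
    ∫⁻ z in Set.Ioo 0 (M * dt) ×ˢ Ω, ‖pressure a γ (densityFun T dt ρ z.1 z.2)‖ₑ ^ 2 ≤
      ENNReal.ofReal (∑ m ∈ Finset.range M, dt *
        ∑ s ∈ T.elements, volume.real (conv s) * pressure a γ (ρ (m + 1) s) ^ 2) := by
  refine (lintegral_densityFun_le hΩ T hdt M ρ (Φ := fun r => ‖pressure a γ r‖ₑ ^ 2) ?_).trans_eq ?_
  · unfold pressure
    fun_prop
  · have hnn : ∀ m, 0 ≤ ∑ s ∈ T.elements,
        volume.real (conv s) * pressure a γ (ρ (m + 1) s) ^ 2 := fun m =>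
      Finset.sum_nonneg fun s _ => mul_nonneg measureReal_nonneg (by positivity)
    rw [ENNReal.ofReal_sum_of_nonneg fun m _ => mul_nonneg hdt.le (hnn m)]
    refine Finset.sum_congr rfl fun m _ => ?_
    rw [ENNReal.ofReal_mul hdt.le, ENNReal.ofReal_sum_of_nonneg fun s _ =>
      mul_nonneg measureReal_nonneg (by positivity)]
    congr 1
    refine Finset.sum_congr rfl fun s _ => ?_
    rw [ENNReal.ofReal_mul measureReal_nonneg, ofReal_measureReal (volume_conv_lt_top s).ne,
      ← sq_abs, ENNReal.ofReal_pow (abs_nonneg _), ← Real.norm_eq_abs, ofReal_norm]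

end Mesh

end CompressibleStokes

/-! ### The uniform bound for the pressure -/

open CompressibleStokes MeasureTheory in
theorem lemma4p4 {N : ℕ} (hN : N = 2 ∨ N = 3)
    -- the domain and the final time
    (Ω : Set (Pt N)) (hΩ_open : IsOpen Ω) (hΩ_bdd : Bornology.IsBounded Ω)
    (hΩ_sc : IsSimplyConnected Ω) (hΩ_lip : HasLipschitzBoundary Ω)
    (Tfin : ℝ) (hT : 0 < Tfin)
    -- the pressure law and the viscosities
    (a γ μ lam : ℝ) (ha : 0 < a) (hγ : 1 < γ) (hμ : 0 < μ) (hlam : 0 ≤ N * lam + 2 * μ)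
    -- the source term and the initial density
    (f : ℝ → Pt N → Pt N)
    (hf : MemLp (fun z : ℝ × Pt N => f z.1 z.2) 2 (volume.restrict (Set.Ioo 0 Tfin ×ˢ Ω)))
    (ρ₀ : Pt N → ℝ) (hρ₀ : MemLp ρ₀ (ENNReal.ofReal γ) (volume.restrict Ω))
    -- a shape regular family of meshes, with time steps proportional to the mesh size
    {ι : Type*} (T : ι → Mesh Ω) (κ : ℝ) (hκ : 0 < κ) (hT_reg : ∀ i, (T i).ShapeRegular κ)
    (c : ℝ) (hc : 0 < c) (dt : ι → ℝ) (hdt : ∀ i, dt i = c * (T i).size)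
    (M : ι → ℕ) (hM : ∀ i, M i * dt i = Tfin)
    -- numerical solutions
    (ρ : ι → ℕ → PiecewiseConst N)
    (w : ι → ℕ → Finset (Pt N) → Pt N → Pt (vortDim N))
    (u : ι → ℕ → Finset (Pt N) → Pt N → Pt N)
    (hsol : ∀ i, IsNumericalSolution a γ μ lam f (T i) (dt i) (M i) (ρ i) (w i) (u i))
    -- the discrete initial densities converge to `ρ₀` as the mesh size tends to zero
    (hρ₀_ae : ∀ᵐ x ∂(volume.restrict Ω),
      Filter.Tendsto (fun i => (T i).toFun (ρ i 0) x)
        (Filter.comap (fun i => (T i).size) (nhds 0)) (nhds (ρ₀ x)))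
    (hρ₀_L1 : Filter.Tendsto
      (fun i => eLpNorm (fun x => (T i).toFun (ρ i 0) x - ρ₀ x) 1 (volume.restrict Ω))
      (Filter.comap (fun i => (T i).size) (nhds 0)) (nhds 0))
    -- and they are bounded in `L^γ`
    (hρ₀_bdd : ∃ R : NNReal, ∀ i,
      eLpNorm ((T i).toFun (ρ i 0)) (ENNReal.ofReal γ) (volume.restrict Ω) ≤ R) :
    ∃ C : NNReal, ∀ i,
      MemLp (fun z : ℝ × Pt N => pressure a γ (densityFun (T i) (dt i) (ρ i) z.1 z.2)) 2
        (volume.restrict (Set.Ioo 0 Tfin ×ˢ Ω)) ∧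
      eLpNorm (fun z : ℝ × Pt N => pressure a γ (densityFun (T i) (dt i) (ρ i) z.1 z.2)) 2
        (volume.restrict (Set.Ioo 0 Tfin ×ˢ Ω)) ≤ C := by
  have hN2 : 2 ≤ N := by omega
  have hΩ := interior_closure_eq_of_hasLipschitzBoundary hΩ_lip hΩ_open
  -- One mesh of the family is needed for the decomposition of `Ω` behind the Poincaré constant.
  rcases isEmpty_or_nonempty ι with hι | ⟨⟨i₀⟩⟩
  · exact ⟨0, fun i => hι.elim i⟩
  have hconn := hΩ_sc.isPathConnected
  obtain ⟨K, hK, hP⟩ := (Mesh.hasPoincare hN2 hΩ_open hΩ_bdd hΩ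
    hconn.isConnected.isPreconnected (T i₀) hκ).exists_sum_le hΩ
  obtain ⟨R, hR⟩ := hρ₀_bdd
  have hV : 0 < volume.real Ω := ENNReal.toReal_pos
    (hΩ_open.measure_pos _ hconn.nonempty).ne' hΩ_bdd.measure_lt_top.ne
  set V := volume.real Ω
  have hν : 0 ≤ μ + lam := by
    rcases hN with rfl | rfl <;> push_cast at hlam <;> linarith
  -- A bound for the initial mass, from `r ≤ 1 + r ^ γ`; it is positive because `V` is.
  set A : ℝ := V + (R : ℝ) ^ γ with hA
  have hRγ : 0 ≤ (R : ℝ) ^ γ := by positivity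
  set F := (∫⁻ z in Set.Ioo 0 Tfin ×ˢ Ω, ‖f z.1 z.2‖ₑ ^ 2).toReal with hF
  set B : ℝ := 40 * (μ + lam) * ((γ - 1)⁻¹ * (a * (R : ℝ) ^ γ)) +
    40 * (K * (2 * ((N + 1) / (N ^ 2 * shapeConst N κ)))) * F +
    8 * V * pressure a γ (2 * A / V) ^ 2 * Tfin with hB
  have key : ∀ i, ∫⁻ z in Set.Ioo 0 Tfin ×ˢ Ω,
      ‖pressure a γ (densityFun (T i) (dt i) (ρ i) z.1 z.2)‖ₑ ^ 2 ≤ ENNReal.ofReal B := by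
    intro i
    -- `M i * dt i` is the positive final time, which excludes a nonpositive time step.
    have hdti : 0 < dt i := by
      by_contra! h
      have := mul_nonpos_of_nonneg_of_nonpos (Nat.cast_nonneg (α := ℝ) (M i)) h
      linarith [hM i]
    have hpos := (hsol i).initial_pos
    have hsum : ∑ s ∈ (T i).elements, volume.real (conv s) = V := Mesh.sum_volume_eq hΩ (T i)
    have hrpow := Mesh.sum_rpow_le hΩ (T i) (by linarith) hpos (hR i)
    have hmass : ∑ s ∈ (T i).elements, volume.real (conv s) * ρ i 0 s ≤ A := by
      rw [hA, ← hsum]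
      refine le_trans ?_ (add_le_add_right hrpow _)
      rw [← Finset.sum_add_distrib]
      refine Finset.sum_le_sum fun s hs => ?_
      have hle : ρ i 0 s ≤ 1 + ρ i 0 s ^ γ := by
        rcases le_total (ρ i 0 s) 1 with h | h
        · have := Real.rpow_nonneg (hpos s hs).le γ
          linarith
        · have := Real.self_le_rpow_of_one_le h hγ.le
          linarith
      have := mul_le_mul_of_nonneg_left hle (Mesh.vol_pos hs).le
      linarith
    have hmain := (hsol i).sum_pressure_sq_le hN hΩ_open ha hγ hν hκ (hT_reg i) hdti.le hK
      (hP (T i) (hT_reg i)) hsum hV (by positivity) hmass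
    have hsource := Mesh.sum_discreteSource_sq_le hΩ (T i) hdti (M i) (by rwa [hM i])
    have hpress := Mesh.lintegral_sq_pressure_le hΩ (T i) hdti (M i) (ρ i) a γ
    rw [hM i] at hmain hsource hpress
    refine hpress.trans (ENNReal.ofReal_le_ofReal (hmain.trans ?_))
    have hinit : ∑ s ∈ (T i).elements, volume.real (conv s) * pressure a γ (ρ i 0 s) ≤
        a * (R : ℝ) ^ γ := by
      refine le_trans (le_of_eq ?_) (mul_le_mul_of_nonneg_left hrpow ha.le)
      rw [Finset.mul_sum]
      exact Finset.sum_congr rfl fun s _ => by rw [pressure]; ring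
    have hγ' : 0 ≤ (γ - 1)⁻¹ := inv_nonneg.2 (by linarith)
    have hc := shapeConst_pos N hκ
    rw [hB]
    gcongr
  refine ⟨(B.toNNReal) ^ (1 / 2 : ℝ), fun i => ?_⟩
  have hle : eLpNorm (fun z : ℝ × Pt N => pressure a γ (densityFun (T i) (dt i) (ρ i) z.1 z.2)) 2
      (volume.restrict (Set.Ioo 0 Tfin ×ˢ Ω)) ≤ ((B.toNNReal ^ (1 / 2 : ℝ) : NNReal) : ENNReal) := by
    rw [eLpNorm_two_eq, ENNReal.coe_rpow_of_nonneg _ (by norm_num)]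
    exact ENNReal.rpow_le_rpow (key i) (by norm_num)
  refine ⟨⟨?_, hle.trans_lt ENNReal.coe_lt_top⟩, hle⟩
  have h := Mesh.measurable_densityFun (T i) (dt i) (ρ i)
  have hp : Measurable (pressure a γ) := by
    unfold pressure
    fun_prop
  exact (hp.comp h).aestronglyMeasurable
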